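/- Let $N\ge 0$ be an integer and let $x=(x_1,\dots,x_N)$ be distinct points of $\mathbb{Z}^2$. Let $X^{(1)},\dots,X^{(N)}$ be independent continuous-time simple random walks on $\mathbb{Z}^2$ with (right-continuous paths and) total jump rate one, i.e. each walk jumps at rate $1$ to a uniformly chosen nearest neighbour, started from $X^{(i)}_0=x_i$. Let $$\mathbf{p}_{\mathbf{NC}}(t)=\mathbb{P}\big[X^{(i)}_s\neq X^{(j)}_s \text{ for all } i\neq j \text{ and all } s\in[0,t]\big]$$ be the probability that no pair of walkers meets by time $t$. Then there is a constant $c_0(x)>0$, depending only on $N$ and $x$, such that $$\mathbf{p}_{\mathbf{NC}}(t)=c_0(x)\,(\log t)^{-\binom N2}\left(1+O\!\left(\frac{\log\log t}{\log t}\right)\right)\qquad\text{as } t\to\infty,$$ where the implied constant and the range of $t$ may depend on $N$ and $x$. -/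

import Mathlib

open MeasureTheory ProbabilityTheory Filter
open scoped NNReal Asymptotics

noncomputable section

/-- The law of one step of the simple random walk on `ℤ²`: uniform on the four nearest neighbours
of the origin. -/
def stepPMF : PMF (ℤ × ℤ) :=
  PMF.uniformOfFinset {(1, 0), (-1, 0), (0, 1), (0, -1)} (by simp)

/-- The law of the sum of `n` independent steps of the simple random walk on `ℤ²`. -/
def stepsPMF : ℕ → PMF (ℤ × ℤ)
  | 0 => PMF.pure 0
  | n + 1 => (stepsPMF n).bind fun y => stepPMF.map fun e => y + e

/-- The displacement over a time interval of length `t` of the continuous-time simple random walk on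
`ℤ²` that jumps at total rate one: the sum of a Poisson number, of mean `t`, of independent steps,
so that `srwLaw t {y} = ∑ n, e⁻ᵗ tⁿ / n! * P(S_n = y)`. -/
def srwLaw (t : ℝ≥0) : Measure (ℤ × ℤ) :=
  (poissonMeasure t).bind fun n => (stepsPMF n).toMeasure

/-- `X` is a rate one continuous-time simple random walk on `ℤ²` started at `x`: it starts at `x`,
has independent increments with the transition law of the walk, and almost surely has
right-continuous paths. (As `ℤ × ℤ` is discrete, right-continuity means that the walk stays for
some positive time at each position that it takes.) -/
structure IsSimpleRandomWalk {Ω : Type*} [MeasurableSpace Ω] (x : ℤ × ℤ)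
    (X : ℝ≥0 → Ω → ℤ × ℤ) (μ : Measure Ω) : Prop where
  measurable : ∀ t, Measurable (X t)
  start : ∀ᵐ ω ∂μ, X 0 ω = x
  indepIncrements : HasIndepIncrements X μ
  increment_law : ∀ s t, s ≤ t → HasLaw (fun ω => X t ω - X s ω) (srwLaw (t - s)) μ
  rightContinuous : ∀ᵐ ω ∂μ, ∀ t, ContinuousWithinAt (fun s => X s ω) (Set.Ici t) t

/-- `X` is a system of independent rate one simple random walks on `ℤ²`, the `i`-th of which starts
at `x i`. The independence is that of the whole processes. -/
structure IsIndepWalkSystem {Ω : Type*} [MeasurableSpace Ω] {N : ℕ} (x : Fin N → ℤ × ℤ)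
    (X : Fin N → ℝ≥0 → Ω → ℤ × ℤ) (μ : Measure Ω) : Prop where
  isWalk : ∀ i, IsSimpleRandomWalk (x i) (X i) μ
  indep : iIndepFun (fun i ω t => X i t ω) μ

/-- The probability that no two of the walkers are ever at the same site during `[0, t]`. -/
def nonCollisionProb {Ω : Type*} [MeasurableSpace Ω] {N : ℕ}
    (X : Fin N → ℝ≥0 → Ω → ℤ × ℤ) (μ : Measure Ω) (t : ℝ≥0) : ℝ :=
  μ.real {ω | ∀ i j, i ≠ j → ∀ s ≤ t, X i s ω ≠ X j s ω}

end

/-!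
The positions of the `N` walkers form a configuration, and the skeleton of its jumps is the chain in
which a uniformly chosen token makes a simple random walk step. Let `d = N.choose 2`.

**The weight.** The potential kernel `a` of the simple random walk on `ℤ²` vanishes at `0`, is
harmonic elsewhere, has increments of order `1 / ‖z‖` and equals `(1 / π) log ‖z‖ + O(1)`
(`PotentialKernel.abs_potential_sub_log_le`; it is defined by an explicit integral). The product
`potentialProd` of `a` over the differences of all pairs of tokens vanishes at collisions.
When one token moves, the terms of first order of this product cancel by harmonicity, so on
collision-free configurations the product is harmonic up to the terms of second order, in which
two different factors change. Their expectation is of order `1 / n` at time `n` by heat kernel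
bounds, apart from powers of `log n`.

**The discrete asymptotics.** Let `weighted` be the expectation of `potentialProd` at time `n` on
the event that there was no collision, and `survival` the probability of this event. With high
probability all distances are `√n` up to powers of `log n`, where `potentialProd` is
`((1 / (2 π)) log n) ^ d` up to a factor `1 + O(log log n / log n)`; this bounds each of `weighted`
and `survival` by the other (`eventually_survival_le`, `eventually_weighted_le`). By the Markov
property at time `n / 2`, the increment of `weighted` at `n` is therefore at most a multiple of
`(weighted + 1) / (n (log n) ^ 2)`, with `weighted` at time `n / 2`. Since `1 / (n (log n) ^ 2)` is
summable, with tails of order `1 / log n`, `weighted` converges at the rate `1 / log n`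
(`exists_weighted_limit`). Its limit is positive: if the tokens first move freely for a long time
`T`, then `weighted` starts at the order of `(log T) ^ d` and cannot lose this value
(`exists_le_weighted`); and since all collision-free configurations communicate
(`survivalEquiv_of_mem`), survival from the given configuration is comparable to survival after this
free period. This gives `survival ∼ c₀ (log n) ^ (-d)` (`exists_survival_asymptotics`).

**Continuous time.** The number of jumps until time `t` is Poisson with mean `N t`. As it is
concentrated and `survival` is monotone in `n`, the asymptotics carry over
(`exists_poissonized_asymptotics`). That the walks of the statement survive with the Poisson mixture
of the discrete survival probabilities (`nonCollisionProb_eq_contSurvival`) is seen on dyadic time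
grids: right-continuity reduces the event to these, the grid probability is an iterate of the
operator `gridStep`, and over a time `δ` both this operator and the Poisson mixture agree with at
most one jump of the chain up to `O(δ ^ 2)`.
-/

/-! ### Averaging operators of the jump chain -/

/-- The four unit steps of the simple random walk on `ℤ²`. -/
def latticeSteps : Finset (ℤ × ℤ) := {(1, 0), (-1, 0), (0, 1), (0, -1)}

lemma sum_latticeSteps {M : Type*} [AddCommMonoid M] (f : ℤ × ℤ → M) :
    ∑ e ∈ latticeSteps, f e = f (1, 0) + f (-1, 0) + f (0, 1) + f (0, -1) := by
  rw [latticeSteps, Finset.sum_insert (by decide), Finset.sum_insert (by decide),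
    Finset.sum_insert (by decide), Finset.sum_singleton]
  simp only [add_assoc]

lemma card_latticeSteps : latticeSteps.card = 4 := by decide

lemma norm_le_one_of_mem_latticeSteps {e : ℤ × ℤ} (he : e ∈ latticeSteps) : ‖e‖ ≤ 1 := by
  simp only [latticeSteps, Finset.mem_insert, Finset.mem_singleton] at he
  rcases he with rfl | rfl | rfl | rfl <;> simp [Prod.norm_def]

/-- The Markov operator of one step of the simple random walk on `ℤ²`. -/
noncomputable def planeAvg : Module.End ℝ (ℤ × ℤ → ℝ) where
  toFun f z := (1 / 4) * ∑ e ∈ latticeSteps, f (z + e)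
  map_add' f g := by
    funext z; simp only [Pi.add_apply, Finset.sum_add_distrib]; ring
  map_smul' c f := by
    funext z; simp only [Pi.smul_apply, smul_eq_mul, RingHom.id_apply, ← Finset.mul_sum]; ring

lemma planeAvg_apply (f : ℤ × ℤ → ℝ) (z : ℤ × ℤ) :
    planeAvg f z = (1 / 4) * ∑ e ∈ latticeSteps, f (z + e) := rfl

/-- A linear operator on functions is `K`-bounded above if it maps functions that are at most `c`
to functions that are at most `K * c`. For a positive operator this says that it maps the constant
function `1` to `K`; for a Markov operator, `K = 1`. -/
def SupBounded {α : Type*} (A : Module.End ℝ (α → ℝ)) (K : ℝ) : Prop :=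
  ∀ (f : α → ℝ) (c : ℝ), (∀ y, f y ≤ c) → ∀ y, A f y ≤ K * c

namespace SupBounded

variable {α : Type*} {A B : Module.End ℝ (α → ℝ)} {K L : ℝ}

lemma one : SupBounded (1 : Module.End ℝ (α → ℝ)) 1 := fun f c h y => by simpa using h y

lemma zero : SupBounded (0 : Module.End ℝ (α → ℝ)) 0 := fun f c h y => by simp

lemma add (hA : SupBounded A K) (hB : SupBounded B L) : SupBounded (A + B) (K + L) :=
  fun f c h y => by
    have := hA f c h y
    have := hB f c h y
    simp only [LinearMap.add_apply, Pi.add_apply]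
    linarith

lemma mul (hA : SupBounded A K) (hB : SupBounded B L) : SupBounded (A * B) (K * L) :=
  fun f c h y => by
    rw [mul_assoc]
    exact hA (B f) (L * c) (hB f c h) y

lemma pow (hA : SupBounded A K) : ∀ n : ℕ, SupBounded (A ^ n) (K ^ n)
  | 0 => by simpa using one
  | n + 1 => by
    rw [pow_succ, pow_succ]
    exact (pow hA n).mul hA

lemma smul (hA : SupBounded A K) {a : ℝ} (ha : 0 ≤ a) : SupBounded (a • A) (a * K) :=
  fun f c h y => by
    simp only [LinearMap.smul_apply, Pi.smul_apply, smul_eq_mul, mul_assoc]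
    exact mul_le_mul_of_nonneg_left (hA f c h y) ha

lemma sum {ι : Type*} (s : Finset ι) {A : ι → Module.End ℝ (α → ℝ)} {K : ι → ℝ}
    (h : ∀ i ∈ s, SupBounded (A i) (K i)) : SupBounded (∑ i ∈ s, A i) (∑ i ∈ s, K i) := by
  classical
  induction s using Finset.induction_on with
  | empty => simpa using zero
  | insert a s ha ih =>
    rw [Finset.sum_insert ha, Finset.sum_insert ha]
    exact (h a (by simp)).add (ih fun i hi => h i (by simp [hi]))

lemma mono (hA : SupBounded A K) {f g : α → ℝ} (h : ∀ y, f y ≤ g y) (y : α) : A f y ≤ A g y := by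
  have := hA (f - g) 0 (fun y => by simpa using h y) y
  simpa using this

lemma nonneg (hA : SupBounded A K) {f : α → ℝ} (h : ∀ y, 0 ≤ f y) (y : α) : 0 ≤ A f y := by
  simpa using hA.mono (f := 0) (g := f) h y

/-- Binomial expansion of `(A + B) ^ n` when the iterates of `A` on `f` are controlled. -/
lemma add_pow_apply_le (hB : SupBounded B L) (hc : Commute A B) {f : α → ℝ}
    {c : ℕ → ℝ} (h : ∀ k y, (A ^ k) f y ≤ c k) (n : ℕ) (y : α) :
    ((A + B) ^ n) f y ≤ ∑ k ∈ Finset.range (n + 1), (n.choose k : ℝ) * L ^ (n - k) * c k := by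
  rw [hc.add_pow, LinearMap.sum_apply, Finset.sum_apply]
  refine Finset.sum_le_sum fun k _ => ?_
  rw [(hc.pow_pow k (n - k)).eq, ← nsmul_eq_mul', LinearMap.smul_apply, Pi.smul_apply,
    nsmul_eq_mul, mul_assoc]
  exact mul_le_mul_of_nonneg_left ((hB.pow (n - k)) _ _ (h k) y) (Nat.cast_nonneg _)

end SupBounded

lemma planeAvg_supBounded : SupBounded planeAvg 1 := fun f c h z => by
  rw [planeAvg_apply, sum_latticeSteps]
  linarith [h (z + (1, 0)), h (z + (-1, 0)), h (z + (0, 1)), h (z + (0, -1))]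

/-- A configuration of `N` labelled tokens on `ℤ²`. -/
abbrev Config (N : ℕ) := Fin N → ℤ × ℤ

/-- The average over the four moves of the `i`-th token. -/
noncomputable def tokenAvg {N : ℕ} (i : Fin N) : Module.End ℝ (Config N → ℝ) where
  toFun f y := (1 / 4) * ∑ e ∈ latticeSteps, f (y + Pi.single i e)
  map_add' f g := by
    funext z; simp only [Pi.add_apply, Finset.sum_add_distrib]; ring
  map_smul' c f := by
    funext z; simp only [Pi.smul_apply, smul_eq_mul, RingHom.id_apply, ← Finset.mul_sum]; ring

lemma tokenAvg_apply {N : ℕ} (i : Fin N) (f : Config N → ℝ) (y : Config N) :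
    tokenAvg i f y = (1 / 4) * ∑ e ∈ latticeSteps, f (y + Pi.single i e) := rfl

lemma tokenAvg_supBounded {N : ℕ} (i : Fin N) : SupBounded (tokenAvg i) 1 := fun f c h y => by
  rw [tokenAvg_apply, sum_latticeSteps]
  linarith [h (y + Pi.single i (1, 0)), h (y + Pi.single i (-1, 0)), h (y + Pi.single i (0, 1)),
    h (y + Pi.single i (0, -1))]

lemma tokenAvg_commute {N : ℕ} (i j : Fin N) : Commute (tokenAvg i) (tokenAvg j) := by
  ext f y
  simp only [Module.End.mul_apply, tokenAvg_apply, sum_latticeSteps, add_assoc,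
    add_comm (Pi.single i _) (Pi.single j _)]
  ring

/-- The Markov operator of the jump chain of `N` independent walks: a uniformly chosen token makes
one simple random walk step. -/
noncomputable def stepAvg (N : ℕ) : Module.End ℝ (Config N → ℝ) :=
  (1 / N : ℝ) • ∑ i, tokenAvg i

lemma stepAvg_apply {N : ℕ} (f : Config N → ℝ) (y : Config N) :
    stepAvg N f y = (1 / N : ℝ) * ∑ i, tokenAvg i f y := by
  simp [stepAvg, LinearMap.sum_apply, Finset.sum_apply]

lemma stepAvg_supBounded {N : ℕ} [NeZero N] : SupBounded (stepAvg N) 1 := by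
  have h := (SupBounded.sum Finset.univ fun i (_ : i ∈ Finset.univ) =>
    tokenAvg_supBounded (N := N) i).smul (a := 1 / (N : ℝ)) (by positivity)
  have hN : (N : ℝ) ≠ 0 := Nat.cast_ne_zero.2 (NeZero.ne N)
  rw [Finset.sum_const, Finset.card_univ, Fintype.card_fin, nsmul_eq_mul, mul_one,
    one_div_mul_cancel hN] at h
  exact h

lemma stepAvg_one {N : ℕ} [NeZero N] : stepAvg N (fun _ => 1) = fun _ => 1 := by
  have hN : (N : ℝ) ≠ 0 := Nat.cast_ne_zero.2 (NeZero.ne N)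
  funext y
  simp only [stepAvg_apply, tokenAvg_apply, card_latticeSteps, Finset.sum_const, Finset.card_univ,
    Fintype.card_fin, nsmul_eq_mul]
  field_simp
  norm_num

lemma sum_choose_mul_pow_div {K : ℝ} (hK : 0 ≤ K) (n : ℕ) :
    ∑ k ∈ Finset.range (n + 1), (n.choose k : ℝ) * K ^ (n - k) * (1 / (k + 1)) ≤
      (K + 1) ^ (n + 1) / (n + 1) := by
  have h : ∀ k ∈ Finset.range (n + 1), (n.choose k : ℝ) * K ^ (n - k) * (1 / (k + 1)) =
      ((n + 1).choose (k + 1) : ℝ) * K ^ (n + 1 - (k + 1)) / (n + 1) := by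
    intro k _
    have := Nat.add_one_mul_choose_eq n k
    have h2 : ((n : ℝ) + 1) * n.choose k = (n + 1).choose (k + 1) * (k + 1) := by
      exact_mod_cast this
    rw [Nat.add_sub_add_right]
    field_simp
    linear_combination K ^ (n - k) * h2
  rw [Finset.sum_congr rfl h, ← Finset.sum_div]
  gcongr
  rw [add_comm K 1, add_pow, Finset.sum_range_succ' _ (n + 1)]
  simp only [one_pow, one_mul]
  have : 0 ≤ K ^ (n + 1 - 0) * ((n + 1).choose 0 : ℝ) := by positivity
  refine le_trans (le_of_eq (Finset.sum_congr rfl fun k _ => by ring)) (le_add_of_nonneg_right this)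

/-- If `k` moves of the `j`-th token alone bring the supremum of `f` down to `c / (k + 1)`, then `n`
steps of the chain bring it down to `N * c / (n + 1)`: the number of moves of token `j` is binomial
and `E[1 / (Bin(n, 1 / N) + 1)] ≤ N / (n + 1)`. -/
lemma stepAvg_pow_le_of_tokenAvg {N : ℕ} [NeZero N] (j : Fin N) {f : Config N → ℝ} {c : ℝ}
    (hc : 0 ≤ c) (h : ∀ (k : ℕ) y, ((tokenAvg j) ^ k) f y ≤ c * (1 / (k + 1))) (n : ℕ)
    (y : Config N) : ((stepAvg N) ^ n) f y ≤ N * c / (n + 1) := by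
  have hN1 : (1 : ℝ) ≤ N := by exact_mod_cast NeZero.one_le
  have hR : SupBounded (∑ i ∈ Finset.univ.erase j, tokenAvg i) ((N : ℝ) - 1) := by
    have := SupBounded.sum (Finset.univ.erase j) fun i (_ : i ∈ Finset.univ.erase j) =>
      tokenAvg_supBounded (N := N) i
    rw [Finset.sum_const, Finset.card_erase_of_mem (Finset.mem_univ j)] at this
    simpa [Nat.cast_sub (show 1 ≤ N from NeZero.one_le)] using this
  have hcomm : Commute (tokenAvg j) (∑ i ∈ Finset.univ.erase j, tokenAvg i) :=
    Commute.sum_right _ _ _ fun i _ => tokenAvg_commute j i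
  have hs : stepAvg N = (1 / N : ℝ) • (tokenAvg j + ∑ i ∈ Finset.univ.erase j, tokenAvg i) := by
    rw [Finset.add_sum_erase _ _ (Finset.mem_univ j)]; rfl
  have key := hR.add_pow_apply_le hcomm h n y
  rw [hs, smul_pow, LinearMap.smul_apply, Pi.smul_apply, smul_eq_mul]
  have h2 := sum_choose_mul_pow_div (K := (N : ℝ) - 1) (by linarith) n
  have h3 : ∑ k ∈ Finset.range (n + 1), (n.choose k : ℝ) * ((N : ℝ) - 1) ^ (n - k) *
      (c * (1 / (k + 1))) ≤ c * ((N : ℝ) ^ (n + 1) / (n + 1)) := by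
    rw [sub_add_cancel] at h2
    refine le_trans (le_of_eq ?_) (mul_le_mul_of_nonneg_left h2 hc)
    rw [Finset.mul_sum]
    exact Finset.sum_congr rfl fun k _ => by ring
  calc (1 / (N : ℝ)) ^ n * _ ≤ (1 / (N : ℝ)) ^ n * (c * ((N : ℝ) ^ (n + 1) / (n + 1))) := by
        gcongr; exact key.trans h3
    _ = N * c / (n + 1) := by
        rw [one_div, inv_pow, pow_succ]; field_simp

/-- The analogue of `stepAvg_pow_le_of_tokenAvg` for two tokens. -/
lemma stepAvg_pow_le_of_tokenAvg_tokenAvg {N : ℕ} [NeZero N] {j k : Fin N} (hjk : j ≠ k)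
    {f : Config N → ℝ} {c : ℝ} (hc : 0 ≤ c)
    (h : ∀ (p q : ℕ) y, ((tokenAvg k) ^ q) (((tokenAvg j) ^ p) f) y ≤
      c * (1 / (p + 1) + 1 / (q + 1))) (n : ℕ)
    (y : Config N) : ((stepAvg N) ^ n) f y ≤ 2 * N * c / (n + 1) := by
  have hN2 : (2 : ℝ) ≤ N := by
    have : 2 ≤ N := by
      have h1 := j.2; have h2 := k.2
      have h3 : (j : ℕ) ≠ k := fun h => hjk (Fin.ext h)
      omega
    exact_mod_cast this
  set S : Finset (Fin N) := (Finset.univ.erase j).erase k with hS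
  have hkj : k ∈ Finset.univ.erase j := by simp [hjk.symm]
  have hR : SupBounded (∑ i ∈ S, tokenAvg i) ((N : ℝ) - 2) := by
    have := SupBounded.sum S fun i (_ : i ∈ S) => tokenAvg_supBounded (N := N) i
    have hcard : S.card = N - 2 := by
      rw [hS, Finset.card_erase_of_mem hkj, Finset.card_erase_of_mem (Finset.mem_univ j)]
      simp [Nat.sub_sub]
    rw [Finset.sum_const, hcard] at this
    simpa [Nat.cast_sub (show 2 ≤ N by exact_mod_cast hN2)] using this
  have hcomm : Commute (tokenAvg k) (∑ i ∈ S, tokenAvg i) :=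
    Commute.sum_right _ _ _ fun i _ => tokenAvg_commute k i
  have hcomm' : Commute (tokenAvg j) (tokenAvg k + ∑ i ∈ S, tokenAvg i) :=
    (tokenAvg_commute j k).add_right (Commute.sum_right _ _ _ fun i _ => tokenAvg_commute j i)
  have hs : stepAvg N = (1 / N : ℝ) • (tokenAvg j + (tokenAvg k + ∑ i ∈ S, tokenAvg i)) := by
    rw [Finset.add_sum_erase _ _ hkj, Finset.add_sum_erase _ _ (Finset.mem_univ j)]; rfl
  -- the bound after `m` moves of tokens other than `j`
  have hQ : ∀ (p m : ℕ) y, ((tokenAvg k + ∑ i ∈ S, tokenAvg i) ^ m) (((tokenAvg j) ^ p) f) y ≤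
      c * ((N - 1) ^ m * (1 / (p + 1)) + (N - 1) ^ (m + 1) / (m + 1)) := by
    intro p m y
    refine (hR.add_pow_apply_le hcomm (h p) m y).trans ?_
    have h2 := sum_choose_mul_pow_div (K := (N : ℝ) - 2) (by linarith) m
    have h3 : ∑ q ∈ Finset.range (m + 1), (m.choose q : ℝ) * ((N : ℝ) - 2) ^ (m - q) =
        (N - 1) ^ m := by
      rw [show (N : ℝ) - 1 = 1 + (N - 2) by ring, add_pow]
      exact Finset.sum_congr rfl fun q _ => by ring
    rw [show (N : ℝ) - 2 + 1 = N - 1 by ring] at h2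
    rw [← h3]
    calc _ = c * ((∑ q ∈ Finset.range (m + 1), (m.choose q : ℝ) * ((N : ℝ) - 2) ^ (m - q)) *
          (1 / (p + 1)) + ∑ q ∈ Finset.range (m + 1),
          (m.choose q : ℝ) * ((N : ℝ) - 2) ^ (m - q) * (1 / (q + 1))) := by
          rw [Finset.sum_mul, ← Finset.sum_add_distrib, Finset.mul_sum]
          exact Finset.sum_congr rfl fun q _ => by ring
      _ ≤ _ := by gcongr
  have hexp : ((tokenAvg j + (tokenAvg k + ∑ i ∈ S, tokenAvg i)) ^ n) f y ≤
      ∑ p ∈ Finset.range (n + 1), (n.choose p : ℝ) *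
        (c * ((N - 1) ^ (n - p) * (1 / (p + 1)) + (N - 1) ^ (n - p + 1) / ((n - p : ℕ) + 1))) := by
    rw [hcomm'.add_pow, LinearMap.sum_apply, Finset.sum_apply]
    refine Finset.sum_le_sum fun p _ => ?_
    rw [(hcomm'.pow_pow p (n - p)).eq, ← nsmul_eq_mul', LinearMap.smul_apply, Pi.smul_apply,
      nsmul_eq_mul]
    exact mul_le_mul_of_nonneg_left (hQ p (n - p) y) (Nat.cast_nonneg _)
  have h1 := sum_choose_mul_pow_div (K := (N : ℝ) - 1) (by linarith) n
  have h2 : ∑ p ∈ Finset.range (n + 1), (n.choose p : ℝ) *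
      ((N - 1) ^ (n - p + 1) / ((n - p : ℕ) + 1)) ≤ (N : ℝ) ^ (n + 1) / (n + 1) := by
    rw [← Finset.sum_range_reflect]
    have : ∀ p ∈ Finset.range (n + 1), (n.choose (n + 1 - 1 - p) : ℝ) *
        (((N : ℝ) - 1) ^ (n - (n + 1 - 1 - p) + 1) / ((n - (n + 1 - 1 - p) : ℕ) + 1)) =
        ((n + 1).choose (p + 1) : ℝ) * (N - 1) ^ (p + 1) / (n + 1) := by
      intro p hp
      have hp' : p ≤ n := by simpa [Nat.lt_succ_iff] using hp
      rw [show n + 1 - 1 - p = n - p by omega, show n - (n - p) = p by omega, Nat.choose_symm hp']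
      have h2 : ((n : ℝ) + 1) * n.choose p = (n + 1).choose (p + 1) * (p + 1) := by
        exact_mod_cast Nat.add_one_mul_choose_eq n p
      field_simp
      linear_combination ((N : ℝ) - 1) ^ (p + 1) * h2
    rw [Finset.sum_congr rfl this, ← Finset.sum_div]
    gcongr
    conv_rhs => rw [show (N : ℝ) = (N - 1) + 1 by ring, add_pow, Finset.sum_range_succ' _ (n + 1)]
    simp only [one_pow, mul_one]
    have : 0 ≤ ((N : ℝ) - 1) ^ 0 * ((n + 1).choose 0 : ℝ) := by positivity
    refine le_trans (le_of_eq (Finset.sum_congr rfl fun k _ => by ring))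
      (le_add_of_nonneg_right this)
  rw [sub_add_cancel] at h1
  rw [hs, smul_pow, LinearMap.smul_apply, Pi.smul_apply, smul_eq_mul]
  calc (1 / (N : ℝ)) ^ n * _
      ≤ (1 / (N : ℝ)) ^ n * (c * (2 * ((N : ℝ) ^ (n + 1) / (n + 1)))) := by
        gcongr
        refine hexp.trans ?_
        rw [two_mul]
        refine le_trans (le_of_eq ?_) (mul_le_mul_of_nonneg_left (add_le_add h1 h2) hc)
        rw [← Finset.sum_add_distrib, Finset.mul_sum]
        exact Finset.sum_congr rfl fun p _ => by ring
    _ = 2 * N * c / (n + 1) := by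
        rw [one_div, inv_pow, pow_succ]; field_simp

/-! ### Heat kernel bounds for the simple random walk -/

/-- The Markov operator of the `±1` walk on `ℤ`. -/
noncomputable def flipAvg : Module.End ℝ (ℤ → ℝ) where
  toFun f u := (f (u + 1) + f (u - 1)) / 2
  map_add' f g := by funext z; simp only [Pi.add_apply]; ring
  map_smul' c f := by funext z; simp only [Pi.smul_apply, smul_eq_mul, RingHom.id_apply]; ring

lemma flipAvg_apply (f : ℤ → ℝ) (u : ℤ) : flipAvg f u = (f (u + 1) + f (u - 1)) / 2 := rfl

lemma flipAvg_supBounded : SupBounded flipAvg 1 := fun f c h u => by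
  rw [flipAvg_apply]
  linarith [h (u + 1), h (u - 1)]

lemma funLeft_add_pow_apply (c : ℤ) (k : ℕ) (f : ℤ → ℝ) (u : ℤ) :
    ((LinearMap.funLeft ℝ ℝ (· + c) : Module.End ℝ (ℤ → ℝ)) ^ k) f u = f (u + k * c) := by
  induction k generalizing u with
  | zero => simp
  | succ k ih =>
    rw [pow_succ', Module.End.mul_apply, LinearMap.funLeft_apply, ih]
    congr 1
    push_cast
    ring

lemma flipAvg_pow_apply (n : ℕ) (f : ℤ → ℝ) (u : ℤ) :
    (flipAvg ^ n) f u =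
      ∑ k ∈ Finset.range (n + 1), (n.choose k : ℝ) / 2 ^ n * f (u + (2 * k - n)) := by
  have h : flipAvg = (1 / 2 : ℝ) • ((LinearMap.funLeft ℝ ℝ (· + 1) : Module.End ℝ (ℤ → ℝ)) +
      (LinearMap.funLeft ℝ ℝ (· + (-1)) : Module.End ℝ (ℤ → ℝ))) := by
    ext f u
    simp [flipAvg_apply, sub_eq_add_neg]
    ring
  have hc : Commute (LinearMap.funLeft ℝ ℝ (· + 1) : Module.End ℝ (ℤ → ℝ))
      (LinearMap.funLeft ℝ ℝ (· + (-1)) : Module.End ℝ (ℤ → ℝ)) := by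
    ext f u
    simp [LinearMap.funLeft_apply]
  rw [h, smul_pow, hc.add_pow, LinearMap.smul_apply, Pi.smul_apply, LinearMap.sum_apply,
    Finset.sum_apply, smul_eq_mul, Finset.mul_sum]
  refine Finset.sum_congr rfl fun k hk => ?_
  have hk' : k ≤ n := by simpa [Nat.lt_succ_iff] using hk
  rw [← nsmul_eq_mul', LinearMap.smul_apply, Pi.smul_apply, nsmul_eq_mul, Module.End.mul_apply,
    funLeft_add_pow_apply, funLeft_add_pow_apply, Nat.cast_sub hk',
    show u + (k : ℤ) * 1 + ((n : ℤ) - k) * (-1) = u + (2 * k - n) by ring, one_div, inv_pow]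
  ring

lemma centralBinom_div_le (n : ℕ) : (n.centralBinom : ℝ) / 4 ^ n ≤ 1 / √(2 * n + 1) := by
  have key : ((n.centralBinom : ℝ) / 4 ^ n) ^ 2 * (2 * n + 1) ≤ 1 := by
    induction n with
    | zero => simp
    | succ n ih =>
      have h : ((n + 1).centralBinom : ℝ) = 2 * (2 * n + 1) * n.centralBinom / (n + 1) := by
        rw [eq_div_iff (by positivity)]
        exact_mod_cast (by linarith [Nat.succ_mul_centralBinom_succ n] :
          (n + 1).centralBinom * (n + 1) = 2 * (2 * n + 1) * n.centralBinom)
      have h2 : (((n + 1).centralBinom : ℝ) / 4 ^ (n + 1)) ^ 2 * (2 * (n + 1 : ℕ) + 1) =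
          ((n.centralBinom : ℝ) / 4 ^ n) ^ 2 * (2 * n + 1) *
            ((2 * n + 1) * (2 * n + 3) / (4 * (n + 1) ^ 2)) := by
        rw [h, pow_succ]; push_cast; field_simp; ring
      rw [h2]
      refine mul_le_one₀ ih (by positivity) ?_
      rw [div_le_one (by positivity)]
      nlinarith
  rw [le_div_iff₀ (by positivity)]
  refine abs_le_one_iff_mul_self_le_one.2 ?_ |> le_of_abs_le
  calc _ = ((n.centralBinom : ℝ) / 4 ^ n) ^ 2 * (√(2 * n + 1) * √(2 * n + 1)) := by ring
    _ ≤ 1 := by rwa [Real.mul_self_sqrt (by positivity)]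

lemma choose_div_two_pow_le (n k : ℕ) : (n.choose k : ℝ) / 2 ^ n ≤ 1 / √(n + 1) := by
  have h1 : (n.choose k : ℝ) / 2 ^ n ≤ (n.choose (n / 2) : ℝ) / 2 ^ n := by
    gcongr
    exact_mod_cast Nat.choose_le_middle k n
  refine h1.trans ?_
  obtain ⟨m, rfl | rfl⟩ := Nat.even_or_odd' n
  · rw [Nat.mul_div_cancel_left m (by norm_num), ← Nat.centralBinom_eq_two_mul_choose, pow_mul]
    have := centralBinom_div_le m
    push_cast
    norm_num at this ⊢
    exact this
  · have h2 : ((2 * m + 1).choose ((2 * m + 1) / 2) : ℝ) = (m + 1).centralBinom / 2 := by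
      rw [show (2 * m + 1) / 2 = m by omega, Nat.centralBinom_eq_two_mul_choose,
        show 2 * (m + 1) = 2 * m + 1 + 1 by ring, Nat.choose_succ_succ' (2 * m + 1) m,
        Nat.choose_symm_half]
      push_cast; ring
    have h3 := centralBinom_div_le (m + 1)
    calc _ = ((m + 1).centralBinom : ℝ) / 4 ^ (m + 1) := by
          rw [h2, div_div]; congr 1
          rw [show (4 : ℝ) = 2 ^ 2 by norm_num, ← pow_mul]; ring
      _ ≤ 1 / √(2 * (m + 1 : ℕ) + 1) := h3
      _ ≤ _ := by
          gcongr
          push_cast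
          linarith

/-- The local limit bound `(n + 1) ^ (-1/2)` on the transition probabilities of the `±1` walk,
integrated against a function. -/
lemma flipAvg_pow_le {φ : ℤ → ℝ} (hφ : ∀ w, 0 ≤ φ w) {r : ℕ} {M : ℝ} (hM0 : 0 ≤ M)
    (hM : ∀ w : ℤ, r < w.natAbs → φ w ≤ M) (n : ℕ) (u : ℤ) :
    (flipAvg ^ n) φ u ≤ (∑ w ∈ Finset.Icc (-r : ℤ) r, φ w) / √(n + 1) + M := by
  have h : ∀ w, φ w ≤ (if w ∈ Finset.Icc (-r : ℤ) r then φ w else 0) + M := by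
    intro w
    split_ifs with hw
    · linarith
    · rw [zero_add]
      refine hM w ?_
      rw [Finset.mem_Icc] at hw
      omega
  refine ((flipAvg_supBounded.pow n).mono h u).trans ?_
  have h2 : (fun w => (if w ∈ Finset.Icc (-r : ℤ) r then φ w else 0) + M) =
      (fun w => if w ∈ Finset.Icc (-r : ℤ) r then φ w else 0) + fun _ => M := rfl
  rw [h2, map_add, Pi.add_apply]
  refine add_le_add ?_ ?_
  · rw [flipAvg_pow_apply]
    calc _ ≤ ∑ k ∈ Finset.range (n + 1), 1 / √(n + 1) *
          (if u + (2 * (k : ℤ) - n) ∈ Finset.Icc (-r : ℤ) r then φ (u + (2 * k - n)) else 0) := by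
          refine Finset.sum_le_sum fun k _ => ?_
          refine mul_le_mul_of_nonneg_right (choose_div_two_pow_le n k) ?_
          split_ifs
          exacts [hφ _, le_rfl]
      _ = (∑ k ∈ (Finset.range (n + 1)).filter
            (fun k : ℕ => u + (2 * (k : ℤ) - n) ∈ Finset.Icc (-r : ℤ) r),
            φ (u + (2 * k - n))) / √(n + 1) := by
          rw [← Finset.mul_sum, Finset.sum_filter]; ring
      _ ≤ _ := by
          gcongr
          rw [← Finset.sum_image (f := φ) (g := fun k : ℕ => u + (2 * (k : ℤ) - n))
            (fun a _ b _ hab => by simp only at hab; omega)]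
          refine Finset.sum_le_sum_of_subset_of_nonneg ?_ fun _ _ _ => hφ _
          intro w hw
          simp only [Finset.mem_image, Finset.mem_filter] at hw
          obtain ⟨k, hk, rfl⟩ := hw
          exact hk.2
  · simpa using (flipAvg_supBounded.pow n) (fun _ => M) M (fun _ => le_rfl) u

/-- In the rotated coordinates `z.1 + z.2` and `z.1 - z.2` the simple random walk on `ℤ²` is a pair
of independent `±1` walks. -/
lemma planeAvg_pow_prod (φ ψ : ℤ → ℝ) (n : ℕ) (z : ℤ × ℤ) :
    (planeAvg ^ n) (fun z => φ (z.1 + z.2) * ψ (z.1 - z.2)) z =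
      (flipAvg ^ n) φ (z.1 + z.2) * (flipAvg ^ n) ψ (z.1 - z.2) := by
  induction n generalizing z with
  | zero => simp
  | succ n ih =>
    rw [pow_succ', pow_succ', Module.End.mul_apply, Module.End.mul_apply, Module.End.mul_apply,
      planeAvg_apply, sum_latticeSteps, flipAvg_apply, flipAvg_apply, ih, ih, ih, ih]
    simp only [Prod.fst_add, Prod.snd_add, add_zero]
    rw [show z.1 + 1 + z.2 = z.1 + z.2 + 1 by ring, show z.1 + 1 - z.2 = z.1 - z.2 + 1 by ring,
      show z.1 + -1 + z.2 = z.1 + z.2 - 1 by ring, show z.1 + -1 - z.2 = z.1 - z.2 - 1 by ring,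
      show z.1 + (z.2 + 1) = z.1 + z.2 + 1 by ring, show z.1 - (z.2 + 1) = z.1 - z.2 - 1 by ring,
      show z.1 + (z.2 + -1) = z.1 + z.2 - 1 by ring, show z.1 - (z.2 + -1) = z.1 - z.2 + 1 by ring]
    ring

lemma natAbs_le_two_mul_norm (z : ℤ × ℤ) :
    ((z.1 + z.2).natAbs : ℝ) ≤ 2 * ‖z‖ ∧ ((z.1 - z.2).natAbs : ℝ) ≤ 2 * ‖z‖ := by
  have h1 : |(z.1 : ℝ)| ≤ ‖z‖ := by simpa [Int.norm_eq_abs] using norm_fst_le z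
  have h2 : |(z.2 : ℝ)| ≤ ‖z‖ := by simpa [Int.norm_eq_abs] using norm_snd_le z
  simp only [Nat.cast_natAbs, Int.cast_abs, Int.cast_add, Int.cast_sub]
  exact ⟨(abs_add_le _ _).trans (by linarith), (abs_sub _ _).trans (by linarith)⟩

/-- The probability that the simple random walk is in a ball of radius `r` after `n` steps. -/
lemma planeAvg_pow_ball_le (r n : ℕ) (z : ℤ × ℤ) :
    (planeAvg ^ n) (Set.indicator {z | ‖z‖ ≤ r} 1) z ≤ (4 * r + 1) ^ 2 * (1 / (n + 1)) := by
  set φ : ℤ → ℝ := fun w => if w.natAbs ≤ 2 * r then 1 else 0 with hφ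
  have hφ0 : ∀ w, 0 ≤ φ w := fun w => by rw [hφ]; dsimp only; split_ifs <;> norm_num
  have h1 : ∀ z : ℤ × ℤ, Set.indicator {z : ℤ × ℤ | ‖z‖ ≤ r} (1 : ℤ × ℤ → ℝ) z ≤
      φ (z.1 + z.2) * φ (z.1 - z.2) := by
    intro z
    refine Set.indicator_apply_le' (fun hz => ?_) (fun _ => mul_nonneg (hφ0 _) (hφ0 _))
    obtain ⟨ha, hb⟩ := natAbs_le_two_mul_norm z
    have hz' : ‖z‖ ≤ r := hz
    have ha' : (z.1 + z.2).natAbs ≤ 2 * r := by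
      have : ((z.1 + z.2).natAbs : ℝ) ≤ 2 * r := by linarith
      exact_mod_cast this
    have hb' : (z.1 - z.2).natAbs ≤ 2 * r := by
      have : ((z.1 - z.2).natAbs : ℝ) ≤ 2 * r := by linarith
      exact_mod_cast this
    simp [hφ, ha', hb']
  refine ((planeAvg_supBounded.pow n).mono h1 z).trans ?_
  rw [planeAvg_pow_prod]
  have h2 : ∀ u, (flipAvg ^ n) φ u ≤ (4 * r + 1) / √(n + 1) := by
    intro u
    refine (flipAvg_pow_le hφ0 (r := 2 * r) (M := 0) le_rfl (fun w hw => ?_) n u).trans ?_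
    · simp [hφ, not_le.2 hw]
    · rw [add_zero]
      gcongr
      calc ∑ w ∈ Finset.Icc (-(2 * r : ℕ) : ℤ) (2 * r : ℕ), φ w
          ≤ ∑ w ∈ Finset.Icc (-(2 * r : ℕ) : ℤ) (2 * r : ℕ), 1 :=
            Finset.sum_le_sum fun w _ => by rw [hφ]; dsimp only; split_ifs <;> norm_num
        _ ≤ 4 * r + 1 := by
            rw [Finset.sum_const, Int.card_Icc, nsmul_eq_mul, mul_one]
            have : ((2 * r : ℕ) + 1 - -((2 * r : ℕ) : ℤ)).toNat = 4 * r + 1 := by omega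
            rw [this]; push_cast; rfl
  calc _ ≤ (4 * r + 1) / √(n + 1) * ((4 * r + 1) / √(n + 1)) :=
        mul_le_mul (h2 _) (h2 _) ((flipAvg_supBounded.pow n).nonneg hφ0 _) (by positivity)
    _ = _ := by
        rw [div_mul_div_comm, Real.mul_self_sqrt (by positivity)]; ring

lemma sum_Icc_inv_sqrt_le (r : ℕ) :
    ∑ w ∈ Finset.Icc (-r : ℤ) r, 1 / √(1 + w.natAbs) ≤ 4 * √(r + 1) := by
  have h1 : ∀ r : ℕ, 1 / √((1 : ℝ) + r) ≤ 2 * (√(r + 1) - √r) := by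
    intro r
    have hb : 0 < √((r : ℝ) + 1) := by positivity
    have ha : √(r : ℝ) ≤ √((r : ℝ) + 1) := Real.sqrt_le_sqrt (by linarith)
    have e1 : √((r : ℝ) + 1) * √((r : ℝ) + 1) = r + 1 := Real.mul_self_sqrt (by positivity)
    have e2 : √(r : ℝ) * √(r : ℝ) = r := Real.mul_self_sqrt (by positivity)
    rw [add_comm (1 : ℝ), div_le_iff₀ hb]
    nlinarith [mul_self_nonneg (√((r : ℝ) + 1) - √r)]
  induction r with
  | zero => simp
  | succ r ih =>
    have h2 : Finset.Icc (-(r + 1 : ℕ) : ℤ) (r + 1 : ℕ) =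
        insert (-(r + 1 : ℕ) : ℤ) (insert ((r + 1 : ℕ) : ℤ) (Finset.Icc (-r : ℤ) r)) := by
      ext w; simp only [Finset.mem_insert, Finset.mem_Icc]; omega
    rw [h2, Finset.sum_insert (by simp only [Finset.mem_insert, Finset.mem_Icc]; omega),
      Finset.sum_insert (by simp only [Finset.mem_Icc]; omega), Int.natAbs_neg, Int.natAbs_natCast]
    have := h1 (r + 1)
    push_cast at this ⊢
    linarith

lemma flipAvg_pow_inv_sqrt_le (n : ℕ) (u : ℤ) :
    (flipAvg ^ n) (fun w => 1 / √(1 + w.natAbs)) u ≤ 5 / √(√(n + 1)) := by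
  set q : ℝ := √(n + 1) with hq
  have hq0 : 0 < q := by positivity
  have hq1 : 1 ≤ q := Real.one_le_sqrt.2 (by linarith [(Nat.cast_nonneg n : (0 : ℝ) ≤ n)])
  set r := ⌊q⌋₊ - 1 with hr
  have hr1 : (r : ℝ) + 1 = ⌊q⌋₊ := by
    have : 1 ≤ ⌊q⌋₊ := Nat.le_floor (by simpa using hq1)
    rw [hr]; push_cast [Nat.cast_sub this]; ring
  have hle : (r : ℝ) + 1 ≤ q := hr1 ▸ Nat.floor_le hq0.le
  have hge : q ≤ (r : ℝ) + 2 := by linarith [Nat.lt_floor_add_one q]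
  refine (flipAvg_pow_le (fun w => by positivity) (r := r) (M := 1 / √q) (by positivity)
    (fun w hw => ?_) n u).trans ?_
  · have : (r : ℝ) + 1 ≤ w.natAbs := by exact_mod_cast hw
    gcongr
    linarith
  · have h1 := sum_Icc_inv_sqrt_le r
    have h2 : √((r : ℝ) + 1) ≤ √q := Real.sqrt_le_sqrt hle
    have h3 : √q / q = 1 / √q := by rw [Real.sqrt_div_self']
    calc _ ≤ 4 * √q / q + 1 / √q := by rw [← hq]; gcongr; linarith
      _ = 5 / √q := by rw [mul_div_assoc, h3]; ring

/-- The expectation of `1 / (1 + ‖Sₙ‖)` for the simple random walk, from any starting point. -/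
lemma planeAvg_pow_inv_norm_le (n : ℕ) (z : ℤ × ℤ) :
    (planeAvg ^ n) (fun z => 1 / (1 + ‖z‖)) z ≤ 50 / √(n + 1) := by
  set φ : ℤ → ℝ := fun w => 1 / √(1 + w.natAbs) with hφ
  have h1 : ∀ z : ℤ × ℤ, 1 / (1 + ‖z‖) ≤ (fun z : ℤ × ℤ =>
      ((2 : ℝ) • φ) (z.1 + z.2) * φ (z.1 - z.2)) z := by
    intro z
    obtain ⟨ha, hb⟩ := natAbs_le_two_mul_norm z
    simp only [Pi.smul_apply, smul_eq_mul, hφ]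
    rw [mul_assoc, div_mul_div_comm, mul_one, ← Real.sqrt_mul (by positivity), ← mul_div_assoc,
      mul_one, div_le_div_iff₀ (by positivity) (by positivity), one_mul]
    refine Real.sqrt_le_iff.2 ⟨by positivity, ?_⟩
    have := norm_nonneg z
    nlinarith [mul_le_mul (add_le_add_right ha 1) (add_le_add_right hb 1) (by positivity)
      (by positivity)]
  refine ((planeAvg_supBounded.pow n).mono h1 z).trans ?_
  rw [planeAvg_pow_prod, map_smul, Pi.smul_apply, smul_eq_mul]
  have h2 := flipAvg_pow_inv_sqrt_le n
  have h0 : ∀ u, 0 ≤ (flipAvg ^ n) φ u :=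
    (flipAvg_supBounded.pow n).nonneg fun w => by positivity
  calc _ ≤ 2 * (5 / √√(n + 1)) * (5 / √√(n + 1)) := by
        gcongr
        exacts [h0 _, h2 _, h2 _]
    _ = 50 / √(n + 1) := by
        rw [mul_assoc, div_mul_div_comm, Real.mul_self_sqrt (by positivity)]; ring

lemma tokenAvg_pow_diff {N : ℕ} {i j : Fin N} (hij : i ≠ j) (F : ℤ × ℤ → ℝ) (n : ℕ)
    (y : Config N) :
    ((tokenAvg j) ^ n) (fun y => F (y i - y j)) y = (planeAvg ^ n) F (y i - y j) := by
  induction n generalizing y with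
  | zero => simp
  | succ n ih =>
    rw [pow_succ', pow_succ', Module.End.mul_apply, Module.End.mul_apply, tokenAvg_apply,
      planeAvg_apply, funext ih]
    simp only [sum_latticeSteps, Pi.add_apply, Pi.single_eq_same, Pi.single_eq_of_ne hij, add_zero,
      ← sub_sub]
    have e1 : ∀ z : ℤ × ℤ, z - (1, 0) = z + (-1, 0) := fun z => by ext <;> simp [sub_eq_add_neg]
    have e2 : ∀ z : ℤ × ℤ, z - (-1, 0) = z + (1, 0) := fun z => by ext <;> simp
    have e3 : ∀ z : ℤ × ℤ, z - (0, 1) = z + (0, -1) := fun z => by ext <;> simp [sub_eq_add_neg]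
    have e4 : ∀ z : ℤ × ℤ, z - (0, -1) = z + (0, 1) := fun z => by ext <;> simp
    rw [e1, e2, e3, e4]
    ring

lemma tokenAvg_mul_of_invariant {N : ℕ} (j : Fin N) {F G : Config N → ℝ}
    (hG : ∀ (y : Config N) e, G (y + Pi.single j e) = G y) (n : ℕ) (y : Config N) :
    ((tokenAvg j) ^ n) (fun y => F y * G y) y = ((tokenAvg j) ^ n) F y * G y := by
  induction n generalizing y with
  | zero => simp
  | succ n ih =>
    rw [pow_succ', Module.End.mul_apply, tokenAvg_apply, Module.End.mul_apply, tokenAvg_apply,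
      funext ih]
    simp only [hG, ← Finset.sum_mul, mul_assoc]

/-- The probability that tokens `i` and `j` are within distance `r` after `n` steps. -/
lemma stepAvg_pow_ball_le {N : ℕ} [NeZero N] {i j : Fin N} (hij : i ≠ j) (r n : ℕ)
    (y : Config N) :
    ((stepAvg N) ^ n) (fun y => Set.indicator {z : ℤ × ℤ | ‖z‖ ≤ r} 1 (y i - y j)) y ≤
      N * (4 * r + 1) ^ 2 / (n + 1) := by
  refine stepAvg_pow_le_of_tokenAvg j (by positivity) (fun k y => ?_) n y
  rw [tokenAvg_pow_diff hij]
  exact planeAvg_pow_ball_le r k _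

/-- The expectation of the product of two inverse distances after `n` steps. That the two
differences are distinct is what makes it `O(1 / n)`, without a logarithm. -/
lemma stepAvg_pow_inv_norm_mul_le {N : ℕ} [NeZero N] {i j k : Fin N} (hij : i ≠ j) (hik : i ≠ k)
    (hjk : j ≠ k) (n : ℕ) (y : Config N) :
    ((stepAvg N) ^ n) (fun y => 1 / (1 + ‖y i - y j‖) * (1 / (1 + ‖y i - y k‖))) y ≤
      2500 * N / (n + 1) := by
  have h := stepAvg_pow_le_of_tokenAvg_tokenAvg hjk (c := 1250)
    (f := fun y : Config N => 1 / (1 + ‖y i - y j‖) * (1 / (1 + ‖y i - y k‖))) (by norm_num)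
    (fun p q y => ?_) n y
  · exact h.trans_eq (by ring)
  · have e1 : ((tokenAvg j) ^ p)
        (fun y : Config N => 1 / (1 + ‖y i - y j‖) * (1 / (1 + ‖y i - y k‖))) =
        fun y => 1 / (1 + ‖y i - y k‖) * (planeAvg ^ p) (fun z => 1 / (1 + ‖z‖)) (y i - y j) := by
      funext y
      rw [tokenAvg_mul_of_invariant j (F := fun y : Config N => 1 / (1 + ‖y i - y j‖))
        (G := fun y : Config N => 1 / (1 + ‖y i - y k‖))
        (fun y e => by simp [Pi.single_eq_of_ne hij, Pi.single_eq_of_ne hjk.symm]),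
        tokenAvg_pow_diff hij (fun z => 1 / (1 + ‖z‖)), mul_comm]
    rw [e1, tokenAvg_mul_of_invariant k (F := fun y : Config N => 1 / (1 + ‖y i - y k‖))
        (G := fun y : Config N => (planeAvg ^ p) (fun z => 1 / (1 + ‖z‖)) (y i - y j))
        (fun y e => by simp [Pi.single_eq_of_ne hik, Pi.single_eq_of_ne hjk]),
        tokenAvg_pow_diff hik (fun z => 1 / (1 + ‖z‖))]
    have ha := planeAvg_pow_inv_norm_le p (y i - y j)
    have hb := planeAvg_pow_inv_norm_le q (y i - y k)
    have ha0 := (planeAvg_supBounded.pow p).nonneg (f := fun z => 1 / (1 + ‖z‖))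
      (fun z => by positivity) (y i - y j)
    refine (mul_le_mul hb ha ha0 (by positivity)).trans ?_
    have hp : (1 / √((p : ℝ) + 1)) ^ 2 = 1 / (p + 1) := by
      rw [div_pow, Real.sq_sqrt (by positivity), one_pow]
    have hq : (1 / √((q : ℝ) + 1)) ^ 2 = 1 / (q + 1) := by
      rw [div_pow, Real.sq_sqrt (by positivity), one_pow]
    rw [← hp, ← hq, div_eq_mul_one_div, div_eq_mul_one_div 50 √((p : ℝ) + 1)]
    nlinarith [sq_nonneg (1 / √((p : ℝ) + 1) - 1 / √((q : ℝ) + 1))]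

/-! ### The potential kernel of the simple random walk on `ℤ²` -/

/-- Integration by parts against a monotone factor: the oscillation of `G'` makes the integral of
`f * G'` as small as `G`. -/
lemma abs_integral_mul_deriv_le_of_antitoneOn {f G g : ℝ → ℝ} {K : ℝ} (hf : ContDiff ℝ 1 f)
    (hanti : AntitoneOn f (Set.Icc 0 Real.pi)) (hf0 : 0 ≤ f Real.pi) (hf1 : f 0 ≤ 1)
    (hG : ∀ x, HasDerivAt G (g x) x) (hg : Continuous g) (hK : ∀ x, |G x| ≤ K) :
    |∫ x in (0 : ℝ)..Real.pi, f x * g x| ≤ 2 * K := by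
  have hpi := Real.pi_pos
  have hK0 : 0 ≤ K := (abs_nonneg _).trans (hK 0)
  have hdf : Continuous (deriv f) := hf.continuous_deriv le_rfl
  have hd : ∀ x, HasDerivAt f (deriv f x) x := fun x =>
    (hf.differentiable one_ne_zero x).hasDerivAt
  rw [intervalIntegral.integral_mul_deriv_eq_deriv_mul (fun x _ => hd x) (fun x _ => hG x)
    (hdf.intervalIntegrable _ _) (hg.intervalIntegrable _ _)]
  have hneg : ∀ x ∈ Set.Ioo 0 Real.pi, deriv f x ≤ 0 := by
    intro x hx
    have h1 := hanti.derivWithin_nonpos (x := x)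
    rwa [derivWithin_of_mem_nhds (Icc_mem_nhds hx.1 hx.2)] at h1
  have hint : |∫ x in (0 : ℝ)..Real.pi, deriv f x * G x| ≤ K * (f 0 - f Real.pi) := by
    have h1 : K * (f 0 - f Real.pi) = ∫ x in (0 : ℝ)..Real.pi, -(K * deriv f x) := by
      rw [intervalIntegral.integral_neg, intervalIntegral.integral_const_mul,
        intervalIntegral.integral_deriv_eq_sub (fun x _ => (hd x).differentiableAt)
        (hdf.intervalIntegrable _ _)]
      ring
    rw [h1, ← Real.norm_eq_abs]
    have hGc : Continuous G := continuous_iff_continuousAt.2 fun x => (hG x).continuousAt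
    refine intervalIntegral.norm_integral_le_of_norm_le hpi.le ?_
      ((hdf.const_mul K).neg.intervalIntegrable _ _)
    filter_upwards [Measure.ae_ne volume Real.pi] with t ht ht'
    have := hneg t ⟨ht'.1, lt_of_le_of_ne ht'.2 ht⟩
    rw [norm_mul, Real.norm_eq_abs, Real.norm_eq_abs, abs_of_nonpos this]
    nlinarith [hK t]
  have hanti' : f Real.pi ≤ f 0 :=
    hanti (Set.left_mem_Icc.2 hpi.le) (Set.right_mem_Icc.2 hpi.le) hpi.le
  have e1 : |f Real.pi * G Real.pi| ≤ f Real.pi * K := by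
    rw [abs_mul, abs_of_nonneg hf0]; gcongr; exact hK _
  have e2 : |f 0 * G 0| ≤ f 0 * K := by
    rw [abs_mul, abs_of_nonneg (hf0.trans hanti')]
    exact mul_le_mul_of_nonneg_left (hK _) (hf0.trans hanti')
  have e3 := abs_sub (f Real.pi * G Real.pi - f 0 * G 0)
    (∫ x in (0 : ℝ)..Real.pi, deriv f x * G x)
  have e4 := abs_sub (f Real.pi * G Real.pi) (f 0 * G 0)
  nlinarith

namespace PotentialKernel

/-- `√(1 + s ^ 2)`; with `s = sin (β / 2)`, `2 * s * w s` is the hyperbolic sine of the rate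
`r` given by `cosh r + cos β = 2`. -/
noncomputable def w (s : ℝ) : ℝ := √(1 + s ^ 2)

/-- The decay factor `exp (-r)`, where `cosh r = 1 + 2 * s ^ 2`. -/
noncomputable def rho (s : ℝ) : ℝ := (w s - s) ^ 2

lemma w_sq (s : ℝ) : w s ^ 2 = 1 + s ^ 2 := Real.sq_sqrt (by positivity)

lemma one_le_w (s : ℝ) : 1 ≤ w s := Real.one_le_sqrt.2 (by nlinarith [sq_nonneg s])

lemma w_pos (s : ℝ) : 0 < w s := zero_lt_one.trans_le (one_le_w s)

lemma lt_w (s : ℝ) : s < w s := by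
  nlinarith [w_sq s, w_pos s]

lemma w_mono {s t : ℝ} (hs : 0 ≤ s) (h : s ≤ t) : w s ≤ w t := by
  unfold w; gcongr

lemma w_sub_mul (s : ℝ) : (w s - s) * (w s + s) = 1 := by nlinarith [w_sq s]

lemma w_sub_anti {s t : ℝ} (hs : 0 ≤ s) (h : s ≤ t) : w t - t ≤ w s - s := by
  have h1 := w_sub_mul s
  have h2 := w_sub_mul t
  have h3 := w_mono hs h
  have h4 := lt_w s
  have h5 := lt_w t
  by_contra! hc
  nlinarith [w_pos s]

lemma rho_nonneg (s : ℝ) : 0 ≤ rho s := sq_nonneg _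

lemma rho_anti {s t : ℝ} (hs : 0 ≤ s) (h : s ≤ t) : rho t ≤ rho s := by
  have := w_sub_anti hs h
  have := lt_w t
  unfold rho
  gcongr

lemma rho_zero : rho 0 = 1 := by simp [rho, w]

lemma rho_le_one {s : ℝ} (hs : 0 ≤ s) : rho s ≤ 1 := rho_zero ▸ rho_anti le_rfl hs

lemma one_sub_rho (s : ℝ) : 1 - rho s = 2 * s * (w s - s) := by
  unfold rho; nlinarith [w_sq s]

lemma rho_sq_add_one (s : ℝ) : rho s ^ 2 + 1 = rho s * (2 + 4 * s ^ 2) := by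
  have h : w s ^ 4 = (1 + s ^ 2) ^ 2 := by rw [← w_sq]; ring
  have h3 : w s ^ 3 = (1 + s ^ 2) * w s := by rw [← w_sq]; ring
  unfold rho
  have : ((w s - s) ^ 2) ^ 2 + 1 - (w s - s) ^ 2 * (2 + 4 * s ^ 2) = 0 := by
    ring_nf
    rw [h, h3, w_sq]
    ring_nf
  linarith

lemma rho_le_exp {s : ℝ} (hs : 0 ≤ s) (hs1 : s ≤ 1) : rho s ≤ Real.exp (-(4 / 5 * s)) := by
  have h1 : (2 : ℝ) / 5 ≤ w s - s := by
    refine le_trans ?_ (w_sub_anti hs hs1)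
    have : (7 : ℝ) / 5 ≤ w 1 := Real.le_sqrt_of_sq_le (by norm_num)
    linarith
  have h2 := Real.add_one_le_exp (-(4 / 5 * s))
  nlinarith [one_sub_rho s]

/-- The integrand of the potential kernel at the point `(n, m)`. For `s = sin (β / 2) ≠ 0` it equals
`(1 - rho s ^ n * cos (m β)) / (2 * s * w s)`; the form chosen here is continuous at `β = 0`. -/
noncomputable def density (n m : ℕ) (β : ℝ) : ℝ :=
  (w (Real.sin (β / 2)) - Real.sin (β / 2)) / w (Real.sin (β / 2)) *
    ∑ k ∈ Finset.range n, rho (Real.sin (β / 2)) ^ k +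
  rho (Real.sin (β / 2)) ^ n *
    ∑ k ∈ Finset.range m, Real.sin ((k + 1 / 2) * β) / w (Real.sin (β / 2))

lemma contDiff_w : ContDiff ℝ 1 fun β => w (Real.sin (β / 2)) := by
  unfold w
  refine ContDiff.sqrt (by fun_prop) fun x => ?_
  positivity

lemma contDiff_rho : ContDiff ℝ 1 fun β => rho (Real.sin (β / 2)) := by
  unfold rho
  exact (contDiff_w.sub (by fun_prop)).pow 2

lemma continuous_density (n m : ℕ) : Continuous (density n m) := by
  have h1 := contDiff_w.continuous
  have h2 := contDiff_rho.continuous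
  unfold density
  refine Continuous.add (Continuous.mul (Continuous.div (by fun_prop) h1 fun x => (w_pos _).ne')
    (by fun_prop)) (Continuous.mul (by fun_prop) ?_)
  exact continuous_finsetSum _ fun k _ => Continuous.div (by fun_prop) h1 fun x => (w_pos _).ne'

/-- The closed form of `density`, multiplied by its denominator, which vanishes at `β = 0`. -/
lemma two_mul_density (n m : ℕ) (β : ℝ) :
    2 * Real.sin (β / 2) * w (Real.sin (β / 2)) * density n m β =
      1 - rho (Real.sin (β / 2)) ^ n * Real.cos (m * β) := by
  set s := Real.sin (β / 2) with hs
  have hw := (w_pos s).ne'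
  have h1 : (1 - rho s) * ∑ k ∈ Finset.range n, rho s ^ k = 1 - rho s ^ n := mul_neg_geom_sum _ _
  have h2 : ∑ k ∈ Finset.range m, 2 * s * Real.sin ((k + 1 / 2) * β) = 1 - Real.cos (m * β) := by
    have : ∀ k ∈ Finset.range m, 2 * s * Real.sin ((k + 1 / 2) * β) =
        -(Real.cos ((k + 1 : ℕ) * β) - Real.cos (k * β)) := by
      intro k _
      rw [Real.cos_sub_cos, hs]
      rw [show (((k + 1 : ℕ) : ℝ) * β + k * β) / 2 = (k + 1 / 2) * β by push_cast; ring,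
        show (((k + 1 : ℕ) : ℝ) * β - k * β) / 2 = β / 2 by push_cast; ring]
      ring
    rw [Finset.sum_congr rfl this, Finset.sum_neg_distrib,
      Finset.sum_range_sub fun k : ℕ => Real.cos (k * β)]
    simp
  unfold density
  rw [← hs, ← Finset.sum_div]
  rw [← Finset.mul_sum] at h2
  rw [one_sub_rho] at h1
  have h3 : 2 * s * w s * ((w s - s) / w s * ∑ k ∈ Finset.range n, rho s ^ k +
      rho s ^ n * ((∑ k ∈ Finset.range m, Real.sin ((k + 1 / 2) * β)) / w s)) =
      2 * s * (w s - s) * ∑ k ∈ Finset.range n, rho s ^ k +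
      rho s ^ n * (2 * s * ∑ k ∈ Finset.range m, Real.sin ((k + 1 / 2) * β)) := by
    generalize ∑ k ∈ Finset.range m, Real.sin ((k + 1 / 2) * β) = S
    field_simp
  rw [h3]
  linear_combination h1 + rho s ^ n * h2

lemma sin_half_pos {β : ℝ} (hβ : β ∈ Set.Ioo 0 Real.pi) : 0 < Real.sin (β / 2) :=
  Real.sin_pos_of_pos_of_lt_pi (by linarith [hβ.1]) (by linarith [hβ.2, Real.pi_pos])

lemma sin_half_mono : MonotoneOn (fun β => Real.sin (β / 2)) (Set.Icc 0 Real.pi) := by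
  intro x hx y hy hxy
  exact Real.sin_le_sin_of_le_of_le_pi_div_two (by linarith [hx.1, Real.pi_pos])
    (by linarith [hy.2]) (by linarith)

lemma sin_half_nonneg {β : ℝ} (hβ : β ∈ Set.Icc 0 Real.pi) : 0 ≤ Real.sin (β / 2) :=
  Real.sin_nonneg_of_nonneg_of_le_pi (by linarith [hβ.1]) (by linarith [hβ.2, Real.pi_pos])

/-- The potential kernel on the quadrant, as a one-dimensional Fourier integral. -/
noncomputable def quadrant (n m : ℕ) : ℝ := (1 / Real.pi) * ∫ β in (0 : ℝ)..Real.pi, density n m β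

lemma quadrant_sub_quadrant (n m n' m' : ℕ) :
    quadrant n m - quadrant n' m' =
      (1 / Real.pi) * ∫ β in (0 : ℝ)..Real.pi, (density n m β - density n' m' β) := by
  rw [intervalIntegral.integral_sub ((continuous_density _ _).intervalIntegrable _ _)
    ((continuous_density _ _).intervalIntegrable _ _), mul_sub]
  rfl

lemma quadrant_nonneg (n m : ℕ) : 0 ≤ quadrant n m := by
  refine mul_nonneg (by positivity) (intervalIntegral.integral_nonneg_of_ae_restrict
    Real.pi_pos.le ?_)
  rw [← restrict_Ioo_eq_restrict_Icc]
  filter_upwards [ae_restrict_mem measurableSet_Ioo] with β hβ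
  have hs := sin_half_pos hβ
  have h := two_mul_density n m β
  have h1 : rho (Real.sin (β / 2)) ^ n * Real.cos (m * β) ≤ 1 := by
    have h2 := pow_le_one₀ (n := n) (rho_nonneg _) (rho_le_one hs.le)
    have h3 := pow_nonneg (rho_nonneg (Real.sin (β / 2))) n
    nlinarith [Real.cos_le_one (m * β)]
  have h4 : 0 < 2 * Real.sin (β / 2) * w (Real.sin (β / 2)) := by
    have := w_pos (Real.sin (β / 2)); positivity
  refine nonneg_of_mul_nonneg_right (a := 2 * Real.sin (β / 2) * w (Real.sin (β / 2))) ?_ h4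
  rw [h]
  linarith

lemma quadrant_zero : quadrant 0 0 = 0 := by simp [quadrant, density]

lemma eq_of_two_mul_mul_eq {β : ℝ} (hβ : β ∈ Set.Ioo 0 Real.pi) {x y : ℝ}
    (h : 2 * Real.sin (β / 2) * w (Real.sin (β / 2)) * x =
      2 * Real.sin (β / 2) * w (Real.sin (β / 2)) * y) : x = y := by
  have h1 := sin_half_pos hβ
  have h2 := w_pos (Real.sin (β / 2))
  exact mul_left_cancel₀ (by positivity) h

/-- The decay of both factors makes the integral of `rho ^ n` of order `1 / n`. -/
lemma abs_integral_le_of_le_rho_pow {n : ℕ} {F : ℝ → ℝ}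
    (h : ∀ β ∈ Set.Ioo 0 Real.pi, |F β| ≤ rho (Real.sin (β / 2)) ^ n) :
    |∫ β in (0 : ℝ)..Real.pi, F β| ≤ 8 / (n + 1) := by
  have hpi := Real.pi_pos
  rcases Nat.eq_zero_or_pos n with rfl | hn
  · have := intervalIntegral.norm_integral_le_of_norm_le (a := 0) (b := Real.pi) (f := F)
      (g := fun _ => (1 : ℝ)) (μ := volume) hpi.le ?_ (by simp)
    · simp only [intervalIntegral.integral_const, smul_eq_mul, mul_one, sub_zero] at this
      have h4 := Real.pi_le_four
      rw [Real.norm_eq_abs] at this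
      refine this.trans ?_
      norm_num
      linarith
    · filter_upwards [Measure.ae_ne volume Real.pi] with t ht ht'
      simpa using h t ⟨ht'.1, lt_of_le_of_ne ht'.2 ht⟩
  · have hn0 : (0 : ℝ) < n := by exact_mod_cast hn
    have hle : ∀ β ∈ Set.Ioo 0 Real.pi, |F β| ≤ Real.exp (-(n / 4) * β) := by
      intro β hβ
      refine (h β hβ).trans ?_
      have h1 : 2 / Real.pi * (β / 2) ≤ Real.sin (β / 2) :=
        Real.mul_le_sin (by linarith [hβ.1]) (by linarith [hβ.2])
      have h2 : (5 / 16) * β ≤ Real.sin (β / 2) := by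
        refine le_trans ?_ h1
        have h3 : 5 / 16 ≤ 1 / Real.pi := by
          rw [div_le_div_iff₀ (by norm_num) hpi]
          linarith [Real.pi_lt_d2]
        calc 5 / 16 * β ≤ 1 / Real.pi * β := by gcongr; exact hβ.1.le
          _ = _ := by field_simp
      calc rho (Real.sin (β / 2)) ^ n ≤ Real.exp (-(4 / 5 * Real.sin (β / 2))) ^ n :=
            pow_le_pow_left₀ (rho_nonneg _) (rho_le_exp (sin_half_pos hβ).le (Real.sin_le_one _)) n
        _ = Real.exp (n * -(4 / 5 * Real.sin (β / 2))) := (Real.exp_nat_mul _ _).symm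
        _ ≤ _ := by
            refine Real.exp_le_exp.2 ?_
            nlinarith
    have hint : ∫ β in (0 : ℝ)..Real.pi, Real.exp (-(n / 4) * β) ≤ 4 / n := by
      have hd : ∀ x : ℝ, HasDerivAt (fun x => -(4 / n) * Real.exp (-(n / 4) * x))
          (Real.exp (-(n / 4) * x)) x := by
        intro x
        have h1 : HasDerivAt (fun x : ℝ => -(n / 4 : ℝ) * x) (-(n / 4)) x := by
          simpa using (hasDerivAt_id x).const_mul (-(n / 4 : ℝ))
        refine (h1.exp.const_mul (-(4 / n : ℝ))).congr_deriv ?_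
        field_simp
      rw [intervalIntegral.integral_eq_sub_of_hasDerivAt (fun x _ => hd x)
        ((by fun_prop : Continuous fun x : ℝ => Real.exp (-(n / 4) * x)).intervalIntegrable _ _)]
      simp only [mul_zero, Real.exp_zero]
      have := Real.exp_pos (-(n / 4) * Real.pi)
      have h4 : 0 < 4 / (n : ℝ) := by positivity
      nlinarith
    have := intervalIntegral.norm_integral_le_of_norm_le (a := 0) (b := Real.pi) (f := F)
      (g := fun β => Real.exp (-(n / 4) * β)) (μ := volume) hpi.le ?_
      ((by fun_prop : Continuous fun x : ℝ => Real.exp (-(n / 4) * x)).intervalIntegrable _ _)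
    · rw [← Real.norm_eq_abs]
      refine this.trans (hint.trans ?_)
      rw [div_le_div_iff₀ hn0 (by positivity)]
      have : (1 : ℝ) ≤ n := by exact_mod_cast hn
      linarith
    · filter_upwards [Measure.ae_ne volume Real.pi] with t ht ht'
      exact hle t ⟨ht'.1, lt_of_le_of_ne ht'.2 ht⟩

lemma div_max_bound {x A B : ℝ} {n m : ℕ} (h1 : x ≤ A / (n + 1)) (h2 : x ≤ B / (m + 1))
    {C : ℝ} (hA : A ≤ C) (hB : B ≤ C) : x ≤ C / (1 + max n m : ℕ) := by
  rcases le_total n m with h | h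
  · rw [max_eq_right h]
    refine h2.trans ?_
    push_cast
    rw [add_comm]
    gcongr
  · rw [max_eq_left h]
    refine h1.trans ?_
    push_cast
    rw [add_comm]
    gcongr

lemma antitoneOn_rho_pow (n : ℕ) :
    AntitoneOn (fun β => rho (Real.sin (β / 2)) ^ n) (Set.Icc 0 Real.pi) := fun _ hx _ hy hxy =>
  pow_le_pow_left₀ (rho_nonneg _)
    (rho_anti (sin_half_nonneg hx) (sin_half_mono hx hy hxy)) n

/-- The increment is a cosine integral against a decreasing factor of at most `rho ^ n`. The decay
of `rho ^ n` bounds it by a multiple of `1 / n`, the oscillation of `cos (m * β)` by one of `1 / m`.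
-/
lemma abs_quadrant_succ_left_sub_le (n m : ℕ) :
    |quadrant (n + 1) m - quadrant n m| ≤ 8 / (1 + max n m : ℕ) := by
  have hpi := Real.pi_pos
  set f : ℝ → ℝ := fun β => rho (Real.sin (β / 2)) ^ n *
    ((w (Real.sin (β / 2)) - Real.sin (β / 2)) * (w (Real.sin (β / 2)))⁻¹) with hf
  have heq : quadrant (n + 1) m - quadrant n m =
      (1 / Real.pi) * ∫ β in (0 : ℝ)..Real.pi, f β * Real.cos (m * β) := by
    rw [quadrant_sub_quadrant]
    congr 1
    refine intervalIntegral.integral_congr_Ioo_of_le hpi.le fun β hβ => ?_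
    refine eq_of_two_mul_mul_eq hβ ?_
    have h := one_sub_rho (Real.sin (β / 2))
    have hw := (w_pos (Real.sin (β / 2))).ne'
    rw [mul_sub, two_mul_density, two_mul_density, hf]
    dsimp only
    generalize Real.cos (m * β) = c
    field_simp
    rw [pow_succ]
    linear_combination rho (Real.sin (β / 2)) ^ n * c * h
  have hg0 : ∀ β, 0 ≤ (w (Real.sin (β / 2)) - Real.sin (β / 2)) * (w (Real.sin (β / 2)))⁻¹ :=
    fun β => mul_nonneg (by linarith [lt_w (Real.sin (β / 2))]) (inv_nonneg.2 (w_pos _).le)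
  have hg1 : ∀ β ∈ Set.Icc 0 Real.pi,
      (w (Real.sin (β / 2)) - Real.sin (β / 2)) * (w (Real.sin (β / 2)))⁻¹ ≤ 1 := by
    intro β hβ
    rw [mul_inv_le_iff₀ (w_pos _)]
    linarith [sin_half_nonneg hβ]
  have hf0 : ∀ β, 0 ≤ f β := fun β => mul_nonneg (pow_nonneg (rho_nonneg _) _) (hg0 β)
  have hf1 : ∀ β ∈ Set.Icc 0 Real.pi, f β ≤ rho (Real.sin (β / 2)) ^ n := fun β hβ =>
    mul_le_of_le_one_right (pow_nonneg (rho_nonneg _) _) (hg1 β hβ)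
  have hsmooth : ContDiff ℝ 1 f :=
    (contDiff_rho.pow n).mul ((contDiff_w.sub (by fun_prop)).mul
      (contDiff_w.inv fun x => (w_pos _).ne'))
  have hanti : AntitoneOn f (Set.Icc 0 Real.pi) := by
    intro x hx y hy hxy
    have hs := sin_half_mono hx hy hxy
    refine mul_le_mul (antitoneOn_rho_pow n hx hy hxy) ?_ (hg0 y) (pow_nonneg (rho_nonneg _) _)
    refine mul_le_mul (w_sub_anti (sin_half_nonneg hx) hs) ?_ (inv_nonneg.2 (w_pos _).le)
      (by linarith [lt_w (Real.sin (x / 2))])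
    exact inv_anti₀ (w_pos _) (w_mono (sin_half_nonneg hx) hs)
  have b1 : |∫ β in (0 : ℝ)..Real.pi, f β * Real.cos (m * β)| ≤ 8 / (n + 1) := by
    refine abs_integral_le_of_le_rho_pow fun β hβ => ?_
    rw [abs_mul, abs_of_nonneg (hf0 β)]
    exact (mul_le_of_le_one_right (hf0 β) (Real.abs_cos_le_one _)).trans
      (hf1 β (Set.Ioo_subset_Icc_self hβ))
  have b2 : |∫ β in (0 : ℝ)..Real.pi, f β * Real.cos (m * β)| ≤ 8 / (m + 1) := by
    rcases Nat.eq_zero_or_pos m with rfl | hm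
    · refine b1.trans ?_
      gcongr
      simp
    · have hm0 : (0 : ℝ) < m := by exact_mod_cast hm
      have hm1 : (1 : ℝ) ≤ m := by exact_mod_cast hm
      refine (abs_integral_mul_deriv_le_of_antitoneOn (G := fun β => Real.sin (m * β) / m)
        (K := 1 / m) hsmooth hanti (hf0 _) ?_ (fun x => ?_) (by fun_prop) fun x => ?_).trans ?_
      · have := hf1 0 (Set.left_mem_Icc.2 hpi.le)
        simpa [rho_zero] using this
      · have h1 : HasDerivAt (fun x : ℝ => (m : ℝ) * x) m x := by
          simpa using (hasDerivAt_id x).const_mul (m : ℝ)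
        refine (h1.sin.div_const (m : ℝ)).congr_deriv ?_
        field_simp
      · rw [abs_div, abs_of_pos hm0]
        gcongr
        exact Real.abs_sin_le_one _
      · rw [mul_one_div, div_le_div_iff₀ hm0 (by positivity)]
        linarith
  rw [heq, abs_mul, abs_of_pos (by positivity)]
  refine (mul_le_of_le_one_left (abs_nonneg _) ?_).trans (div_max_bound b1 b2 le_rfl le_rfl)
  rw [div_le_one hpi]
  linarith [Real.pi_gt_three]

/-- The increment is a sine integral against a decreasing factor of at most `rho ^ n`, bounded as in
`abs_quadrant_succ_left_sub_le`. -/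
lemma abs_quadrant_succ_right_sub_le (n m : ℕ) :
    |quadrant n (m + 1) - quadrant n m| ≤ 8 / (1 + max n m : ℕ) := by
  have hpi := Real.pi_pos
  set f : ℝ → ℝ := fun β => rho (Real.sin (β / 2)) ^ n * (w (Real.sin (β / 2)))⁻¹ with hf
  have heq : quadrant n (m + 1) - quadrant n m =
      (1 / Real.pi) * ∫ β in (0 : ℝ)..Real.pi, f β * Real.sin ((m + 1 / 2) * β) := by
    rw [quadrant_sub_quadrant]
    congr 1
    refine intervalIntegral.integral_congr fun β _ => ?_
    simp only [density, Finset.sum_range_succ, hf]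
    ring
  have hg0 : ∀ β, 0 ≤ (w (Real.sin (β / 2)))⁻¹ := fun β => inv_nonneg.2 (w_pos _).le
  have hf0 : ∀ β, 0 ≤ f β := fun β => mul_nonneg (pow_nonneg (rho_nonneg _) _) (hg0 β)
  have hf1 : ∀ β, f β ≤ rho (Real.sin (β / 2)) ^ n := fun β =>
    mul_le_of_le_one_right (pow_nonneg (rho_nonneg _) _) (inv_le_one_of_one_le₀ (one_le_w _))
  have hsmooth : ContDiff ℝ 1 f :=
    (contDiff_rho.pow n).mul (contDiff_w.inv fun x => (w_pos _).ne')
  have hanti : AntitoneOn f (Set.Icc 0 Real.pi) := by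
    intro x hx y hy hxy
    refine mul_le_mul (antitoneOn_rho_pow n hx hy hxy) ?_ (hg0 y) (pow_nonneg (rho_nonneg _) _)
    exact inv_anti₀ (w_pos _) (w_mono (sin_half_nonneg hx) (sin_half_mono hx hy hxy))
  have b1 : |∫ β in (0 : ℝ)..Real.pi, f β * Real.sin ((m + 1 / 2) * β)| ≤ 8 / (n + 1) := by
    refine abs_integral_le_of_le_rho_pow fun β _ => ?_
    rw [abs_mul, abs_of_nonneg (hf0 β)]
    exact (mul_le_of_le_one_right (hf0 β) (Real.abs_sin_le_one _)).trans (hf1 β)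
  have b2 : |∫ β in (0 : ℝ)..Real.pi, f β * Real.sin ((m + 1 / 2) * β)| ≤ 8 / (m + 1) := by
    have hm0 : (0 : ℝ) < m + 1 / 2 := by positivity
    refine (abs_integral_mul_deriv_le_of_antitoneOn
      (G := fun β => -Real.cos ((m + 1 / 2) * β) / (m + 1 / 2))
      (K := 1 / (m + 1 / 2)) hsmooth hanti (hf0 _) ?_ (fun x => ?_) (by fun_prop) fun x => ?_).trans
      ?_
    · simpa [rho_zero] using hf1 0
    · have h1 : HasDerivAt (fun x : ℝ => ((m : ℝ) + 1 / 2) * x) (m + 1 / 2) x := by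
        simpa using (hasDerivAt_id x).const_mul ((m : ℝ) + 1 / 2)
      refine (h1.cos.neg.div_const ((m : ℝ) + 1 / 2)).congr_deriv ?_
      field_simp
    · rw [abs_div, abs_of_pos hm0, abs_neg]
      gcongr
      exact Real.abs_cos_le_one _
    · rw [mul_one_div, div_le_div_iff₀ hm0 (by positivity)]
      linarith
  rw [heq, abs_mul, abs_of_pos (by positivity)]
  refine (mul_le_of_le_one_left (abs_nonneg _) ?_).trans (div_max_bound b1 b2 le_rfl le_rfl)
  rw [div_le_one hpi]
  linarith [Real.pi_gt_three]

/-! ### Logarithmic growth and harmonicity of the potential kernel -/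

lemma sum_inv_half_le (m : ℕ) (hm : 1 ≤ m) :
    ∑ k ∈ Finset.range m, 1 / ((k : ℝ) + 1 / 2) ≤ Real.log m + 2 := by
  induction m, hm using Nat.le_induction with
  | base => norm_num
  | succ m hm ih =>
    have hm0 : (0 : ℝ) < m := by exact_mod_cast hm
    have h1 := Real.le_log_one_add_of_nonneg (x := 1 / (m : ℝ)) (by positivity)
    have h2 : Real.log (1 + 1 / (m : ℝ)) = Real.log (m + 1 : ℕ) - Real.log m := by
      rw [← Real.log_div (by positivity) (by positivity)]
      congr 1
      push_cast
      field_simp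
    have h3 : 2 * (1 / (m : ℝ)) / (1 / (m : ℝ) + 2) = 1 / ((m : ℝ) + 1 / 2) := by
      field_simp
      ring
    rw [Finset.sum_range_succ]
    linarith

lemma log_le_sum_inv_half (m : ℕ) :
    Real.log (m + 1) ≤ ∑ k ∈ Finset.range m, 1 / ((k : ℝ) + 1 / 2) := by
  induction m with
  | zero => simp
  | succ m ih =>
    have h1 := Real.add_one_le_exp (1 / ((m : ℝ) + 1))
    have h2 : Real.log ((m + 1 : ℕ) + 1) - Real.log (m + 1) ≤ 1 / ((m : ℝ) + 1) := by
      rw [← Real.log_div (by positivity) (by positivity), Real.log_le_iff_le_exp (by positivity)]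
      refine le_trans (le_of_eq ?_) h1
      push_cast
      field_simp
      ring
    have h3 : 1 / ((m : ℝ) + 1) ≤ 1 / ((m : ℝ) + 1 / 2) := by gcongr; norm_num
    rw [Finset.sum_range_succ]
    linarith

lemma integral_sin_mul (k : ℕ) :
    ∫ β in (0 : ℝ)..Real.pi, Real.sin ((k + 1 / 2) * β) = 1 / ((k : ℝ) + 1 / 2) := by
  have hc : ((k : ℝ) + 1 / 2) ≠ 0 := by positivity
  rw [intervalIntegral.integral_comp_mul_left (fun x => Real.sin x) hc, integral_sin, mul_zero,
    Real.cos_zero, show ((k : ℝ) + 1 / 2) * Real.pi = Real.pi / 2 + k * Real.pi by ring,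
    Real.cos_add_nat_mul_pi, Real.cos_pi_div_two, mul_zero, sub_zero, smul_eq_mul, mul_one,
    inv_eq_one_div]

/-- On the vertical axis the kernel is `1 / π` times a harmonic sum, up to a bounded error. -/
lemma abs_quadrant_zero_sub_sum_le (m : ℕ) :
    |quadrant 0 m - (1 / Real.pi) * ∑ k ∈ Finset.range m, 1 / ((k : ℝ) + 1 / 2)| ≤ 2 := by
  have hpi := Real.pi_pos
  have hcont : Continuous fun β : ℝ => ∑ k ∈ Finset.range m, Real.sin (((k : ℝ) + 1 / 2) * β) := by
    fun_prop
  have h1 : ∑ k ∈ Finset.range m, 1 / ((k : ℝ) + 1 / 2) =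
      ∫ β in (0 : ℝ)..Real.pi, ∑ k ∈ Finset.range m, Real.sin (((k : ℝ) + 1 / 2) * β) := by
    rw [intervalIntegral.integral_finsetSum fun (k : ℕ) _ =>
      (by fun_prop : Continuous fun β : ℝ =>
        Real.sin (((k : ℝ) + 1 / 2) * β)).intervalIntegrable _ _]
    exact Finset.sum_congr rfl fun k _ => (integral_sin_mul k).symm
  rw [h1, quadrant, ← mul_sub, ← intervalIntegral.integral_sub
    ((continuous_density _ _).intervalIntegrable _ _) (hcont.intervalIntegrable _ _), abs_mul,
    abs_of_pos (by positivity)]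
  have h2 := intervalIntegral.norm_integral_le_of_norm_le (a := 0) (b := Real.pi)
      (f := fun β => density 0 m β - ∑ k ∈ Finset.range m, Real.sin (((k : ℝ) + 1 / 2) * β))
      (g := fun _ => (2 : ℝ)) (μ := volume) hpi.le ?_ (by simp)
  · rw [Real.norm_eq_abs] at h2
    refine (mul_le_mul_of_nonneg_left h2 (by positivity)).trans (le_of_eq ?_)
    simp only [intervalIntegral.integral_const, smul_eq_mul, sub_zero]
    field_simp
  · filter_upwards [Measure.ae_ne volume Real.pi] with β hne hβ'
    have hβ : β ∈ Set.Ioo 0 Real.pi := ⟨hβ'.1, lt_of_le_of_ne hβ'.2 hne⟩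
    have hs := sin_half_pos hβ
    have hs1 := Real.sin_le_one (β / 2)
    have hd := two_mul_density 0 m β
    set s := Real.sin (β / 2) with hsdef
    have hw := one_le_w s
    have hw0 := w_pos s
    set S := ∑ k ∈ Finset.range m, Real.sin (((k : ℝ) + 1 / 2) * β) with hS
    have hden : density 0 m β = S / w s := by
      simp [density, hS, Finset.sum_div, ← hsdef]
    rw [hden] at hd ⊢
    rw [pow_zero, one_mul] at hd
    have hd' : 2 * s * S = 1 - Real.cos (m * β) := by
      rw [← hd]; field_simp
    have hSs : |s * S| ≤ 1 := by
      rw [abs_le]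
      constructor <;> nlinarith [Real.cos_le_one (m * β), Real.neg_one_le_cos (m * β)]
    clear_value S s
    have hws : w s - 1 ≤ s ^ 2 := by nlinarith [w_sq s]
    have e : S / w s - S = -(S * ((w s - 1) / w s)) := by field_simp; ring
    rw [e, norm_neg, Real.norm_eq_abs, abs_mul, abs_of_nonneg (a := (w s - 1) / w s)
      (div_nonneg (by linarith) hw0.le)]
    have h3 : (w s - 1) / w s ≤ s * s := by
      rw [div_le_iff₀ hw0]; nlinarith [mul_pos hs hs]
    calc |S| * ((w s - 1) / w s) ≤ |S| * (s * s) := by gcongr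
      _ = |s * S| * s := by rw [abs_mul, abs_of_pos hs]; ring
      _ ≤ 1 * 1 := by gcongr
      _ ≤ 2 := by norm_num

lemma abs_quadrant_zero_sub_log_le (m : ℕ) (hm : 1 ≤ m) :
    |quadrant 0 m - (1 / Real.pi) * Real.log m| ≤ 4 := by
  have h1 := abs_quadrant_zero_sub_sum_le m
  have h2 := sum_inv_half_le m hm
  have h3 : Real.log m ≤ ∑ k ∈ Finset.range m, 1 / ((k : ℝ) + 1 / 2) := by
    refine le_trans (Real.log_le_log (by exact_mod_cast hm) (by linarith)) (log_le_sum_inv_half m)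
  have hpi : 1 / Real.pi ≤ 1 := by
    rw [div_le_one Real.pi_pos]; linarith [Real.pi_gt_three]
  have hpi0 : 0 < 1 / Real.pi := by positivity
  rw [abs_le] at h1 ⊢
  constructor <;> nlinarith

lemma abs_sub_le_of_forall_succ {f : ℕ → ℝ} {K : ℝ} {a b : ℕ} (hab : a ≤ b)
    (h : ∀ k, a ≤ k → k < b → |f (k + 1) - f k| ≤ K) : |f b - f a| ≤ (b - a : ℕ) * K := by
  induction b, hab using Nat.le_induction with
  | base => simp
  | succ b hb ih =>
    have h1 := ih fun k hk hkb => h k hk (by omega)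
    have h2 := h b hb (by omega)
    rw [show b + 1 - a = (b - a) + 1 by omega]
    push_cast
    have := abs_add_le (f (b + 1) - f b) (f b - f a)
    rw [show f (b + 1) - f b + (f b - f a) = f (b + 1) - f a by ring] at this
    linarith

lemma nat_mul_eight_div_le {k M : ℕ} (h : k ≤ M) : (k : ℝ) * (8 / (1 + M : ℕ)) ≤ 8 := by
  rw [mul_div_assoc', div_le_iff₀ (by positivity)]
  have : (k : ℝ) ≤ (1 + M : ℕ) := by exact_mod_cast h.trans (by omega)
  linarith

/-- Comparison with the vertical axis along a lattice path of length at most `2 * max n m`, first on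
to the diagonal if the point is below it. The gradient bound makes the error bounded. -/
lemma abs_quadrant_sub_log_le (n m : ℕ) (h : 1 ≤ max n m) :
    |quadrant n m - (1 / Real.pi) * Real.log (max n m : ℕ)| ≤ 20 := by
  rcases le_total n m with hnm | hnm
  · rw [max_eq_right hnm] at h ⊢
    have h1 := abs_sub_le_of_forall_succ (f := fun k => quadrant k m) (K := 8 / (1 + m : ℕ))
      (Nat.zero_le n) fun k _ hk => by
        have := abs_quadrant_succ_left_sub_le k m
        rwa [max_eq_right (hk.le.trans hnm)] at this
    have h2 := abs_quadrant_zero_sub_log_le m h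
    have h3 := nat_mul_eight_div_le hnm
    rw [Nat.sub_zero] at h1
    have := abs_add_le (quadrant n m - quadrant 0 m) (quadrant 0 m - (1 / Real.pi) * Real.log m)
    rw [sub_add_sub_cancel] at this
    linarith
  · rw [max_eq_left hnm] at h ⊢
    have h1 := abs_sub_le_of_forall_succ (f := fun k => quadrant n k) (K := 8 / (1 + n : ℕ))
      hnm fun k _ hk => by
        have := abs_quadrant_succ_right_sub_le n k
        rwa [max_eq_left hk.le] at this
    have h1' := abs_sub_le_of_forall_succ (f := fun k => quadrant k n) (K := 8 / (1 + n : ℕ))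
      (Nat.zero_le n) fun k _ hk => by
        have := abs_quadrant_succ_left_sub_le k n
        rwa [max_eq_right hk.le] at this
    have h2 := abs_quadrant_zero_sub_log_le n h
    have h3 := nat_mul_eight_div_le (Nat.sub_le n m)
    have h4 := nat_mul_eight_div_le (Nat.sub_le n 0)
    have a1 := abs_add_le (quadrant n n - quadrant 0 n) (quadrant 0 n - (1 / Real.pi) * Real.log n)
    have a2 := abs_sub (quadrant n n - (1 / Real.pi) * Real.log n) (quadrant n n - quadrant n m)
    rw [sub_add_sub_cancel] at a1
    rw [sub_sub_sub_cancel_left, ← abs_neg, neg_sub] at a2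
    rw [← abs_neg, neg_sub] at a2
    linarith

/-- The potential kernel of the simple random walk on `ℤ²`, normalized so as to grow like
`(1 / π) * log ‖z‖`. -/
noncomputable def potential (z : ℤ × ℤ) : ℝ := quadrant z.1.natAbs z.2.natAbs

lemma potential_nonneg (z : ℤ × ℤ) : 0 ≤ potential z := quadrant_nonneg _ _

lemma potential_zero : potential 0 = 0 := by simpa [potential] using quadrant_zero

lemma norm_eq_max_natAbs (z : ℤ × ℤ) : ‖z‖ = (max z.1.natAbs z.2.natAbs : ℕ) := by
  rw [Prod.norm_def, Int.norm_eq_abs, Int.norm_eq_abs, Nat.cast_max, Nat.cast_natAbs,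
    Nat.cast_natAbs, Int.cast_abs, Int.cast_abs]

lemma one_le_norm {z : ℤ × ℤ} (hz : z ≠ 0) : 1 ≤ ‖z‖ := by
  rw [norm_eq_max_natAbs]
  have : 1 ≤ max z.1.natAbs z.2.natAbs := by
    by_contra! h
    exact hz (Prod.ext (by simp; omega) (by simp; omega))
  exact_mod_cast this

lemma abs_potential_sub_log_le {z : ℤ × ℤ} (hz : z ≠ 0) :
    |potential z - (1 / Real.pi) * Real.log ‖z‖| ≤ 20 := by
  have h := one_le_norm hz
  rw [norm_eq_max_natAbs] at h ⊢
  exact abs_quadrant_sub_log_le _ _ (by exact_mod_cast h)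

lemma eight_div_le {k l : ℕ} (h : l ≤ k + 1) : (8 : ℝ) / (1 + k : ℕ) ≤ 16 / (1 + l) := by
  have : (l : ℝ) ≤ k + 1 := by exact_mod_cast h
  rw [div_le_div_iff₀ (by positivity) (by positivity)]
  push_cast
  linarith

lemma abs_quadrant_natAbs_sub_left_le (a b : ℤ) (m : ℕ) (hab : b = a + 1) :
    |quadrant b.natAbs m - quadrant a.natAbs m| ≤ 16 / (1 + (max a.natAbs m : ℕ)) ∧
    |quadrant b.natAbs m - quadrant a.natAbs m| ≤ 16 / (1 + (max b.natAbs m : ℕ)) := by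
  rcases le_or_gt 0 a with h | h
  · have e : b.natAbs = a.natAbs + 1 := by omega
    rw [e]
    exact ⟨(abs_quadrant_succ_left_sub_le _ _).trans (eight_div_le (by omega)),
      (abs_quadrant_succ_left_sub_le _ _).trans (eight_div_le (by omega))⟩
  · have e : a.natAbs = b.natAbs + 1 := by omega
    rw [e, abs_sub_comm]
    exact ⟨(abs_quadrant_succ_left_sub_le _ _).trans (eight_div_le (by omega)),
      (abs_quadrant_succ_left_sub_le _ _).trans (eight_div_le (by omega))⟩

lemma abs_quadrant_natAbs_sub_right_le (a b : ℤ) (n : ℕ) (hab : b = a + 1) :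
    |quadrant n b.natAbs - quadrant n a.natAbs| ≤ 16 / (1 + (max n a.natAbs : ℕ)) ∧
    |quadrant n b.natAbs - quadrant n a.natAbs| ≤ 16 / (1 + (max n b.natAbs : ℕ)) := by
  rcases le_or_gt 0 a with h | h
  · have e : b.natAbs = a.natAbs + 1 := by omega
    rw [e]
    exact ⟨(abs_quadrant_succ_right_sub_le _ _).trans (eight_div_le (by omega)),
      (abs_quadrant_succ_right_sub_le _ _).trans (eight_div_le (by omega))⟩
  · have e : a.natAbs = b.natAbs + 1 := by omega
    rw [e, abs_sub_comm]
    exact ⟨(abs_quadrant_succ_right_sub_le _ _).trans (eight_div_le (by omega)),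
      (abs_quadrant_succ_right_sub_le _ _).trans (eight_div_le (by omega))⟩

lemma abs_potential_add_sub_le {e : ℤ × ℤ} (he : e ∈ latticeSteps) (z : ℤ × ℤ) :
    |potential (z + e) - potential z| ≤ 16 * (1 / (1 + ‖z‖)) := by
  rw [mul_one_div, norm_eq_max_natAbs]
  simp only [latticeSteps, Finset.mem_insert, Finset.mem_singleton] at he
  rcases he with rfl | rfl | rfl | rfl <;>
    simp only [potential, Prod.fst_add, Prod.snd_add, add_zero]
  · exact (abs_quadrant_natAbs_sub_left_le _ _ _ rfl).1
  · rw [abs_sub_comm]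
    exact (abs_quadrant_natAbs_sub_left_le _ _ _ (by ring)).2
  · exact (abs_quadrant_natAbs_sub_right_le _ _ _ rfl).1
  · rw [abs_sub_comm]
    exact (abs_quadrant_natAbs_sub_right_le _ _ _ (by ring)).2

lemma integral_cos_nat_mul {m : ℕ} (hm : 1 ≤ m) :
    ∫ β in (0 : ℝ)..Real.pi, Real.cos (m * β) = 0 := by
  have hc : (m : ℝ) ≠ 0 := by positivity
  rw [intervalIntegral.integral_comp_mul_left (fun x => Real.cos x) hc, integral_cos, mul_zero,
    Real.sin_zero, Real.sin_nat_mul_pi, sub_zero, smul_zero]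

lemma cos_eq_one_sub_sin_half (β : ℝ) : Real.cos β = 1 - 2 * Real.sin (β / 2) ^ 2 := by
  have h := Real.cos_sq' (β / 2)
  have h2 := Real.cos_two_mul (β / 2)
  rw [mul_div_cancel₀ _ (two_ne_zero)] at h2
  linarith

lemma cos_succ_add_cos_pred {m : ℕ} (β : ℝ) :
    Real.cos ((m + 1 + 1 : ℕ) * β) + Real.cos (m * β) =
      2 * Real.cos β * Real.cos ((m + 1 : ℕ) * β) := by
  rw [show ((m + 1 + 1 : ℕ) : ℝ) * β = (m + 1 : ℕ) * β + β by push_cast; ring,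
    show (m : ℝ) * β = (m + 1 : ℕ) * β - β by push_cast; ring, Real.cos_add, Real.cos_sub]
  ring

/-- A linear relation between values of the kernel follows from the one between its integrands,
which is stated free of denominators. -/
lemma four_mul_quadrant (n m n1 m1 n2 m2 n3 m3 n4 m4 : ℕ) (c : ℝ → ℝ) (hc : Continuous c)
    (h : ∀ β ∈ Set.Ioo 0 Real.pi, 1 - rho (Real.sin (β / 2)) ^ n1 * Real.cos (m1 * β) +
      (1 - rho (Real.sin (β / 2)) ^ n2 * Real.cos (m2 * β)) +
      (1 - rho (Real.sin (β / 2)) ^ n3 * Real.cos (m3 * β)) +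
      (1 - rho (Real.sin (β / 2)) ^ n4 * Real.cos (m4 * β)) =
      4 * (1 - rho (Real.sin (β / 2)) ^ n * Real.cos (m * β)) +
      2 * Real.sin (β / 2) * w (Real.sin (β / 2)) * c β) :
    quadrant n1 m1 + quadrant n2 m2 + quadrant n3 m3 + quadrant n4 m4 = 4 * quadrant n m +
      (1 / Real.pi) * ∫ β in (0 : ℝ)..Real.pi, c β := by
  have hi : ∀ n m, IntervalIntegrable (density n m) volume 0 Real.pi := fun n m =>
    (continuous_density n m).intervalIntegrable _ _
  have hci : IntervalIntegrable c volume 0 Real.pi := hc.intervalIntegrable _ _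
  simp only [quadrant]
  rw [mul_left_comm, ← mul_add, ← mul_add, ← mul_add, ← mul_add,
    ← intervalIntegral.integral_const_mul,
    ← intervalIntegral.integral_add (hi _ _) (hi _ _),
    ← intervalIntegral.integral_add ((hi _ _).add (hi _ _)) (hi _ _),
    ← intervalIntegral.integral_add (((hi _ _).add (hi _ _)).add (hi _ _)) (hi _ _),
    ← intervalIntegral.integral_add ((hi _ _).const_mul 4) hci]
  congr 1
  refine intervalIntegral.integral_congr_Ioo_of_le Real.pi_pos.le fun β hβ => ?_
  refine eq_of_two_mul_mul_eq hβ ?_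
  simp only [mul_add, two_mul_density]
  rw [mul_left_comm, two_mul_density, h β hβ]

/-- Off the vertical axis this is the characteristic equation `cosh r + cos β = 2` of
`rho = exp (-r)`. On it the reflection leaves the integral of `cos (m * β)`, which is zero unless
`m = 0`. -/
lemma potential_harmonic {z : ℤ × ℤ} (hz : z ≠ 0) : planeAvg potential z = potential z := by
  have key : ∀ n m : ℕ, (n ≠ 0 ∨ m ≠ 0) →
      quadrant (n + 1) m + quadrant ((n : ℤ) - 1).natAbs m +
        quadrant n (m + 1) + quadrant n ((m : ℤ) - 1).natAbs = 4 * quadrant n m := by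
    intro n m h
    have hcos : ∀ β : ℝ, Real.cos ((m + 1 : ℕ) * β) + Real.cos (((m : ℤ) - 1).natAbs * β) =
        2 * Real.cos β * Real.cos (m * β) := by
      intro β
      rcases m with _ | m
      · simp; ring
      · rw [← cos_succ_add_cos_pred]
        congr 4
        omega
    rcases n with _ | n
    · have hm : 1 ≤ m := Nat.one_le_iff_ne_zero.2 (by simpa using h)
      have := four_mul_quadrant 0 m (0 + 1) m ((0 : ℕ) - 1 : ℤ).natAbs m 0 (m + 1) 0
        ((m : ℤ) - 1).natAbs (fun β => 2 * Real.cos (m * β)) (by fun_prop) fun β _ => ?_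
      · rw [this, intervalIntegral.integral_const_mul, integral_cos_nat_mul hm]
        ring
      · have h1 := hcos β
        have h2 := one_sub_rho (Real.sin (β / 2))
        have h3 := cos_eq_one_sub_sin_half β
        have h4 : ((0 : ℕ) - 1 : ℤ).natAbs = 1 := rfl
        rw [h4, zero_add, pow_one, pow_zero]
        rw [h3] at h1
        linear_combination -h1 + 2 * Real.cos (m * β) * h2
    · have := four_mul_quadrant (n + 1) m (n + 1 + 1) m ((n + 1 : ℕ) - 1 : ℤ).natAbs m (n + 1)
        (m + 1) (n + 1) ((m : ℤ) - 1).natAbs (fun β => 0) (by fun_prop) fun β _ => ?_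
      · rw [this]; simp
      · have h1 := hcos β
        have h2 := rho_sq_add_one (Real.sin (β / 2))
        have h3 := cos_eq_one_sub_sin_half β
        have h4 : ((n + 1 : ℕ) - 1 : ℤ).natAbs = n := by omega
        rw [h3] at h1
        rw [h4, pow_succ, pow_succ]
        linear_combination -rho (Real.sin (β / 2)) ^ n * rho (Real.sin (β / 2)) * h1 -
          rho (Real.sin (β / 2)) ^ n * Real.cos (m * β) * h2
  have key1 : ∀ (a : ℤ) (m : ℕ), quadrant (a + 1).natAbs m + quadrant (a + -1).natAbs m =
      quadrant (a.natAbs + 1) m + quadrant ((a.natAbs : ℤ) - 1).natAbs m := by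
    intro a m
    rcases lt_trichotomy a 0 with h | rfl | h
    · rw [add_comm, show (a + -1).natAbs = a.natAbs + 1 by omega,
        show (a + 1).natAbs = ((a.natAbs : ℤ) - 1).natAbs by omega]
    · rfl
    · rw [show (a + 1).natAbs = a.natAbs + 1 by omega,
        show (a + -1).natAbs = ((a.natAbs : ℤ) - 1).natAbs by omega]
  have key2 : ∀ (a : ℤ) (n : ℕ), quadrant n (a + 1).natAbs + quadrant n (a + -1).natAbs =
      quadrant n (a.natAbs + 1) + quadrant n ((a.natAbs : ℤ) - 1).natAbs := by
    intro a m
    rcases lt_trichotomy a 0 with h | rfl | h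
    · rw [add_comm, show (a + -1).natAbs = a.natAbs + 1 by omega,
        show (a + 1).natAbs = ((a.natAbs : ℤ) - 1).natAbs by omega]
    · rfl
    · rw [show (a + 1).natAbs = a.natAbs + 1 by omega,
        show (a + -1).natAbs = ((a.natAbs : ℤ) - 1).natAbs by omega]
  have hz' : z.1.natAbs ≠ 0 ∨ z.2.natAbs ≠ 0 := by
    by_contra! h
    exact hz (Prod.ext (by simpa using h.1) (by simpa using h.2))
  rw [planeAvg_apply, sum_latticeSteps]
  simp only [potential, Prod.fst_add, Prod.snd_add, add_zero]
  rw [key1, add_assoc, key2, ← add_assoc, key _ _ hz']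
  ring

end PotentialKernel

section KilledChain

open PotentialKernel

/-! ### The killed jump chain -/

/-- A linear operator on functions of configurations is monotone with range `r` if its value at `x`
depends monotonically on the function, and only on its values within distance `r` of `x`. -/
def MonotoneWithRange {N : ℕ} (A : Module.End ℝ (Config N → ℝ)) (r : ℝ) : Prop :=
  ∀ (f g : Config N → ℝ) (x : Config N), (∀ y, ‖y - x‖ ≤ r → f y ≤ g y) → A f x ≤ A g x

namespace MonotoneWithRange

variable {N : ℕ} {A B : Module.End ℝ (Config N → ℝ)} {r s : ℝ}

lemma one : MonotoneWithRange (1 : Module.End ℝ (Config N → ℝ)) 0 := fun f g x h => by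
  simpa using h x (by simp)

lemma mul (hA : MonotoneWithRange A r) (hB : MonotoneWithRange B s) :
    MonotoneWithRange (A * B) (r + s) := fun f g x h => by
  refine hA _ _ x fun y hy => hB _ _ y fun z hz => h z ?_
  have := norm_add_le (z - y) (y - x)
  rw [sub_add_sub_cancel] at this
  linarith

lemma pow (hA : MonotoneWithRange A r) (n : ℕ) : MonotoneWithRange (A ^ n) (n * r) := by
  induction n with
  | zero => simpa using one
  | succ n ih =>
    rw [pow_succ]
    convert ih.mul hA using 1
    push_cast
    ring

lemma mono (hA : MonotoneWithRange A r) {f g : Config N → ℝ} (h : ∀ y, f y ≤ g y) (x : Config N) :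
    A f x ≤ A g x := hA f g x fun y _ => h y

lemma nonneg (hA : MonotoneWithRange A r) {f : Config N → ℝ} (h : ∀ y, 0 ≤ f y) (x : Config N) :
    0 ≤ A f x := by
  simpa using hA.mono (f := 0) (g := f) h x

lemma abs_le (hA : MonotoneWithRange A r) {f g : Config N → ℝ} {x : Config N}
    (h : ∀ y, ‖y - x‖ ≤ r → |f y| ≤ g y) : |A f x| ≤ A g x := by
  refine _root_.abs_le.2 ⟨?_, hA _ _ x fun y hy => (le_abs_self _).trans (h y hy)⟩
  have h := hA (-f) g x fun y hy => (neg_le_abs _).trans (h y hy)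
  rw [map_neg, Pi.neg_apply] at h
  linarith

end MonotoneWithRange

lemma norm_single_le_one {N : ℕ} (i : Fin N) {e : ℤ × ℤ} (he : e ∈ latticeSteps) :
    ‖(Pi.single i e : Config N)‖ ≤ 1 := by
  refine (pi_norm_le_iff_of_nonneg zero_le_one).2 fun j => ?_
  rcases eq_or_ne j i with rfl | h
  · simpa using norm_le_one_of_mem_latticeSteps he
  · simp [Pi.single_eq_of_ne h]

lemma stepAvg_monotoneWithRange {N : ℕ} : MonotoneWithRange (stepAvg N) 1 := fun f g x h => by
  simp only [stepAvg_apply, tokenAvg_apply]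
  gcongr with i _ e he
  exact h _ (by simpa using norm_single_le_one i he)

/-- The collision-free configurations. -/
def collisionFree (N : ℕ) : Set (Config N) := {y | Function.Injective y}

/-- One step of the jump chain, killed when it leaves the collision-free configurations. -/
noncomputable def killedStep (N : ℕ) : Module.End ℝ (Config N → ℝ) where
  toFun f := (collisionFree N).indicator (stepAvg N f)
  map_add' f g := by rw [map_add, Set.indicator_add']
  map_smul' c f := by
    funext y
    by_cases hy : y ∈ collisionFree N <;> simp [hy]

lemma killedStep_apply {N : ℕ} (f : Config N → ℝ) :
    killedStep N f = (collisionFree N).indicator (stepAvg N f) := rfl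

lemma killedStep_monotoneWithRange {N : ℕ} : MonotoneWithRange (killedStep N) 1 :=
  fun f g x h => by
    rw [killedStep_apply, killedStep_apply]
    by_cases hx : x ∈ collisionFree N
    · simpa [hx] using stepAvg_monotoneWithRange f g x h
    · simp [hx]

lemma killedStep_le_stepAvg {N : ℕ} {f : Config N → ℝ} (hf : ∀ y, 0 ≤ f y) (y : Config N) :
    killedStep N f y ≤ stepAvg N f y :=
  Set.indicator_apply_le' (fun _ => le_rfl) fun _ => stepAvg_monotoneWithRange.nonneg hf y

lemma killedStep_pow_le {N : ℕ} {f : Config N → ℝ} (hf : ∀ y, 0 ≤ f y) (n : ℕ) (y : Config N) :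
    ((killedStep N) ^ n) f y ≤ ((stepAvg N) ^ n) f y := by
  induction n generalizing y with
  | zero => simp
  | succ n ih =>
    rw [pow_succ', pow_succ', Module.End.mul_apply, Module.End.mul_apply]
    exact (killedStep_le_stepAvg ((killedStep_monotoneWithRange.pow n).nonneg hf) y).trans
      (stepAvg_monotoneWithRange.mono ih y)

lemma killedStep_pow_eq_zero {N : ℕ} {f : Config N → ℝ} (hf : ∀ y ∉ collisionFree N, f y = 0)
    (n : ℕ) {y : Config N} (hy : y ∉ collisionFree N) : ((killedStep N) ^ n) f y = 0 := by
  rcases n with _ | n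
  · simpa using hf y hy
  · rw [pow_succ', Module.End.mul_apply, killedStep_apply, Set.indicator_of_notMem hy]

/-- The indicator function of the collision-free configurations. -/
noncomputable def alive (N : ℕ) : Config N → ℝ := (collisionFree N).indicator 1

lemma alive_of_mem {N : ℕ} {y : Config N} (hy : y ∈ collisionFree N) : alive N y = 1 := by
  simp [alive, hy]

lemma alive_of_notMem {N : ℕ} {y : Config N} (hy : y ∉ collisionFree N) : alive N y = 0 := by
  simp [alive, hy]

lemma alive_nonneg {N : ℕ} (y : Config N) : 0 ≤ alive N y :=
  Set.indicator_nonneg (fun _ _ => zero_le_one) y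

lemma alive_le_one {N : ℕ} (y : Config N) : alive N y ≤ 1 :=
  Set.indicator_le_self' (fun _ _ => zero_le_one) y

/-- `T` steps of the free chain followed by `n` steps of the killed chain. -/
noncomputable def delayedChain (N T n : ℕ) : Module.End ℝ (Config N → ℝ) :=
  (stepAvg N) ^ T * (killedStep N) ^ n

lemma delayedChain_monotoneWithRange {N T n : ℕ} :
    MonotoneWithRange (delayedChain N T n) ((T + n : ℕ) : ℝ) := by
  have h := (stepAvg_monotoneWithRange (N := N).pow T).mul (killedStep_monotoneWithRange.pow n)
  rwa [mul_one, mul_one, ← Nat.cast_add] at h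

lemma delayedChain_le {N T n : ℕ} {f : Config N → ℝ} (hf : ∀ y, 0 ≤ f y) (y : Config N) :
    delayedChain N T n f y ≤ ((stepAvg N) ^ (T + n)) f y := by
  rw [delayedChain, pow_add, Module.End.mul_apply, Module.End.mul_apply]
  exact (stepAvg_monotoneWithRange.pow T).mono (killedStep_pow_le hf n) y

/-- Markov property: a function with free mean at most `c` after `r` steps, which vanishes at
collisions, has killed mean at most `c` times the survival probability `r` steps earlier. -/
lemma delayedChain_add_le {N T n r : ℕ} {f : Config N → ℝ} {c : ℝ}
    (hf : ∀ y, 0 ≤ f y) (hf0 : ∀ y ∉ collisionFree N, f y = 0)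
    (h : ∀ y, ((stepAvg N) ^ r) f y ≤ c) (y : Config N) :
    delayedChain N T (n + r) f y ≤ c * delayedChain N T n (alive N) y := by
  rw [delayedChain, pow_add, ← mul_assoc, Module.End.mul_apply, ← delayedChain,
    ← smul_eq_mul, ← Pi.smul_apply, ← map_smul]
  refine delayedChain_monotoneWithRange.mono (fun z => ?_) y
  by_cases hz : z ∈ collisionFree N
  · rw [Pi.smul_apply, alive_of_mem hz, smul_eq_mul, mul_one]
    exact (killedStep_pow_le hf r z).trans (h z)
  · rw [killedStep_pow_eq_zero hf0 r hz, Pi.smul_apply, alive_of_notMem hz, smul_zero]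

/-- The pairs of tokens. -/
def tokenPairs (N : ℕ) : Finset (Fin N × Fin N) := Finset.univ.filter fun p => p.1 < p.2

lemma mem_tokenPairs {N : ℕ} {p : Fin N × Fin N} : p ∈ tokenPairs N ↔ p.1 < p.2 := by
  simp [tokenPairs]

lemma card_tokenPairs (N : ℕ) : (tokenPairs N).card = N.choose 2 := by
  have h : (tokenPairs N).card = ∑ i : Fin N, (Finset.Ioi i).card := by
    rw [tokenPairs, Finset.card_filter, Fintype.sum_prod_type]
    refine Finset.sum_congr rfl fun i _ => ?_
    rw [← Finset.card_filter]
    congr 1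
    ext j; simp
  rw [h]
  simp only [Fin.card_Ioi]
  rw [Fin.sum_univ_eq_sum_range fun i => N - 1 - i, Finset.sum_range_reflect (fun i => i) N,
    Finset.sum_range_id, Nat.choose_two_right]

/-- The difference of the positions of a pair of tokens. -/
def pairDiff {N : ℕ} (y : Config N) (p : Fin N × Fin N) : ℤ × ℤ := y p.1 - y p.2

lemma pairDiff_ne_zero {N : ℕ} {y : Config N} (hy : y ∈ collisionFree N) {p : Fin N × Fin N}
    (hp : p ∈ tokenPairs N) : pairDiff y p ≠ 0 := fun h =>
  (mem_tokenPairs.1 hp).ne (hy (sub_eq_zero.1 h))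

lemma exists_pairDiff_eq_zero {N : ℕ} {y : Config N} (hy : y ∉ collisionFree N) :
    ∃ p ∈ tokenPairs N, pairDiff y p = 0 := by
  simp only [collisionFree, Set.mem_ofPred_eq, Function.Injective] at hy
  push Not at hy
  obtain ⟨i, j, hij, hne⟩ := hy
  rcases lt_or_gt_of_ne hne with h | h
  · exact ⟨(i, j), mem_tokenPairs.2 h, sub_eq_zero.2 hij⟩
  · exact ⟨(j, i), mem_tokenPairs.2 h, sub_eq_zero.2 hij.symm⟩

/-- The product over the pairs of tokens of the potential kernel of their difference. -/
noncomputable def potentialProd {N : ℕ} (y : Config N) : ℝ :=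
  ∏ p ∈ tokenPairs N, potential (pairDiff y p)

lemma potentialProd_nonneg {N : ℕ} (y : Config N) : 0 ≤ potentialProd y :=
  Finset.prod_nonneg fun _ _ => potential_nonneg _

lemma potentialProd_eq_zero {N : ℕ} {y : Config N} (hy : y ∉ collisionFree N) :
    potentialProd y = 0 := by
  obtain ⟨p, hp, h⟩ := exists_pairDiff_eq_zero hy
  exact Finset.prod_eq_zero hp (by rw [h, potential_zero])

/-- First order expansion of a product. -/
lemma abs_prod_add_sub_prod_le {ι : Type*} [DecidableEq ι] (s : Finset ι) {a δ : ι → ℝ} {L : ℝ}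
    (hL : 1 ≤ L) (ha : ∀ i ∈ s, |a i| ≤ L) (hb : ∀ i ∈ s, |a i + δ i| ≤ L) :
    |∏ i ∈ s, (a i + δ i) - ∏ i ∈ s, a i| ≤ (∑ i ∈ s, |δ i|) * (L ^ s.card / L) := by
  have hL0 : 0 < L := by linarith
  induction s using Finset.induction_on with
  | empty => simp
  | insert r s hr ih =>
    have ih' := ih (fun i hi => ha i (by simp [hi])) (fun i hi => hb i (by simp [hi]))
    rw [Finset.prod_insert hr, Finset.prod_insert hr, Finset.sum_insert hr,
      Finset.card_insert_of_notMem hr]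
    have hprod : |∏ i ∈ s, a i| ≤ L ^ s.card := by
      rw [Finset.abs_prod]
      exact (Finset.prod_le_prod (fun _ _ => abs_nonneg _) fun i hi =>
        ha i (by simp [hi])).trans_eq (Finset.prod_const L)
    rw [show (a r + δ r) * ∏ i ∈ s, (a i + δ i) - a r * ∏ i ∈ s, a i =
      (a r + δ r) * (∏ i ∈ s, (a i + δ i) - ∏ i ∈ s, a i) + δ r * ∏ i ∈ s, a i by ring]
    refine (abs_add_le _ _).trans ?_
    rw [abs_mul, abs_mul]
    calc _ ≤ L * ((∑ i ∈ s, |δ i|) * (L ^ s.card / L)) + |δ r| * L ^ s.card := by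
          gcongr
          exact hb r (by simp)
      _ = _ := by rw [pow_succ]; field_simp; ring

/-- Second order expansion of a product. -/
lemma abs_prod_add_sub_linear_le {ι : Type*} [DecidableEq ι] (s : Finset ι) {a δ : ι → ℝ} {L : ℝ}
    (hL : 1 ≤ L) (ha : ∀ i ∈ s, |a i| ≤ L) (hb : ∀ i ∈ s, |a i + δ i| ≤ L) :
    |∏ i ∈ s, (a i + δ i) - ∏ i ∈ s, a i - ∑ i ∈ s, δ i * ∏ j ∈ s.erase i, a j| ≤
      (∑ i ∈ s, ∑ j ∈ s, if i ≠ j then |δ i| * |δ j| else 0) * (L ^ s.card / L ^ 2) := by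
  have hL0 : 0 < L := by linarith
  induction s using Finset.induction_on with
  | empty => simp
  | insert r s hr ih =>
    have ih' := ih (fun i hi => ha i (by simp [hi])) (fun i hi => hb i (by simp [hi]))
    have h1 := abs_prod_add_sub_prod_le s hL (fun i hi => ha i (by simp [hi]))
      (fun i hi => hb i (by simp [hi]))
    have hlin : ∑ i ∈ insert r s, δ i * ∏ j ∈ (insert r s).erase i, a j =
        δ r * ∏ j ∈ s, a j + a r * ∑ i ∈ s, δ i * ∏ j ∈ s.erase i, a j := by
      rw [Finset.sum_insert hr, Finset.erase_insert hr, Finset.mul_sum]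
      congr 1
      refine Finset.sum_congr rfl fun i hi => ?_
      have hne : r ≠ i := fun h => hr (h ▸ hi)
      rw [Finset.erase_insert_of_ne hne, Finset.prod_insert (by simp [hr])]
      ring
    have hsum : (∑ j ∈ s, |δ r| * |δ j|) + ∑ i ∈ s, ∑ j ∈ s, (if i ≠ j then |δ i| * |δ j| else 0) ≤
        ∑ i ∈ insert r s, ∑ j ∈ insert r s, if i ≠ j then |δ i| * |δ j| else 0 := by
      rw [Finset.sum_insert hr, Finset.sum_insert hr]
      simp only [ne_eq, not_true_eq_false, if_false, zero_add]
      refine add_le_add (le_of_eq (Finset.sum_congr rfl fun j hj => ?_))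
        (Finset.sum_le_sum fun i hi => Finset.sum_le_sum_of_subset_of_nonneg
          (Finset.subset_insert _ _) fun _ _ _ => by split_ifs <;> positivity)
      rw [if_pos fun h : r = j => hr (h ▸ hj)]
    rw [hlin, Finset.prod_insert hr, Finset.prod_insert hr, Finset.card_insert_of_notMem hr]
    rw [show (a r + δ r) * ∏ i ∈ s, (a i + δ i) - a r * ∏ i ∈ s, a i -
        (δ r * ∏ j ∈ s, a j + a r * ∑ i ∈ s, δ i * ∏ j ∈ s.erase i, a j) =
      a r * (∏ i ∈ s, (a i + δ i) - ∏ i ∈ s, a i - ∑ i ∈ s, δ i * ∏ j ∈ s.erase i, a j) +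
        δ r * (∏ i ∈ s, (a i + δ i) - ∏ i ∈ s, a i) by ring]
    refine (abs_add_le _ _).trans ?_
    rw [abs_mul, abs_mul]
    calc _ ≤ L * ((∑ i ∈ s, ∑ j ∈ s, if i ≠ j then |δ i| * |δ j| else 0) *
            (L ^ s.card / L ^ 2)) + |δ r| * ((∑ i ∈ s, |δ i|) * (L ^ s.card / L)) := by
          gcongr
          exact ha r (by simp)
      _ = ((∑ j ∈ s, |δ r| * |δ j|) +
            ∑ i ∈ s, ∑ j ∈ s, if i ≠ j then |δ i| * |δ j| else 0) *
            (L ^ (s.card + 1) / L ^ 2) := by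
          rw [← Finset.mul_sum, pow_succ]; field_simp; ring
      _ ≤ _ := by gcongr

lemma tokenAvg_fst_diff {N : ℕ} {i j : Fin N} (hij : i ≠ j) (F : ℤ × ℤ → ℝ) (y : Config N) :
    tokenAvg i (fun y => F (y i - y j)) y = planeAvg F (y i - y j) := by
  rw [tokenAvg_apply, planeAvg_apply]
  simp only [Pi.add_apply, Pi.single_eq_same, Pi.single_eq_of_ne hij.symm, add_zero,
    add_sub_right_comm]

lemma pairDiff_add_single_of_ne {N : ℕ} {k : Fin N} {p : Fin N × Fin N} (h1 : p.1 ≠ k)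
    (h2 : p.2 ≠ k) (y : Config N) (e : ℤ × ℤ) :
    pairDiff (y + Pi.single k e) p = pairDiff y p := by
  simp [pairDiff, Pi.single_eq_of_ne h1, Pi.single_eq_of_ne h2]

/-- Each factor of `potentialProd` is harmonic in the position of every token as long as there is no
collision. -/
lemma tokenAvg_potential_pairDiff {N : ℕ} (k : Fin N) {y : Config N} (hy : y ∈ collisionFree N)
    {p : Fin N × Fin N} (hp : p ∈ tokenPairs N) :
    tokenAvg k (fun y => potential (pairDiff y p)) y = potential (pairDiff y p) := by
  have hne := (mem_tokenPairs.1 hp).ne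
  have hz := potential_harmonic (pairDiff_ne_zero hy hp)
  rcases eq_or_ne p.1 k with h1 | h1
  · subst h1
    exact (tokenAvg_fst_diff hne potential y).trans hz
  · rcases eq_or_ne p.2 k with h2 | h2
    · subst h2
      have := tokenAvg_pow_diff hne potential 1 y
      rw [pow_one, pow_one] at this
      exact this.trans hz
    · simp only [tokenAvg_apply, pairDiff_add_single_of_ne h1 h2, Finset.sum_const,
        card_latticeSteps, nsmul_eq_mul]
      push_cast
      ring

lemma abs_potential_pairDiff_sub_le {N : ℕ} (k : Fin N) {e : ℤ × ℤ} (he : e ∈ latticeSteps)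
    (y : Config N) {p : Fin N × Fin N} (hp : p ∈ tokenPairs N) :
    |potential (pairDiff (y + Pi.single k e) p) - potential (pairDiff y p)| ≤
      if p.1 = k ∨ p.2 = k then 16 * (1 / (1 + ‖pairDiff y p‖)) else 0 := by
  have hne := (mem_tokenPairs.1 hp).ne
  by_cases h1 : p.1 = k
  · subst h1
    rw [if_pos (Or.inl rfl)]
    have : pairDiff (y + Pi.single p.1 e) p = pairDiff y p + e := by
      simp [pairDiff, Pi.single_eq_of_ne hne.symm, add_sub_right_comm]
    rw [this]
    exact abs_potential_add_sub_le he _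
  · by_cases h2 : p.2 = k
    · subst h2
      rw [if_pos (Or.inr rfl)]
      have : pairDiff (y + Pi.single p.2 e) p = pairDiff y p + -e := by
        simp [pairDiff, Pi.single_eq_of_ne hne]
        abel
      rw [this]
      have he' : -e ∈ latticeSteps := by
        simp only [latticeSteps, Finset.mem_insert, Finset.mem_singleton] at he ⊢
        rcases he with rfl | rfl | rfl | rfl <;> simp
      exact abs_potential_add_sub_le he' _
    · rw [if_neg (by simp [h1, h2]), pairDiff_add_single_of_ne h1 h2, sub_self, abs_zero]

/-- The sum, over all ways in which a move of one token affects two pairs at once, of the product of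
the inverse distances of these pairs. It controls the failure of `potentialProd` to be harmonic. -/
noncomputable def crossWeight {N : ℕ} (y : Config N) : ℝ :=
  ∑ k : Fin N, ∑ p ∈ tokenPairs N, ∑ q ∈ tokenPairs N,
    if p ≠ q ∧ (p.1 = k ∨ p.2 = k) ∧ (q.1 = k ∨ q.2 = k) then
      1 / (1 + ‖pairDiff y p‖) * (1 / (1 + ‖pairDiff y q‖)) else 0

lemma crossWeight_nonneg {N : ℕ} (y : Config N) : 0 ≤ crossWeight y :=
  Finset.sum_nonneg fun _ _ => Finset.sum_nonneg fun _ _ => Finset.sum_nonneg fun _ _ => by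
    split_ifs <;> positivity

/-- The move of a token changes `potentialProd` in the mean only by terms of second order, in which
two pairs containing the token change. -/
lemma abs_tokenAvg_potentialProd_sub_le {N : ℕ} (k : Fin N) {y : Config N}
    (hy : y ∈ collisionFree N) {L : ℝ} (hL : 1 ≤ L)
    (h : ∀ p ∈ tokenPairs N, potential (pairDiff y p) ≤ L)
    (h' : ∀ e ∈ latticeSteps, ∀ p ∈ tokenPairs N,
      potential (pairDiff (y + Pi.single k e) p) ≤ L) :
    |tokenAvg k potentialProd y - potentialProd y| ≤
      256 * (L ^ (N.choose 2) / L ^ 2) * ∑ p ∈ tokenPairs N, ∑ q ∈ tokenPairs N,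
        if p ≠ q ∧ (p.1 = k ∨ p.2 = k) ∧ (q.1 = k ∨ q.2 = k) then
          1 / (1 + ‖pairDiff y p‖) * (1 / (1 + ‖pairDiff y q‖)) else 0 := by
  have hL0 : 0 < L := by linarith
  set S := ∑ p ∈ tokenPairs N, ∑ q ∈ tokenPairs N,
        if p ≠ q ∧ (p.1 = k ∨ p.2 = k) ∧ (q.1 = k ∨ q.2 = k) then
          1 / (1 + ‖pairDiff y p‖) * (1 / (1 + ‖pairDiff y q‖)) else 0 with hS
  set δ : ℤ × ℤ → Fin N × Fin N → ℝ := fun e p =>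
    potential (pairDiff (y + Pi.single k e) p) - potential (pairDiff y p) with hδ
  set c : Fin N × Fin N → ℝ := fun p => ∏ q ∈ (tokenPairs N).erase p, potential (pairDiff y q)
  -- harmonicity of the kernel off the origin cancels the linear term
  have hlin : ∑ e ∈ latticeSteps, ∑ p ∈ tokenPairs N, δ e p * c p = 0 := by
    rw [Finset.sum_comm]
    refine Finset.sum_eq_zero fun p hp => ?_
    rw [← Finset.sum_mul]
    have := tokenAvg_potential_pairDiff k hy hp
    rw [tokenAvg_apply] at this
    rw [hδ, Finset.sum_sub_distrib, Finset.sum_const, card_latticeSteps, nsmul_eq_mul]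
    refine mul_eq_zero_of_left ?_ _
    push_cast
    linarith
  have hquad : ∀ e ∈ latticeSteps,
      |potentialProd (y + Pi.single k e) - potentialProd y - ∑ p ∈ tokenPairs N, δ e p * c p| ≤
        256 * (L ^ (N.choose 2) / L ^ 2) * S := by
    intro e he
    have h1 := abs_prod_add_sub_linear_le (tokenPairs N) (a := fun p => potential (pairDiff y p))
      (δ := δ e) hL (fun p hp => by
        rw [abs_of_nonneg (potential_nonneg _)]; exact h p hp) (fun p hp => by
        simp only [hδ, add_sub_cancel]
        rw [abs_of_nonneg (potential_nonneg _)]; exact h' e he p hp)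
    simp only [hδ, add_sub_cancel, card_tokenPairs] at h1
    refine h1.trans ?_
    rw [mul_right_comm, hS, Finset.mul_sum]
    refine mul_le_mul_of_nonneg_right (Finset.sum_le_sum fun p hp => ?_) (by positivity)
    rw [Finset.mul_sum]
    refine Finset.sum_le_sum fun q hq => ?_
    have bp := abs_potential_pairDiff_sub_le k he y hp
    have bq := abs_potential_pairDiff_sub_le k he y hq
    by_cases hpq : p = q
    · simp [hpq]
    · by_cases hp' : p.1 = k ∨ p.2 = k
      · by_cases hq' : q.1 = k ∨ q.2 = k
        · rw [if_pos hp'] at bp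
          rw [if_pos hq'] at bq
          rw [if_pos hpq, if_pos ⟨hpq, hp', hq'⟩]
          refine (mul_le_mul bp bq (abs_nonneg _) (by positivity)).trans_eq (by ring)
        · rw [if_neg hq'] at bq
          rw [if_pos hpq, if_neg (by tauto), le_antisymm bq (abs_nonneg _)]
          simp
      · rw [if_neg hp'] at bp
        rw [if_pos hpq, if_neg (by tauto), le_antisymm bp (abs_nonneg _)]
        simp
  have e1 : tokenAvg k potentialProd y - potentialProd y = (1 / 4) * ∑ e ∈ latticeSteps,
      (potentialProd (y + Pi.single k e) - potentialProd y - ∑ p ∈ tokenPairs N, δ e p * c p) := by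
    rw [Finset.sum_sub_distrib, Finset.sum_sub_distrib, hlin, tokenAvg_apply, Finset.sum_const,
      card_latticeSteps, nsmul_eq_mul]
    push_cast
    ring
  rw [e1, abs_mul, abs_of_pos (by norm_num)]
  have h3 := (Finset.abs_sum_le_sum_abs _ _).trans (Finset.sum_le_sum hquad)
  rw [Finset.sum_const, card_latticeSteps, nsmul_eq_mul] at h3
  push_cast at h3
  linarith

lemma abs_stepAvg_potentialProd_sub_le {N : ℕ} [NeZero N] {y : Config N}
    (hy : y ∈ collisionFree N) {L : ℝ} (hL : 1 ≤ L)
    (h : ∀ z : Config N, ‖z - y‖ ≤ 1 → ∀ p ∈ tokenPairs N, potential (pairDiff z p) ≤ L) :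
    |stepAvg N potentialProd y - potentialProd y| ≤
      256 * (L ^ (N.choose 2) / L ^ 2) * crossWeight y := by
  have hL0 : 0 < L := by linarith
  have hN1 : (1 : ℝ) ≤ N := by exact_mod_cast NeZero.one_le
  have e : stepAvg N potentialProd y - potentialProd y =
      (1 / N : ℝ) * ∑ k : Fin N, (tokenAvg k potentialProd y - potentialProd y) := by
    rw [Finset.sum_sub_distrib, stepAvg_apply, Finset.sum_const, Finset.card_univ,
      Fintype.card_fin, nsmul_eq_mul]
    field_simp
  rw [e, abs_mul, abs_of_pos (by positivity)]
  refine (mul_le_of_le_one_left (abs_nonneg _) ?_).trans ?_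
  · rw [div_le_one (by linarith)]; exact hN1
  · rw [crossWeight, Finset.mul_sum]
    refine (Finset.abs_sum_le_sum_abs _ _).trans (Finset.sum_le_sum fun k _ =>
      abs_tokenAvg_potentialProd_sub_le k hy hL (h y (by simp)) fun e he =>
        h _ (by simpa using norm_single_le_one k he))

/-- Two pairs that share a token involve two further tokens, so their inverse distances, of order
`n ^ (-1/2)` each, can be averaged one after the other. -/
lemma stepAvg_pow_crossWeight_le {N : ℕ} [NeZero N] (n : ℕ) (y : Config N) :
    ((stepAvg N) ^ n) crossWeight y ≤ N * (N.choose 2) ^ 2 * (2500 * N) / (n + 1) := by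
  have hfun : (crossWeight : Config N → ℝ) = ∑ k : Fin N, ∑ p ∈ tokenPairs N, ∑ q ∈ tokenPairs N,
      fun y => if p ≠ q ∧ (p.1 = k ∨ p.2 = k) ∧ (q.1 = k ∨ q.2 = k) then
        1 / (1 + ‖pairDiff y p‖) * (1 / (1 + ‖pairDiff y q‖)) else 0 := by
    funext y
    simp only [crossWeight, Finset.sum_apply]
  have hb : ∀ k : Fin N, ∀ p ∈ tokenPairs N, ∀ q ∈ tokenPairs N, ((stepAvg N) ^ n)
      (fun y => if p ≠ q ∧ (p.1 = k ∨ p.2 = k) ∧ (q.1 = k ∨ q.2 = k) then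
        1 / (1 + ‖pairDiff y p‖) * (1 / (1 + ‖pairDiff y q‖)) else 0) y ≤ 2500 * N / (n + 1) := by
    intro k p hp q hq
    have hpn := (mem_tokenPairs.1 hp).ne
    have hqn := (mem_tokenPairs.1 hq).ne
    by_cases hc : p ≠ q ∧ (p.1 = k ∨ p.2 = k) ∧ (q.1 = k ∨ q.2 = k)
    · have hother : ∀ p : Fin N × Fin N, p.1 ≠ p.2 → (p.1 = k ∨ p.2 = k) → ∃ j, k ≠ j ∧
          (p = (k, j) ∨ p = (j, k)) ∧ ∀ y : Config N, ‖pairDiff y p‖ = ‖y k - y j‖ := by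
        rintro ⟨a, b⟩ hab (rfl | rfl)
        · exact ⟨b, hab, Or.inl rfl, fun y => rfl⟩
        · exact ⟨a, hab.symm, Or.inr rfl, fun y => norm_sub_rev _ _⟩
      obtain ⟨j, hkj, hpj, hj⟩ := hother p hpn hc.2.1
      obtain ⟨j', hkj', hqj, hj'⟩ := hother q hqn hc.2.2
      have hjj : j ≠ j' := by
        rintro rfl
        have h1 := mem_tokenPairs.1 hp
        have h2 := mem_tokenPairs.1 hq
        rcases hpj with rfl | rfl <;> rcases hqj with rfl | rfl
        · exact hc.1 rfl
        · exact absurd h1 (not_lt.2 h2.le)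
        · exact absurd h1 (not_lt.2 h2.le)
        · exact hc.1 rfl
      simp only [if_pos hc, hj, hj']
      exact stepAvg_pow_inv_norm_mul_le hkj hkj' hjj n y
    · simp only [if_neg hc]
      have : ((stepAvg N) ^ n) (fun _ => (0 : ℝ)) y = 0 := by
        have h0 : (fun _ => (0 : ℝ)) = (0 : Config N → ℝ) := rfl
        rw [h0, map_zero]; rfl
      rw [this]
      positivity
  rw [hfun]
  simp only [map_sum, Finset.sum_apply]
  calc _ ≤ ∑ k : Fin N, ∑ p ∈ tokenPairs N, ∑ q ∈ tokenPairs N, 2500 * (N : ℝ) / (n + 1) :=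
        Finset.sum_le_sum fun k _ => Finset.sum_le_sum fun p hp => Finset.sum_le_sum fun q hq =>
          hb k p hp q hq
    _ = _ := by
        simp only [Finset.sum_const, card_tokenPairs, Finset.card_univ, Fintype.card_fin,
          nsmul_eq_mul]
        ring

variable {N : ℕ}

/-! ### Survival probabilities and weighted survival -/

/-- The logarithmic time scale of the jump chain; the shift makes it positive for all `s`. -/
noncomputable def logTime (s : ℕ) : ℝ := Real.log (s + 2)

lemma half_le_logTime (s : ℕ) : 1 / 2 ≤ logTime s := by
  have h : Real.log 2 ≤ logTime s :=
    Real.log_le_log (by norm_num) (by linarith [(Nat.cast_nonneg s : (0 : ℝ) ≤ s)])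
  linarith [Real.log_two_gt_d9]

lemma logTime_pos (s : ℕ) : 0 < logTime s := by linarith [half_le_logTime s]

lemma logTime_mono : Monotone logTime := fun a b h => by
  have : (a : ℝ) ≤ b := by exact_mod_cast h
  exact Real.log_le_log (by positivity) (by linarith)

lemma logTime_le_two_mul {a b : ℕ} (h : b + 2 ≤ (a + 2) ^ 2) : logTime b ≤ 2 * logTime a := by
  have h' : (b : ℝ) + 2 ≤ ((a : ℝ) + 2) ^ 2 := by exact_mod_cast h
  calc logTime b ≤ Real.log (((a : ℝ) + 2) ^ 2) := Real.log_le_log (by positivity) h'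
    _ = 2 * logTime a := by rw [Real.log_pow]; rfl

lemma tendsto_logTime : Tendsto logTime atTop atTop :=
  Real.tendsto_log_atTop.comp
    (tendsto_atTop_add_const_right _ _ (tendsto_natCast_atTop_atTop (R := ℝ)))

/-- The probability that `N` tokens started at `x`, which move freely for `T` steps, do not collide
during the subsequent `n` steps. -/
noncomputable def survival (x : Config N) (T n : ℕ) : ℝ := delayedChain N T n (alive N) x

/-- The expectation of `potentialProd` on the event whose probability is `survival`. -/
noncomputable def weighted (x : Config N) (T n : ℕ) : ℝ := delayedChain N T n potentialProd x

lemma survival_nonneg (x : Config N) (T n : ℕ) : 0 ≤ survival x T n :=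
  delayedChain_monotoneWithRange.nonneg alive_nonneg x

lemma weighted_nonneg (x : Config N) (T n : ℕ) : 0 ≤ weighted x T n :=
  delayedChain_monotoneWithRange.nonneg potentialProd_nonneg x

lemma stepAvg_pow_const_le [NeZero N] (n : ℕ) (c : ℝ) (x : Config N) :
    ((stepAvg N) ^ n) (fun _ => c) x ≤ c := by
  simpa using (stepAvg_supBounded.pow n) (fun _ => c) c (fun _ => le_rfl) x

lemma survival_le_one [NeZero N] (x : Config N) (T n : ℕ) : survival x T n ≤ 1 :=
  (delayedChain_le alive_nonneg x).trans <|
    ((stepAvg_monotoneWithRange.pow _).mono alive_le_one x).trans (stepAvg_pow_const_le _ _ x)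

/-- The constant in the bound of the potential kernel on the range of the chain started at `x`. -/
noncomputable def rangeConst (x : Config N) : ℝ := 2 * (20 + Real.log (2 * ‖x‖ + 3)) + 1

lemma rangeConst_ge (x : Config N) : 41 ≤ rangeConst x := by
  have := Real.log_nonneg (x := 2 * ‖x‖ + 3) (by linarith [norm_nonneg x])
  unfold rangeConst
  linarith

lemma one_le_rangeConst_mul (x : Config N) (s : ℕ) : 1 ≤ rangeConst x * logTime s := by
  nlinarith [rangeConst_ge x, half_le_logTime s]

lemma norm_pairDiff_le (y : Config N) (p : Fin N × Fin N) : ‖pairDiff y p‖ ≤ 2 * ‖y‖ := by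
  refine (norm_sub_le _ _).trans ?_
  linarith [norm_le_pi_norm y p.1, norm_le_pi_norm y p.2]

lemma inv_pi_le_one : 1 / Real.pi ≤ 1 := by
  rw [div_le_one Real.pi_pos]; linarith [Real.pi_gt_three]

lemma inv_pi_pos : 0 < 1 / Real.pi := by
  have := Real.pi_pos
  positivity

lemma potential_le_of_norm_le {z : ℤ × ℤ} {R : ℝ} (hR : 1 ≤ R) (h : ‖z‖ ≤ R) :
    potential z ≤ (1 / Real.pi) * Real.log R + 20 := by
  have hlog : 0 ≤ Real.log R := Real.log_nonneg hR
  rcases eq_or_ne z 0 with rfl | hz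
  · rw [potential_zero]
    have := mul_nonneg inv_pi_pos.le hlog
    linarith
  · have h1 := (abs_le.1 (abs_potential_sub_log_le hz)).2
    have h2 := Real.log_le_log (by linarith [one_le_norm hz]) h
    have := mul_le_mul_of_nonneg_left h2 inv_pi_pos.le
    linarith

lemma le_potential_of_le_norm {z : ℤ × ℤ} {r : ℝ} (hr : 1 ≤ r) (h : r ≤ ‖z‖) :
    (1 / Real.pi) * Real.log r - 20 ≤ potential z := by
  have hz : z ≠ 0 := by
    rintro rfl
    rw [norm_zero] at h
    linarith
  have h1 := (abs_le.1 (abs_potential_sub_log_le hz)).1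
  have h2 := Real.log_le_log (by linarith) h
  have := mul_le_mul_of_nonneg_left h2 inv_pi_pos.le
  linarith

/-- The chain has range `s` after `s` steps, so the kernel is at most logarithmic in the time,
deterministically. -/
lemma potential_pairDiff_le_of_mem_range {x y : Config N} {s : ℕ} (h : ‖y - x‖ ≤ s + 1)
    (p : Fin N × Fin N) : potential (pairDiff y p) ≤ rangeConst x * logTime s := by
  have hx := norm_nonneg x
  have hs : (0 : ℝ) ≤ s := Nat.cast_nonneg s
  have h1 : ‖pairDiff y p‖ ≤ (2 * ‖x‖ + 3) * (s + 2) := by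
    have h2 := norm_pairDiff_le y p
    have h3 := norm_add_le (y - x) x
    rw [sub_add_cancel] at h3
    nlinarith
  have h2 := potential_le_of_norm_le (by nlinarith) h1
  rw [Real.log_mul (by linarith) (by linarith)] at h2
  have h3 := half_le_logTime s
  have h4 : 0 ≤ Real.log (2 * ‖x‖ + 3) := Real.log_nonneg (by linarith)
  have h5 : (1 / Real.pi) * (Real.log (2 * ‖x‖ + 3) + Real.log (s + 2)) ≤
      Real.log (2 * ‖x‖ + 3) + Real.log (s + 2) :=
    mul_le_of_le_one_left (by have := logTime_pos s; unfold logTime at this; linarith)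
      inv_pi_le_one
  have h6 : logTime s = Real.log (s + 2) := rfl
  rw [← h6] at h2 h5
  unfold rangeConst
  nlinarith

lemma potentialProd_le_pow {y : Config N} {L : ℝ}
    (h : ∀ p ∈ tokenPairs N, potential (pairDiff y p) ≤ L) :
    potentialProd y ≤ L ^ (N.choose 2) := by
  rw [← card_tokenPairs]
  exact (Finset.prod_le_prod (fun _ _ => potential_nonneg _) h).trans_eq (Finset.prod_const L)

/-- The crude bound by the largest value of `potentialProd` on the range of the chain; the sharp
constant is in `weighted_le_survival_add`. -/
lemma weighted_le_survival (x : Config N) (T n : ℕ) :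
    weighted x T n ≤ (rangeConst x * logTime (T + n)) ^ (N.choose 2) * survival x T n := by
  rw [survival, ← smul_eq_mul, ← Pi.smul_apply, ← map_smul]
  refine delayedChain_monotoneWithRange _ _ x fun y hy => ?_
  rw [Pi.smul_apply, smul_eq_mul]
  by_cases hyc : y ∈ collisionFree N
  · rw [alive_of_mem hyc, mul_one]
    exact potentialProd_le_pow fun p _ => potential_pairDiff_le_of_mem_range (by linarith) p
  · rw [potentialProd_eq_zero hyc, alive_of_notMem hyc, mul_zero]

/-- If no pair of tokens is within distance `r`, then `potentialProd` is bounded below; that some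
pair is within distance `r` is unlikely by the local limit bound. -/
lemma survival_le_weighted [NeZero N] (x : Config N) (T n : ℕ) {r : ℕ} (hr : 1 ≤ r) {c : ℝ}
    (hc : 0 < c) (hcr : c ≤ (1 / Real.pi) * Real.log r - 20) :
    survival x T n ≤ weighted x T n / c ^ (N.choose 2) +
      N.choose 2 * (N * (4 * r + 1) ^ 2 / ((T + n : ℕ) + 1)) := by
  set near : Config N → ℝ := ∑ p ∈ tokenPairs N,
    fun y => Set.indicator {z : ℤ × ℤ | ‖z‖ ≤ r} 1 (pairDiff y p) with hnear
  have hnear0 : ∀ y, 0 ≤ near y := fun y => by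
    rw [hnear, Finset.sum_apply]
    exact Finset.sum_nonneg fun _ _ => Set.indicator_nonneg (fun _ _ => zero_le_one) _
  have hpt : ∀ y, alive N y ≤ ((c ^ (N.choose 2))⁻¹ • (potentialProd : Config N → ℝ) + near) y := by
    intro y
    rw [Pi.add_apply, Pi.smul_apply, smul_eq_mul]
    have h0 : 0 ≤ (c ^ (N.choose 2))⁻¹ * potentialProd y :=
      mul_nonneg (by positivity) (potentialProd_nonneg y)
    by_cases hfar : ∀ p ∈ tokenPairs N, (r : ℝ) < ‖pairDiff y p‖
    · have h1 : c ^ (N.choose 2) ≤ potentialProd y := by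
        rw [← card_tokenPairs, ← Finset.prod_const]
        exact Finset.prod_le_prod (fun _ _ => hc.le) fun p hp =>
          hcr.trans (le_potential_of_le_norm (by exact_mod_cast hr) (hfar p hp).le)
      have h2 : 1 ≤ (c ^ (N.choose 2))⁻¹ * potentialProd y := by
        rw [inv_mul_eq_div, one_le_div (by positivity)]; exact h1
      linarith [alive_le_one y, hnear0 y]
    · push Not at hfar
      obtain ⟨p, hp, hle⟩ := hfar
      have h1 : 1 ≤ near y := by
        rw [hnear, Finset.sum_apply]
        refine le_trans (le_of_eq ?_) (Finset.single_le_sum (f := fun p =>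
          Set.indicator {z : ℤ × ℤ | ‖z‖ ≤ r} (1 : ℤ × ℤ → ℝ) (pairDiff y p))
          (fun _ _ => Set.indicator_nonneg (fun _ _ => zero_le_one) _) hp)
        simp [hle]
      linarith [alive_le_one y]
  have h1 := delayedChain_monotoneWithRange (T := T) (n := n).mono hpt x
  rw [map_add, map_smul, Pi.add_apply, Pi.smul_apply, smul_eq_mul] at h1
  have h2 : delayedChain N T n near x ≤
      N.choose 2 * (N * (4 * r + 1) ^ 2 / ((T + n : ℕ) + 1)) := by
    refine (delayedChain_le hnear0 x).trans ?_
    rw [hnear, map_sum, Finset.sum_apply, ← card_tokenPairs, ← nsmul_eq_mul, ← Finset.sum_const]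
    exact Finset.sum_le_sum fun p hp =>
      stepAvg_pow_ball_le (mem_tokenPairs.1 hp).ne r (T + n) x
  rw [survival, weighted, div_eq_inv_mul]
  linarith

/-- A function that grows by at most `1` per move in the mean grows at most linearly. With the
squared distance as the function, this is the second moment bound. -/
lemma stepAvg_pow_le_add_nat [NeZero N] {f : Config N → ℝ} (h : ∀ k y, tokenAvg k f y ≤ f y + 1)
    (n : ℕ) (y : Config N) : ((stepAvg N) ^ n) f y ≤ f y + n := by
  have hN : (0 : ℝ) < N := by exact_mod_cast Nat.pos_of_ne_zero (NeZero.ne N)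
  have h1 : ∀ y, stepAvg N f y ≤ f y + 1 := by
    intro y
    rw [stepAvg_apply, one_div, inv_mul_le_iff₀ hN]
    refine (Finset.sum_le_sum fun k _ => h k y).trans_eq ?_
    rw [Finset.sum_const, Finset.card_univ, Fintype.card_fin, nsmul_eq_mul]
  induction n generalizing y with
  | zero => simp
  | succ n ih =>
    rw [pow_succ', Module.End.mul_apply]
    refine (stepAvg_monotoneWithRange.mono (g := f + fun _ => (n : ℝ)) ih y).trans ?_
    rw [map_add, Pi.add_apply]
    have h2 := stepAvg_pow_const_le 1 (n : ℝ) y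
    rw [pow_one] at h2
    push_cast
    linarith [h1 y]

/-- The squared Euclidean distance of a pair of tokens. -/
def sqDist (p : Fin N × Fin N) (y : Config N) : ℝ :=
  ((pairDiff y p).1 : ℝ) ^ 2 + ((pairDiff y p).2 : ℝ) ^ 2

lemma sq_norm_le_sqDist (p : Fin N × Fin N) (y : Config N) : ‖pairDiff y p‖ ^ 2 ≤ sqDist p y := by
  rw [Prod.norm_def, Int.norm_eq_abs, Int.norm_eq_abs, sqDist]
  rcases max_choice |((pairDiff y p).1 : ℝ)| |((pairDiff y p).2 : ℝ)| with h | h <;>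
  · rw [h, sq_abs]
    nlinarith [sq_nonneg ((pairDiff y p).1 : ℝ), sq_nonneg ((pairDiff y p).2 : ℝ)]

lemma sqDist_le (p : Fin N × Fin N) (y : Config N) : sqDist p y ≤ 8 * ‖y‖ ^ 2 := by
  have h1 := norm_pairDiff_le y p
  have h2 : |((pairDiff y p).1 : ℝ)| ≤ ‖pairDiff y p‖ := by
    simpa [Int.norm_eq_abs] using norm_fst_le (pairDiff y p)
  have h3 : |((pairDiff y p).2 : ℝ)| ≤ ‖pairDiff y p‖ := by
    simpa [Int.norm_eq_abs] using norm_snd_le (pairDiff y p)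
  have h4 := pow_le_pow_left₀ (abs_nonneg _) (h2.trans h1) 2
  have h5 := pow_le_pow_left₀ (abs_nonneg _) (h3.trans h1) 2
  rw [sq_abs] at h4 h5
  unfold sqDist
  linarith

lemma tokenAvg_sqDist_le (k : Fin N) {p : Fin N × Fin N} (hp : p ∈ tokenPairs N) (y : Config N) :
    tokenAvg k (sqDist p) y ≤ sqDist p y + 1 := by
  have hne := (mem_tokenPairs.1 hp).ne
  have hpl : ∀ z : ℤ × ℤ, planeAvg (fun z => (z.1 : ℝ) ^ 2 + (z.2 : ℝ) ^ 2) z =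
      (z.1 : ℝ) ^ 2 + (z.2 : ℝ) ^ 2 + 1 := by
    intro z
    rw [planeAvg_apply, sum_latticeSteps]
    simp only [Prod.fst_add, Prod.snd_add, add_zero]
    push_cast
    ring
  rcases eq_or_ne p.1 k with h1 | h1
  · subst h1
    exact ((tokenAvg_fst_diff hne (fun z => (z.1 : ℝ) ^ 2 + (z.2 : ℝ) ^ 2) y).trans
      (hpl _)).le
  · rcases eq_or_ne p.2 k with h2 | h2
    · subst h2
      have := tokenAvg_pow_diff hne (fun z => (z.1 : ℝ) ^ 2 + (z.2 : ℝ) ^ 2) 1 y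
      rw [pow_one, pow_one] at this
      exact (this.trans (hpl _)).le
    · simp only [tokenAvg_apply, sqDist, pairDiff_add_single_of_ne h1 h2, Finset.sum_const,
        card_latticeSteps, nsmul_eq_mul]
      push_cast
      linarith

/-- If all pairs of tokens are within distance `R`, then `potentialProd` is bounded above; that some
pair is not is unlikely by the second moment bound. -/
lemma weighted_le_survival_add [NeZero N] (x : Config N) (T n : ℕ) {R : ℝ} (hR : 1 ≤ R) :
    weighted x T n ≤ ((1 / Real.pi) * Real.log R + 20) ^ (N.choose 2) * survival x T n +
      (rangeConst x * logTime (T + n)) ^ (N.choose 2) *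
        (N.choose 2 * ((8 * ‖x‖ ^ 2 + (T + n : ℕ)) / R ^ 2)) := by
  set L := rangeConst x * logTime (T + n)
  have hL : 0 ≤ L := by linarith [one_le_rangeConst_mul x (T + n)]
  set c := (1 / Real.pi) * Real.log R + 20
  have hc : 0 ≤ c := by
    have := mul_nonneg inv_pi_pos.le (Real.log_nonneg hR)
    linarith
  set far : Config N → ℝ := ∑ p ∈ tokenPairs N, (R ^ 2)⁻¹ • sqDist p with hfar
  have hsq0 : ∀ p (y : Config N), 0 ≤ sqDist p y := fun p y =>
    (sq_nonneg _).trans (sq_norm_le_sqDist p y)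
  have hfar0 : ∀ y, 0 ≤ far y := fun y => by
    rw [hfar, Finset.sum_apply]
    exact Finset.sum_nonneg fun p _ => mul_nonneg (by positivity) (hsq0 p y)
  have hpt : ∀ y, ‖y - x‖ ≤ (T + n : ℕ) →
      potentialProd y ≤ (c ^ (N.choose 2) • alive N + L ^ (N.choose 2) • far) y := by
    intro y hy
    simp only [Pi.add_apply, Pi.smul_apply, smul_eq_mul]
    have h0 : 0 ≤ c ^ (N.choose 2) * alive N y := mul_nonneg (by positivity) (alive_nonneg y)
    have h0' : 0 ≤ L ^ (N.choose 2) * far y := mul_nonneg (by positivity) (hfar0 y)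
    by_cases hyc : y ∈ collisionFree N
    · by_cases hnear : ∀ p ∈ tokenPairs N, ‖pairDiff y p‖ ≤ R
      · have := potentialProd_le_pow fun p hp => potential_le_of_norm_le hR (hnear p hp)
        rw [alive_of_mem hyc]
        linarith
      · push Not at hnear
        obtain ⟨p, hp, hlt⟩ := hnear
        have h1 : 1 ≤ far y := by
          rw [hfar, Finset.sum_apply]
          refine le_trans ?_ (Finset.single_le_sum (f := fun p => ((R ^ 2)⁻¹ • sqDist p) y)
            (fun p _ => mul_nonneg (by positivity) (hsq0 p y)) hp)
          rw [Pi.smul_apply, smul_eq_mul, inv_mul_eq_div, one_le_div (by positivity)]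
          exact (pow_le_pow_left₀ (by linarith) hlt.le 2).trans (sq_norm_le_sqDist p y)
        have h2 : potentialProd y ≤ L ^ (N.choose 2) :=
          potentialProd_le_pow fun p _ => potential_pairDiff_le_of_mem_range (by linarith) p
        have h3 : L ^ (N.choose 2) * 1 ≤ L ^ (N.choose 2) * far y := by gcongr
        linarith
    · rw [potentialProd_eq_zero hyc]
      linarith
  have h1 := delayedChain_monotoneWithRange (T := T) (n := n) _ _ x hpt
  rw [map_add, map_smul, map_smul, Pi.add_apply, Pi.smul_apply, Pi.smul_apply, smul_eq_mul,
    smul_eq_mul] at h1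
  refine h1.trans (add_le_add le_rfl (mul_le_mul_of_nonneg_left ?_ (by positivity)))
  refine (delayedChain_le hfar0 x).trans ?_
  rw [hfar, map_sum, Finset.sum_apply, ← card_tokenPairs, ← nsmul_eq_mul, ← Finset.sum_const]
  refine Finset.sum_le_sum fun p hp => ?_
  rw [map_smul, Pi.smul_apply, smul_eq_mul, div_eq_inv_mul]
  have := stepAvg_pow_le_add_nat (fun k y => tokenAvg_sqDist_le k hp y) (T + n) x
  have := sqDist_le p x
  gcongr
  linarith

/-- One step changes `weighted` only through the failure of `potentialProd` to be harmonic. -/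
lemma abs_weighted_succ_sub_le [NeZero N] (x : Config N) (T n : ℕ) :
    |weighted x T (n + 1) - weighted x T n| ≤
      256 * ((rangeConst x * logTime (T + n)) ^ (N.choose 2) /
        (rangeConst x * logTime (T + n)) ^ 2) *
      delayedChain N T n ((collisionFree N).indicator crossWeight) x := by
  set L := rangeConst x * logTime (T + n)
  have hL : 1 ≤ L := one_le_rangeConst_mul x (T + n)
  have hp : (potentialProd : Config N → ℝ) = (collisionFree N).indicator potentialProd := by
    funext y
    by_cases hy : y ∈ collisionFree N
    · simp [hy]
    · simp [hy, potentialProd_eq_zero hy]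
  have e : weighted x T (n + 1) - weighted x T n =
      delayedChain N T n (killedStep N potentialProd - potentialProd) x := by
    rw [map_sub, Pi.sub_apply, weighted, weighted, delayedChain, pow_succ, ← mul_assoc,
      Module.End.mul_apply, ← delayedChain]
  rw [e, ← smul_eq_mul, ← Pi.smul_apply, ← map_smul]
  refine delayedChain_monotoneWithRange.abs_le fun y hy => ?_
  rw [Pi.sub_apply, Pi.smul_apply, smul_eq_mul, killedStep_apply]
  by_cases hyc : y ∈ collisionFree N
  · rw [Set.indicator_of_mem hyc, Set.indicator_of_mem hyc]
    refine abs_stepAvg_potentialProd_sub_le hyc hL fun z hz p _ =>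
      potential_pairDiff_le_of_mem_range ?_ p
    have := norm_add_le (z - y) (y - x)
    rw [sub_add_sub_cancel] at this
    linarith
  · rw [Set.indicator_of_notMem hyc, Set.indicator_of_notMem hyc, potentialProd_eq_zero hyc]
    simp

lemma stepAvg_pow_indicator_crossWeight_le [NeZero N] (n : ℕ) (y : Config N) :
    ((stepAvg N) ^ n) ((collisionFree N).indicator crossWeight) y ≤
      N * (N.choose 2) ^ 2 * (2500 * N) / (n + 1) :=
  ((stepAvg_monotoneWithRange.pow n).mono
    (fun z => Set.indicator_le_self' (fun _ _ => crossWeight_nonneg z) z) y).trans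
    (stepAvg_pow_crossWeight_le n y)

lemma indicator_crossWeight_nonneg (y : Config N) :
    0 ≤ (collisionFree N).indicator crossWeight y :=
  Set.indicator_nonneg (fun z _ => crossWeight_nonneg z) y

/-- The increments of `weighted`, without use of the survival probability. -/
lemma exists_abs_weighted_succ_sub_le [NeZero N] (x : Config N) : ∃ C : ℝ, 0 ≤ C ∧ ∀ T n : ℕ,
    |weighted x T (n + 1) - weighted x T n| ≤
      C * (logTime (T + n) ^ (N.choose 2) / logTime (T + n) ^ 2) / ((T + n : ℕ) + 1) := by
  have hA := rangeConst_ge x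
  refine ⟨256 * (rangeConst x ^ (N.choose 2) / rangeConst x ^ 2) *
    (N * (N.choose 2) ^ 2 * (2500 * N)), by positivity, fun T n => ?_⟩
  refine (abs_weighted_succ_sub_le x T n).trans ?_
  have h1 := (delayedChain_le (T := T) (n := n) indicator_crossWeight_nonneg x).trans
    (stepAvg_pow_indicator_crossWeight_le _ x)
  have hL : 0 < rangeConst x * logTime (T + n) := by linarith [one_le_rangeConst_mul x (T + n)]
  refine (mul_le_mul_of_nonneg_left h1 (by positivity)).trans_eq ?_
  rw [mul_pow, mul_pow]
  have := logTime_pos (T + n)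
  field_simp

/-- The increments of `weighted`, with the survival probability at half the time. -/
lemma exists_abs_weighted_succ_sub_le_survival [NeZero N] (x : Config N) : ∃ C : ℝ, 0 ≤ C ∧
    ∀ T m r : ℕ, T + m ≤ r + 1 → |weighted x T (m + r + 1) - weighted x T (m + r)| ≤
      C * (logTime (T + (m + r)) ^ (N.choose 2) / logTime (T + (m + r)) ^ 2) /
        ((T + (m + r) : ℕ) + 1) * survival x T m := by
  have hA := rangeConst_ge x
  refine ⟨2 * (256 * (rangeConst x ^ (N.choose 2) / rangeConst x ^ 2) *
    (N * (N.choose 2) ^ 2 * (2500 * N))), by positivity, fun T m r hr => ?_⟩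
  refine (abs_weighted_succ_sub_le x T (m + r)).trans ?_
  have h1 := delayedChain_add_le (T := T) (n := m) indicator_crossWeight_nonneg
    (fun y hy => Set.indicator_of_notMem hy _) (stepAvg_pow_indicator_crossWeight_le r) x
  have hL : 0 < rangeConst x * logTime (T + (m + r)) := by
    linarith [one_le_rangeConst_mul x (T + (m + r))]
  refine (mul_le_mul_of_nonneg_left h1 (by positivity)).trans ?_
  have hs := survival_nonneg x T m
  have h2 : N * (N.choose 2) ^ 2 * (2500 * N) / ((r : ℝ) + 1) ≤
      2 * (N * (N.choose 2) ^ 2 * (2500 * N)) / ((T + (m + r) : ℕ) + 1) := by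
    rw [div_le_div_iff₀ (by positivity) (by positivity)]
    have : ((T + (m + r) : ℕ) : ℝ) + 1 ≤ 2 * (r + 1) := by
      have : T + (m + r) + 1 ≤ 2 * (r + 1) := by omega
      exact_mod_cast this
    calc _ ≤ N * (N.choose 2 : ℝ) ^ 2 * (2500 * N) * (2 * (r + 1)) := by gcongr
      _ = _ := by ring
  rw [← survival]
  refine (mul_le_mul_of_nonneg_left (mul_le_mul_of_nonneg_right h2 hs) (by positivity)).trans_eq ?_
  rw [mul_pow, mul_pow]
  have := logTime_pos (T + (m + r))
  field_simp

/-! ### Convergence of the weighted survival probability -/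

/-- The rate `1 / (s (log s) ^ 2)` is summable, with tails of order `1 / log s`: it is dominated by
the increments of `1 / logTime`. -/
lemma one_div_succ_mul_logTime_sq_le (s : ℕ) :
    1 / (((s : ℝ) + 1) * logTime s ^ 2) ≤ 6 * (1 / logTime s - 1 / logTime (s + 1)) := by
  have h0 := logTime_pos s
  have h1 := logTime_pos (s + 1)
  have h2 : logTime (s + 1) ≤ 2 * logTime s := logTime_le_two_mul (by nlinarith)
  have h3 : 1 / ((s : ℝ) + 3) ≤ logTime (s + 1) - logTime s := by
    have := Real.one_sub_inv_le_log_of_pos (x := ((s : ℝ) + 3) / (s + 2)) (by positivity)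
    rw [Real.log_div (by positivity) (by positivity)] at this
    have e : 1 - (((s : ℝ) + 3) / (s + 2))⁻¹ = 1 / (s + 3) := by field_simp; ring
    rw [e] at this
    have e2 : logTime (s + 1) = Real.log (s + 3) := by
      unfold logTime; congr 1; push_cast; ring
    rw [e2]
    exact this
  have h4 : 1 / logTime s - 1 / logTime (s + 1) =
      (logTime (s + 1) - logTime s) / (logTime s * logTime (s + 1)) := by
    field_simp
  have hs : (0 : ℝ) ≤ s := Nat.cast_nonneg s
  have h5 : 0 ≤ logTime (s + 1) - logTime s := le_trans (by positivity) h3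
  rw [h4]
  calc 1 / (((s : ℝ) + 1) * logTime s ^ 2) ≤ 6 * (1 / (s + 3) / (logTime s * (2 * logTime s))) := by
        rw [div_div, mul_one_div, div_le_div_iff₀ (by positivity) (by positivity)]
        nlinarith [mul_nonneg hs (sq_nonneg (logTime s)), sq_nonneg (logTime s)]
    _ ≤ _ := by gcongr

/-- The survival probability is at most of order `logTime ^ (-N.choose 2)`, in terms of the weighted
survival probability. -/
lemma exists_survival_le [NeZero N] : ∃ B : ℝ, 0 < B ∧ ∀ (x : Config N) (T n : ℕ),
    survival x T n ≤ B * (weighted x T n / logTime (T + n) ^ (N.choose 2) +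
      1 / logTime (T + n) ^ (N.choose 2 + 1)) := by
  set d := N.choose 2
  set D : ℝ := d * (N * (162 * ((d + 1).factorial * 2 ^ (d + 1)))) with hD
  have hD0 : 0 ≤ D := by positivity
  refine ⟨26 ^ d + D + 520 ^ (d + 1), by positivity, fun x T n => ?_⟩
  set l := logTime (T + n)
  have hl : 0 < l := logTime_pos _
  have hw := weighted_nonneg x T n
  have h0 : 0 ≤ weighted x T n / l ^ d := by positivity
  have h0' : 0 ≤ 1 / l ^ (d + 1) := by positivity
  -- for bounded `l` the error term exceeds one, which bounds every probability
  rcases le_or_gt l 520 with hsmall | hlarge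
  · have h1 : 1 ≤ 520 ^ (d + 1) * (1 / l ^ (d + 1)) := by
      rw [mul_one_div, one_le_div (by positivity)]
      gcongr
    have h2 := survival_le_one x T n
    have h3 : 0 ≤ (26 : ℝ) ^ d + D := by positivity
    nlinarith [mul_nonneg h3 (add_nonneg h0 h0'),
      mul_nonneg (by positivity : (0 : ℝ) ≤ 520 ^ (d + 1)) h0]
  · set u := Real.exp (l / 4) with hu
    have hu1 : 1 ≤ u := Real.one_le_exp (by positivity)
    have hu4 : u ^ 4 = (T + n : ℕ) + 2 := by
      rw [hu, ← Real.exp_nat_mul]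
      push_cast
      rw [mul_div_cancel₀ _ (by norm_num : (4 : ℝ) ≠ 0)]
      show Real.exp (Real.log _) = _
      rw [Real.exp_log (by positivity)]
      push_cast; ring
    -- at the distance `r`, of order `n ^ (1/4)`, the kernel is still a multiple of `log n`, while
    -- the probability of a pair within distance `r` is a power of `1 / n`
    set r := ⌊u⌋₊ + 1
    have hur : u ≤ r := by
      have := (Nat.lt_floor_add_one u).le
      simpa [r] using this
    have hru : (r : ℝ) ≤ 2 * u := by
      have := Nat.floor_le (by linarith : (0 : ℝ) ≤ u)
      simp only [r]; push_cast; linarith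
    have hlogr : l / 4 ≤ Real.log r := by
      rw [Real.le_log_iff_exp_le (by linarith)]; exact hur
    have hc : l / 26 ≤ (1 / Real.pi) * Real.log r - 20 := by
      have h1 : (4 : ℝ) / 13 ≤ 1 / Real.pi := by
        rw [div_le_div_iff₀ (by norm_num) Real.pi_pos]
        linarith [Real.pi_lt_d2]
      nlinarith
    have key := survival_le_weighted x T n (r := r) (by simp [r]) (by positivity) hc
    have hprob : (N * (4 * (r : ℝ) + 1) ^ 2 / ((T + n : ℕ) + 1)) ≤
        N * (162 * ((d + 1).factorial * 2 ^ (d + 1))) * (1 / l ^ (d + 1)) := by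
      have h1 : (4 * (r : ℝ) + 1) ^ 2 ≤ 81 * u ^ 2 := by nlinarith
      have h2 : u ^ 4 / 2 ≤ ((T + n : ℕ) : ℝ) + 1 := by rw [hu4]; linarith
      have h3 : l ^ (d + 1) ≤ (d + 1).factorial * 2 ^ (d + 1) * u ^ 2 := by
        have := Real.pow_div_factorial_le_exp (l / 2) (by positivity) (d + 1)
        rw [div_le_iff₀ (by positivity), div_pow, div_le_iff₀ (by positivity)] at this
        refine this.trans_eq ?_
        rw [hu, ← Real.exp_nat_mul, show ((2 : ℕ) : ℝ) * (l / 4) = l / 2 by push_cast; ring]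
        ring
      calc (N * (4 * (r : ℝ) + 1) ^ 2 / ((T + n : ℕ) + 1))
          ≤ N * (81 * u ^ 2) / (u ^ 4 / 2) := by gcongr
        _ = N * 162 * (1 / u ^ 2) := by field_simp; ring
        _ ≤ N * 162 * ((d + 1).factorial * 2 ^ (d + 1) * (1 / l ^ (d + 1))) := by
            gcongr
            rw [mul_one_div, div_le_div_iff₀ (by positivity) (by positivity)]
            linarith
        _ = _ := by ring
    have h5 : weighted x T n / (l / 26) ^ d = 26 ^ d * (weighted x T n / l ^ d) := by
      rw [div_pow]; field_simp
    rw [h5] at key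
    have h6 : (d : ℝ) * (N * (4 * (r : ℝ) + 1) ^ 2 / ((T + n : ℕ) + 1)) ≤
        D * (1 / l ^ (d + 1)) := by
      rw [hD, mul_assoc (d : ℝ)]
      exact mul_le_mul_of_nonneg_left hprob (by positivity)
    have h7 : (0 : ℝ) ≤ 520 ^ (d + 1) := by positivity
    have h8 : (0 : ℝ) ≤ 26 ^ d := by positivity
    nlinarith [mul_nonneg h7 (add_nonneg h0 h0'), mul_nonneg hD0 h0, mul_nonneg h8 h0']

/-- A sequence whose increments are bounded by earlier values times the increments of a small
decreasing sequence is bounded, and nearly constant. -/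
lemma bounded_of_increment_le {M b : ℕ → ℝ} {B U : ℝ} {j₀ s₀ : ℕ} (hj : j₀ ≤ s₀) (hb : Antitone b)
    (hb0 : ∀ s, 0 ≤ b s) (hB : 0 ≤ B) (hsmall : B * b s₀ ≤ 1 / 2) (hU0 : 0 ≤ U)
    (hU : ∀ s, j₀ ≤ s → s ≤ s₀ → M s ≤ U)
    (h : ∀ s, s₀ ≤ s → ∃ j, j₀ ≤ j ∧ j ≤ s ∧
      |M (s + 1) - M s| ≤ B * (b s - b (s + 1)) * (M j + 1)) :
    (∀ s, j₀ ≤ s → M s ≤ 2 * U + 1) ∧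
      ∀ s t, s₀ ≤ s → s ≤ t → |M t - M s| ≤ B * (b s - b t) * (2 * U + 2) := by
  have hstep : ∀ s, s₀ ≤ s → (∀ j, j₀ ≤ j → j ≤ s → M j ≤ 2 * U + 1) →
      |M (s + 1) - M s| ≤ B * (b s - b (s + 1)) * (2 * U + 2) := by
    intro s hs hM
    obtain ⟨j, hj1, hj2, hj3⟩ := h s hs
    refine hj3.trans (mul_le_mul_of_nonneg_left ?_
      (mul_nonneg hB (sub_nonneg.2 (hb (Nat.le_succ s)))))
    linarith [hM j hj1 hj2]
  have main : ∀ s, s₀ ≤ s → (∀ j, j₀ ≤ j → j ≤ s → M j ≤ 2 * U + 1) ∧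
      |M s - M s₀| ≤ B * (b s₀ - b s) * (2 * U + 2) := by
    intro s hs
    induction s, hs using Nat.le_induction with
    | base => exact ⟨fun j h1 h2 => by linarith [hU j h1 h2], by simp⟩
    | succ s hs ih =>
      have h1 := hstep s hs ih.1
      have h2 : |M (s + 1) - M s₀| ≤ B * (b s₀ - b (s + 1)) * (2 * U + 2) := by
        have := abs_add_le (M (s + 1) - M s) (M s - M s₀)
        rw [sub_add_sub_cancel] at this
        linarith [ih.2]
      refine ⟨fun j hj1 hj2 => ?_, h2⟩
      rcases Nat.lt_or_ge j (s + 1) with hlt | hge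
      · exact ih.1 j hj1 (by omega)
      · obtain rfl : j = s + 1 := le_antisymm hj2 hge
        have h3 := (abs_le.1 h2).2
        have h4 : B * (b s₀ - b (s + 1)) ≤ 1 / 2 := by
          have := mul_nonneg hB (hb0 (s + 1))
          linarith
        have h5 : B * (b s₀ - b (s + 1)) * (2 * U + 2) ≤ 1 / 2 * (2 * U + 2) :=
          mul_le_mul_of_nonneg_right h4 (by linarith)
        linarith [hU s₀ hj le_rfl]
  have hbound : ∀ s, j₀ ≤ s → M s ≤ 2 * U + 1 := fun s hs =>
    (main (max s s₀) (le_max_right _ _)).1 s hs (le_max_left _ _)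
  refine ⟨hbound, fun s t hs hst => ?_⟩
  induction t, hst using Nat.le_induction with
  | base => simp
  | succ t hst ih =>
    have h1 := hstep t (hs.trans hst) fun j hj1 _ => hbound j hj1
    have := abs_add_le (M (t + 1) - M t) (M t - M s)
    rw [sub_add_sub_cancel] at this
    linarith

lemma antitone_one_div_logTime : Antitone fun s => 1 / logTime s := fun _ _ h =>
  one_div_le_one_div_of_le (logTime_pos _) (logTime_mono h)

lemma tendsto_one_div_logTime : Tendsto (fun s => 1 / logTime s) atTop (nhds 0) := by
  simp only [one_div]
  exact tendsto_logTime.inv_tendsto_atTop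

/-- The increments of `weighted`, as a function of the total time, satisfy the hypothesis of
`bounded_of_increment_le`. -/
lemma exists_weighted_increment_le [NeZero N] (x : Config N) : ∃ B : ℝ, 0 ≤ B ∧ ∀ T s : ℕ,
    2 * T ≤ s → ∃ j, T ≤ j ∧ j ≤ s ∧ |weighted x T (s + 1 - T) - weighted x T (s - T)| ≤
      B * (1 / logTime s - 1 / logTime (s + 1)) * (weighted x T (j - T) + 1) := by
  obtain ⟨C, hC, h1⟩ := exists_abs_weighted_succ_sub_le_survival x
  obtain ⟨B, hB, h2⟩ := exists_survival_le (N := N)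
  set d := N.choose 2
  -- the Markov property is used at half of the total time
  refine ⟨C * (2 * B * 2 ^ d) * 6, by positivity, fun T s hs => ⟨s / 2, by omega, by omega, ?_⟩⟩
  set m := s / 2 - T with hm
  have hTm : T + m = s / 2 := by omega
  have h3 := h1 T m (s - s / 2) (by omega)
  rw [show m + (s - s / 2) + 1 = s + 1 - T by omega, show m + (s - s / 2) = s - T by omega,
    show T + (s - T) = s by omega] at h3
  refine h3.trans ?_
  have h4 := h2 x T m
  rw [hTm] at h4
  have hl := logTime_pos s
  have hk := logTime_pos (s / 2)
  have hkhalf := half_le_logTime (s / 2)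
  have hlk : logTime s ≤ 2 * logTime (s / 2) := logTime_le_two_mul (by
    have : s ≤ 2 * (s / 2) + 1 := by omega
    nlinarith)
  have hw := weighted_nonneg x T m
  have h5 : survival x T m ≤ 2 * B * (weighted x T m + 1) / logTime (s / 2) ^ d := by
    refine h4.trans ?_
    have h6 : 1 / logTime (s / 2) ^ (d + 1) ≤ 2 / logTime (s / 2) ^ d := by
      rw [div_le_div_iff₀ (by positivity) (by positivity), pow_succ]
      nlinarith [pow_pos hk d]
    calc B * (weighted x T m / logTime (s / 2) ^ d + 1 / logTime (s / 2) ^ (d + 1))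
        ≤ B * (weighted x T m / logTime (s / 2) ^ d + 2 / logTime (s / 2) ^ d) := by gcongr
      _ = B * (weighted x T m + 2) / logTime (s / 2) ^ d := by rw [← add_div, mul_div_assoc]
      _ ≤ _ := by
          refine div_le_div_of_nonneg_right ?_ (by positivity)
          nlinarith
  have h7 := one_div_succ_mul_logTime_sq_le s
  have h8 : logTime s ^ d ≤ 2 ^ d * logTime (s / 2) ^ d := by
    rw [← mul_pow]; gcongr
  have h9 := survival_nonneg x T m
  calc C * (logTime s ^ d / logTime s ^ 2) / (s + 1) * survival x T m
      ≤ C * (2 ^ d * logTime (s / 2) ^ d / logTime s ^ 2) / (s + 1) *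
        (2 * B * (weighted x T m + 1) / logTime (s / 2) ^ d) := by gcongr
    _ = C * (2 * B * 2 ^ d) * (1 / ((s + 1) * logTime s ^ 2)) * (weighted x T m + 1) := by
        field_simp
    _ ≤ C * (2 * B * 2 ^ d) * (6 * (1 / logTime s - 1 / logTime (s + 1))) *
        (weighted x T m + 1) := by gcongr
    _ = _ := by ring

/-- After `T` free steps, a collision at that instant is unlikely, by the local limit bound at
distance `0`. -/
lemma one_le_survival_zero_add [NeZero N] (x : Config N) (T : ℕ) :
    1 ≤ survival x T 0 + N.choose 2 * (N / (T + 1)) := by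
  set near : Config N → ℝ := ∑ p ∈ tokenPairs N,
    fun y => Set.indicator {z : ℤ × ℤ | ‖z‖ ≤ (0 : ℕ)} 1 (pairDiff y p) with hnear
  have hpt : ∀ y, (fun _ => (1 : ℝ)) y ≤ (alive N + near) y := by
    intro y
    have hnear0 : 0 ≤ near y := by
      rw [hnear, Finset.sum_apply]
      exact Finset.sum_nonneg fun _ _ => Set.indicator_nonneg (fun _ _ => zero_le_one) _
    rw [Pi.add_apply]
    by_cases hy : y ∈ collisionFree N
    · rw [alive_of_mem hy]; linarith
    · obtain ⟨p, hp, h⟩ := exists_pairDiff_eq_zero hy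
      have h1 : 1 ≤ near y := by
        rw [hnear, Finset.sum_apply]
        refine le_trans (le_of_eq ?_) (Finset.single_le_sum (f := fun p =>
          Set.indicator {z : ℤ × ℤ | ‖z‖ ≤ (0 : ℕ)} (1 : ℤ × ℤ → ℝ) (pairDiff y p))
          (fun _ _ => Set.indicator_nonneg (fun _ _ => zero_le_one) _) hp)
        simp [h]
      linarith [alive_nonneg y]
  have hone : ∀ n : ℕ, ((stepAvg N) ^ n) (fun _ => (1 : ℝ)) = fun _ => 1 := by
    intro n
    induction n with
    | zero => simp
    | succ n ih => rw [pow_succ, Module.End.mul_apply, stepAvg_one, ih]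
  have h1 := (stepAvg_monotoneWithRange.pow T).mono hpt x
  rw [hone, map_add, Pi.add_apply] at h1
  have h2 : ((stepAvg N) ^ T) near x ≤ N.choose 2 * (N / (T + 1)) := by
    rw [hnear, map_sum, Finset.sum_apply, ← card_tokenPairs, ← nsmul_eq_mul, ← Finset.sum_const]
    refine Finset.sum_le_sum fun p hp => ?_
    have := stepAvg_pow_ball_le (mem_tokenPairs.1 hp).ne 0 T x
    simpa [pairDiff] using this
  have h3 : survival x T 0 = ((stepAvg N) ^ T) (alive N) x := by
    rw [survival, delayedChain, pow_zero, mul_one]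
  linarith

/-- After a long free run the tokens are so far apart that the later variation of the weighted
survival probability is small compared to its value, so that it stays away from zero. -/
lemma exists_le_weighted [NeZero N] (x : Config N) :
    ∃ (T : ℕ) (c : ℝ), 0 < c ∧ ∀ n, T ≤ n → c ≤ weighted x T n := by
  obtain ⟨C, hC, h1⟩ := exists_abs_weighted_succ_sub_le x
  obtain ⟨B, hB, h2⟩ := exists_weighted_increment_le x
  obtain ⟨D, hD, h3⟩ := exists_survival_le (N := N)
  set d := N.choose 2 with hd
  obtain ⟨T, hTl, hTN⟩ := ((tendsto_logTime.eventually_ge_atTop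
    (1 + 4 * D + C * 2 ^ d * 16 * D + 4 * B * (4 + 8 * D))).and
    (eventually_ge_atTop (2 * (d * N)))).exists
  set l := logTime T with hl
  have hp1 : 0 ≤ C * 2 ^ d * 16 * D := by positivity
  have hp2 : 0 ≤ 4 * B * (4 + 8 * D) := by positivity
  have hl1 : 1 ≤ l := by linarith
  have hl0 : 0 < l := by linarith
  set W := weighted x T 0 with hW
  have hhalf : 1 / 2 ≤ survival x T 0 := by
    have h4 := one_le_survival_zero_add x T
    have h5 : (d : ℝ) * (N / (T + 1)) ≤ 1 / 2 := by
      rw [mul_div_assoc', div_le_iff₀ (by positivity)]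
      have : (2 * (d * N : ℕ) : ℝ) ≤ T := by exact_mod_cast hTN
      push_cast at this
      linarith
    linarith
  have hWl : l ^ d ≤ 4 * D * W := by
    have h4 := h3 x T 0
    rw [add_zero, ← hl, ← hW] at h4
    have h5 : D * (1 / l ^ (d + 1)) ≤ 1 / 4 := by
      rw [mul_one_div, div_le_div_iff₀ (by positivity) (by norm_num), one_mul]
      have : l ≤ l ^ (d + 1) := le_self_pow₀ hl1 (by omega)
      linarith
    have h6 : 1 / 4 ≤ D * (W / l ^ d) := by linarith
    rw [mul_div_assoc', div_le_div_iff₀ (by norm_num) (by positivity)] at h6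
    linarith
  have hld : 1 ≤ l ^ d := one_le_pow₀ hl1
  have hW0 : 0 < W := by
    by_contra! h
    nlinarith
  -- Up to the total time `2 * T` the bound without survival suffices: `T` increments of order
  -- `(log T) ^ (d - 2) / T` are small compared to `W`, which is at least of order `(log T) ^ d`.
  have hearly : ∀ n, n ≤ T → |weighted x T n - W| ≤ W / 4 := by
    intro n hn
    have h4 := abs_sub_le_of_forall_succ (f := weighted x T) (a := 0) (b := n)
      (K := C * (2 ^ d * l ^ d / l ^ 2) / (T + 1)) (Nat.zero_le n) fun k _ hk => by
        refine (h1 T k).trans ?_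
        have a1 : logTime (T + k) ≤ 2 * l := logTime_le_two_mul (by nlinarith)
        have a2 : l ≤ logTime (T + k) := logTime_mono (by omega)
        have a3 : logTime (T + k) ^ d ≤ 2 ^ d * l ^ d := by
          rw [← mul_pow]; gcongr
          linarith
        have a4 : (T : ℝ) ≤ (T + k : ℕ) := by exact_mod_cast Nat.le_add_right T k
        gcongr
    rw [Nat.sub_zero] at h4
    refine h4.trans ?_
    have hnT : (n : ℝ) ≤ T + 1 := by exact_mod_cast hn.trans (Nat.le_succ T)
    calc (n : ℝ) * (C * (2 ^ d * l ^ d / l ^ 2) / (T + 1))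
        ≤ (T + 1) * (C * (2 ^ d * l ^ d / l ^ 2) / (T + 1)) := by gcongr
      _ = C * 2 ^ d * l ^ d / l ^ 2 := by field_simp
      _ ≤ C * 2 ^ d * (4 * D * W) / l ^ 2 := by gcongr
      _ ≤ W / 4 := by
          rw [div_le_div_iff₀ (by positivity) (by norm_num)]
          have : C * 2 ^ d * 16 * D ≤ l ^ 2 := by nlinarith
          nlinarith
  have hb2T : 1 / logTime (2 * T) ≤ 1 / l := antitone_one_div_logTime (by omega)
  have hBl : B * (1 / l) * (4 + 8 * D) ≤ 1 / 4 := by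
    rw [mul_one_div, div_mul_eq_mul_div, div_le_div_iff₀ hl0 (by norm_num)]
    linarith
  have hBsmall : B * (1 / logTime (2 * T)) ≤ 1 / 2 := by
    have a1 : B * (1 / logTime (2 * T)) ≤ B * (1 / l) := by gcongr
    have a2 : 0 ≤ B * (1 / l) := by positivity
    nlinarith
  -- later increments are summable, with sum of order `1 / log T` relative to `W`
  have h5 := (bounded_of_increment_le (M := fun s => weighted x T (s - T))
    (b := fun s => 1 / logTime s) (U := 2 * W) (j₀ := T) (s₀ := 2 * T) (by omega)
    antitone_one_div_logTime (fun s => by have := logTime_pos s; positivity) hB hBsmall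
    (by linarith) (fun s _ hs2 => by
      have := (abs_le.1 (hearly (s - T) (by omega))).2
      linarith) (fun s hs => h2 T s hs)).2
  refine ⟨T, W / 2, by linarith, fun n hn => ?_⟩
  have h6 := h5 (2 * T) (n + T) le_rfl (by omega)
  simp only [Nat.add_sub_cancel, show 2 * T - T = T by omega] at h6
  have h7 : B * (1 / logTime (2 * T) - 1 / logTime (n + T)) * (2 * (2 * W) + 2) ≤ W / 4 := by
    have a0 : 0 ≤ 1 / logTime (n + T) := by have := logTime_pos (n + T); positivity
    have a1 : 2 * (2 * W) + 2 ≤ (4 + 8 * D) * W := by linarith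
    calc _ ≤ B * (1 / l) * ((4 + 8 * D) * W) := by gcongr; linarith
      _ = B * (1 / l) * (4 + 8 * D) * W := by ring
      _ ≤ 1 / 4 * W := by gcongr
      _ = _ := by ring
  have h8 := (abs_le.1 (hearly T le_rfl)).1
  have h9 := (abs_le.1 h6).1
  linarith

/-! ### Connectedness of the collision-free configurations -/

lemma survival_zero_succ (x : Config N) (n : ℕ) :
    survival x 0 (n + 1) = killedStep N (fun y => survival y 0 n) x := by
  simp only [survival, delayedChain, pow_zero, one_mul, pow_succ', Module.End.mul_apply]

lemma survival_zero_zero (x : Config N) : survival x 0 0 = alive N x := by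
  simp [survival, delayedChain]

lemma survival_of_notMem {x : Config N} (hx : x ∉ collisionFree N) (n : ℕ) :
    survival x 0 n = 0 := by
  simp only [survival, delayedChain, pow_zero, one_mul]
  exact killedStep_pow_eq_zero (fun y hy => alive_of_notMem hy) n hx

lemma survival_antitone [NeZero N] (x : Config N) : Antitone (survival x 0) := by
  refine antitone_nat_of_succ_le fun n => ?_
  induction n generalizing x with
  | zero =>
    by_cases hx : x ∈ collisionFree N
    · rw [survival_zero_zero, alive_of_mem hx]
      exact survival_le_one x 0 1
    · rw [survival_of_notMem hx, survival_of_notMem hx]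
  | succ n ih =>
    rw [survival_zero_succ, survival_zero_succ x n]
    exact killedStep_monotoneWithRange.mono ih x

/-- The survival probabilities from `x` and from `y` are comparable, uniformly in time. -/
def SurvivalEquiv (x y : Config N) : Prop :=
  ∃ K : ℝ, 0 ≤ K ∧ ∀ n, survival y 0 n ≤ K * survival x 0 n ∧ survival x 0 n ≤ K * survival y 0 n

namespace SurvivalEquiv

lemma refl (x : Config N) : SurvivalEquiv x x := ⟨1, zero_le_one, fun n => by simp⟩

lemma symm {x y : Config N} (h : SurvivalEquiv x y) : SurvivalEquiv y x := by
  obtain ⟨K, hK, h⟩ := h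
  exact ⟨K, hK, fun n => (h n).symm⟩

lemma trans {x y z : Config N} (h : SurvivalEquiv x y) (h' : SurvivalEquiv y z) :
    SurvivalEquiv x z := by
  obtain ⟨K, hK, h⟩ := h
  obtain ⟨K', hK', h'⟩ := h'
  refine ⟨K * K', mul_nonneg hK hK', fun n => ⟨?_, ?_⟩⟩
  · calc _ ≤ K' * survival y 0 n := (h' n).1
      _ ≤ K' * (K * survival x 0 n) := mul_le_mul_of_nonneg_left (h n).1 hK'
      _ = _ := by ring
  · calc _ ≤ K * survival y 0 n := (h n).2
      _ ≤ K * (K' * survival z 0 n) := mul_le_mul_of_nonneg_left (h' n).2 hK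
      _ = _ := by ring

end SurvivalEquiv

/-- The chain may make the given move first, with probability `1 / (4 * N)`, and survival for `n`
steps is implied by survival for `n + 1`. -/
lemma survival_add_single_le [NeZero N] {x : Config N} (hx : x ∈ collisionFree N) (i : Fin N)
    {e : ℤ × ℤ} (he : e ∈ latticeSteps) (n : ℕ) :
    survival (x + Pi.single i e) 0 n ≤ 4 * N * survival x 0 n := by
  have hN : (0 : ℝ) < N := by exact_mod_cast Nat.pos_of_ne_zero (NeZero.ne N)
  have h1 := survival_antitone x (Nat.le_succ n)
  rw [Nat.succ_eq_add_one, survival_zero_succ, killedStep_apply, Set.indicator_of_mem hx,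
    stepAvg_apply] at h1
  have h2 : 1 / 4 * survival (x + Pi.single i e) 0 n ≤
      ∑ k, tokenAvg k (fun y => survival y 0 n) x := by
    refine le_trans ?_ (Finset.single_le_sum (f := fun k => tokenAvg k (fun y => survival y 0 n) x)
      (fun k _ => (tokenAvg_supBounded k).nonneg (fun y => survival_nonneg y 0 n) x)
      (Finset.mem_univ i))
    rw [tokenAvg_apply]
    exact mul_le_mul_of_nonneg_left (Finset.single_le_sum
      (f := fun e => survival (x + Pi.single i e) 0 n)
      (fun e _ => survival_nonneg _ 0 n) he) (by norm_num)
  rw [one_div, inv_mul_le_iff₀ hN] at h1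
  linarith

lemma neg_mem_latticeSteps {e : ℤ × ℤ} (he : e ∈ latticeSteps) : -e ∈ latticeSteps := by
  simp only [latticeSteps, Finset.mem_insert, Finset.mem_singleton] at he ⊢
  rcases he with rfl | rfl | rfl | rfl <;> simp

lemma survivalEquiv_add_single [NeZero N] {x : Config N} {i : Fin N} {e : ℤ × ℤ}
    (he : e ∈ latticeSteps) (hx : x ∈ collisionFree N)
    (hx' : x + Pi.single i e ∈ collisionFree N) : SurvivalEquiv x (x + Pi.single i e) := by
  refine ⟨4 * N, by positivity, fun n => ⟨survival_add_single_le hx i he n, ?_⟩⟩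
  have := survival_add_single_le hx' i (neg_mem_latticeSteps he) n
  rwa [add_assoc, ← Pi.single_add, add_neg_cancel, Pi.single_zero, add_zero] at this

/-- A token may walk along a line on which it meets no other token. -/
lemma survivalEquiv_line [NeZero N] {x : Config N} {i : Fin N} {e : ℤ × ℤ}
    (he : e ∈ latticeSteps) {k : ℕ} (h : ∀ m ≤ k, x + Pi.single i (m • e) ∈ collisionFree N) :
    SurvivalEquiv x (x + Pi.single i (k • e)) := by
  induction k with
  | zero => simpa using SurvivalEquiv.refl x
  | succ k ih =>
    have e1 : x + Pi.single i ((k + 1) • e) = x + Pi.single i (k • e) + Pi.single i e := by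
      rw [add_assoc, ← Pi.single_add, succ_nsmul]
    refine (ih fun m hm => h m (by omega)).trans ?_
    have h1 := h (k + 1) le_rfl
    rw [e1] at h1 ⊢
    exact survivalEquiv_add_single he (h k (by omega)) h1

/-- If the tokens have distinct coordinates in one direction, they move freely in the other. -/
lemma survivalEquiv_transverse [NeZero N] {π : ℤ × ℤ →+ ℤ} {e : ℤ × ℤ} (he : e ∈ latticeSteps)
    (hπ : π e = 0) (x : Config N) (hx : Function.Injective fun i => π (x i)) (k : Fin N → ℤ) :
    SurvivalEquiv x (fun i => x i + k i • e) := by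
  have hfree : ∀ y : Config N, (∀ i, π (y i) = π (x i)) → y ∈ collisionFree N :=
    fun y hy a b hab => hx (by simp only [← hy, hab])
  have hone : ∀ (y : Config N) (i : Fin N) (m : ℤ), (∀ i, π (y i) = π (x i)) →
      SurvivalEquiv y (y + Pi.single i (m • e)) := by
    intro y i m hy
    have hmem : ∀ e' : ℤ × ℤ, π e' = 0 → y + Pi.single i e' ∈ collisionFree N := by
      intro e' he'
      refine hfree _ fun j => ?_
      rcases eq_or_ne j i with rfl | hj
      · simp [he', hy]
      · simp [Pi.single_eq_of_ne hj, hy]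
    rcases Int.eq_nat_or_neg m with ⟨n, rfl | rfl⟩
    · rw [natCast_zsmul]
      exact survivalEquiv_line he fun m _ => hmem _ (by rw [map_nsmul, hπ, smul_zero])
    · rw [neg_smul, natCast_zsmul, ← smul_neg]
      exact survivalEquiv_line (neg_mem_latticeSteps he) fun m _ => hmem _
        (by rw [map_nsmul, map_neg, hπ, neg_zero, smul_zero])
  have main : ∀ S : Finset (Fin N),
      SurvivalEquiv x (fun i => if i ∈ S then x i + k i • e else x i) := by
    intro S
    induction S using Finset.induction_on with
    | empty => simpa using SurvivalEquiv.refl x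
    | insert a S ha ih =>
      refine ih.trans ?_
      have := hone (fun i => if i ∈ S then x i + k i • e else x i) a (k a)
        (fun i => by split_ifs <;> simp only [map_add, map_zsmul, hπ, smul_zero, add_zero])
      convert this using 1
      funext i
      rcases eq_or_ne i a with rfl | hi
      · simp [ha]
      · simp [hi]
  simpa using main Finset.univ

/-- The tokens can be moved to distinct columns, the rightmost one first. -/
lemma exists_survivalEquiv_injective_fst [NeZero N] (A : ℤ) (U : Finset (Fin N)) (x : Config N)
    (hx : x ∈ collisionFree N) (hU : ∀ i ∈ U, (x i).1 ≤ A) (hV : ∀ i ∉ U, A + U.card < (x i).1)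
    (hinj : ∀ i ∉ U, ∀ j ∉ U, (x i).1 = (x j).1 → i = j) :
    ∃ y, SurvivalEquiv x y ∧ Function.Injective fun i => (y i).1 := by
  induction hn : U.card generalizing U x with
  | zero =>
    obtain rfl := Finset.card_eq_zero.1 hn
    exact ⟨x, SurvivalEquiv.refl x, fun i j h => hinj i (by simp) j (by simp) h⟩
  | succ n ih =>
    have hne : U.Nonempty := Finset.card_pos.1 (by omega)
    -- the rightmost token `a` of `U` walks to the right into column `A + U.card`; there is no token
    -- in the columns between
    obtain ⟨a, haU, hamax⟩ := U.exists_max_image (fun i => (x i).1) hne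
    obtain ⟨k, hk⟩ := Int.eq_ofNat_of_zero_le (a := A + (n + 1) - (x a).1)
      (by have := hU a haU; omega)
    have hcoord : ∀ (m : ℕ) (i : Fin N), i ≠ a →
        (x + Pi.single a (m • ((1 : ℤ), (0 : ℤ))) : Config N) i = x i := by
      intro m i hi; simp [Pi.single_eq_of_ne hi]
    have hcoorda : ∀ m : ℕ, ((x + Pi.single a (m • ((1 : ℤ), (0 : ℤ))) : Config N) a) =
        ((x a).1 + m, (x a).2) := by
      intro m; ext <;> simp
    have hfree : ∀ m ≤ k, x + Pi.single a (m • ((1 : ℤ), (0 : ℤ))) ∈ collisionFree N := by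
      have haux : ∀ m ≤ k, ∀ j, j ≠ a → x j ≠ ((x a).1 + m, (x a).2) := by
        intro m hm j hj heq
        have h1 : (x j).1 = (x a).1 + m := by rw [heq]
        by_cases hjU : j ∈ U
        · have h2 := hamax j hjU
          obtain rfl : m = 0 := by omega
          exact hj (hx (by rw [heq]; simp))
        · have := hV j hjU
          omega
      intro m hm i j hij
      by_contra hne
      rcases eq_or_ne i a with rfl | hi
      · rw [hcoorda, hcoord m j (Ne.symm hne)] at hij
        exact haux m hm j (Ne.symm hne) hij.symm
      · rw [hcoord m i hi] at hij
        rcases eq_or_ne j a with rfl | hj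
        · rw [hcoorda] at hij
          exact haux m hm i hi hij
        · rw [hcoord m j hj] at hij
          exact hne (hx hij)
    have hline := survivalEquiv_line (i := a) (by simp [latticeSteps]) hfree
    have hcard : (U.erase a).card = n := by rw [Finset.card_erase_of_mem haU]; omega
    have hcola : ((x + Pi.single a (k • ((1 : ℤ), (0 : ℤ))) : Config N) a).1 = A + (n + 1) := by
      rw [hcoorda]; simp only; omega
    obtain ⟨y, hy, hyinj⟩ := ih (U.erase a) (x + Pi.single a (k • ((1 : ℤ), (0 : ℤ))))
      (hfree k le_rfl) (fun i hi => by
        rw [hcoord k i (Finset.ne_of_mem_erase hi)]; exact hU i (Finset.mem_of_mem_erase hi))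
      (fun i hi => by
        rcases eq_or_ne i a with rfl | hia
        · rw [hcola, hcard]; omega
        · rw [hcoord k i hia, hcard]
          have := hV i (fun h => hi (Finset.mem_erase.2 ⟨hia, h⟩))
          omega)
      (fun i hi j hj hij => by
        by_contra hne
        have hmem : ∀ i, i ∉ U.erase a → i ≠ a → i ∉ U := fun i hi hia h =>
          hi (Finset.mem_erase.2 ⟨hia, h⟩)
        rcases eq_or_ne i a with rfl | hia
        · rw [hcola, hcoord k j (Ne.symm hne)] at hij
          have := hV j (hmem j hj (Ne.symm hne))
          omega
        · rw [hcoord k i hia] at hij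
          rcases eq_or_ne j a with rfl | hja
          · rw [hcola] at hij
            have := hV i (hmem i hi hia)
            omega
          · rw [hcoord k j hja] at hij
            exact hne (hinj i (hmem i hi hia) j (hmem j hj hja) hij))
      hcard
    exact ⟨y, hline.trans hy, hyinj⟩

/-- Every collision-free configuration can be brought to the same reference configuration. -/
lemma survivalEquiv_column [NeZero N] {x : Config N} (hx : x ∈ collisionFree N) :
    SurvivalEquiv x fun i => (0, (i : ℤ)) := by
  obtain ⟨A, hA⟩ : ∃ A : ℤ, ∀ i, (x i).1 ≤ A := by
    obtain ⟨A, hA⟩ := (Set.finite_range fun i => (x i).1).bddAbove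
    exact ⟨A, fun i => hA ⟨i, rfl⟩⟩
  obtain ⟨y, hxy, hy⟩ := exists_survivalEquiv_injective_fst A Finset.univ x hx (fun i _ => hA i)
    (by simp) (by simp)
  -- from distinct columns the tokens reach distinct rows, and from distinct rows they reach column
  -- `0`
  have h1 := survivalEquiv_transverse (π := AddMonoidHom.fst ℤ ℤ) (e := (0, 1))
    (by simp [latticeSteps]) rfl y hy fun i => i - (y i).2
  have h2 := survivalEquiv_transverse (π := AddMonoidHom.snd ℤ ℤ) (e := (1, 0))
    (by simp [latticeSteps]) rfl (fun i => y i + ((i : ℤ) - (y i).2) • ((0 : ℤ), (1 : ℤ)))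
    (fun i j h => by simpa [Fin.ext_iff] using h) fun i => -(y i).1
  refine hxy.trans (h1.trans ?_)
  convert h2 using 1
  funext i
  ext <;> simp

lemma survivalEquiv_of_mem [NeZero N] {x y : Config N} (hx : x ∈ collisionFree N)
    (hy : y ∈ collisionFree N) : SurvivalEquiv x y :=
  (survivalEquiv_column hx).trans (survivalEquiv_column hy).symm

lemma finite_closedBall_config (x : Config N) (r : ℝ) : {y : Config N | ‖y - x‖ ≤ r}.Finite := by
  have h : {y : Config N | ‖y - x‖ ≤ r} = Metric.closedBall x r := by
    ext y; simp [dist_eq_norm]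
  rw [h]
  exact (isCompact_closedBall x r).finite_of_discrete

/-- After `T` free steps there are finitely many possible configurations, each of which survives no
better than `x` up to a constant. -/
lemma exists_survival_delayed_le [NeZero N] {x : Config N} (hx : x ∈ collisionFree N) (T : ℕ) :
    ∃ K : ℝ, 0 < K ∧ ∀ n, survival x T n ≤ K * survival x 0 n := by
  have h1 : ∀ y : Config N, ∃ K : ℝ, 0 ≤ K ∧ ∀ n, survival y 0 n ≤ K * survival x 0 n := by
    intro y
    by_cases hy : y ∈ collisionFree N
    · obtain ⟨K, hK, h⟩ := survivalEquiv_of_mem hx hy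
      exact ⟨K, hK, fun n => (h n).1⟩
    · exact ⟨0, le_rfl, fun n => by rw [survival_of_notMem hy, zero_mul]⟩
  choose K hK0 hK using h1
  set S := (finite_closedBall_config x T).toFinset
  refine ⟨1 + ∑ y ∈ S, K y, by linarith [Finset.sum_nonneg fun y (_ : y ∈ S) => hK0 y],
    fun n => ?_⟩
  have h2 : survival x T n = ((stepAvg N) ^ T) (fun y => survival y 0 n) x := by
    simp only [survival, delayedChain, pow_zero, one_mul, Module.End.mul_apply]
  rw [h2]
  refine ((stepAvg_monotoneWithRange.pow T) _ (fun _ => (1 + ∑ y ∈ S, K y) * survival x 0 n) x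
    fun y hy => ?_).trans (stepAvg_pow_const_le _ _ _)
  refine (hK y n).trans (mul_le_mul_of_nonneg_right ?_ (survival_nonneg x 0 n))
  rw [mul_one] at hy
  have := Finset.single_le_sum (fun y (_ : y ∈ S) => hK0 y)
    ((Set.Finite.mem_toFinset _).2 hy : y ∈ S)
  linarith

/-! ### Asymptotics of the survival probability of the jump chain -/

/-- The lower bound of the right order: `exists_le_weighted` bounds below the survival probability
after a free run, and the free run costs a constant factor. -/
lemma eventually_le_survival [NeZero N] {x : Config N} (hx : x ∈ collisionFree N) :
    ∃ c : ℝ, 0 < c ∧ ∀ᶠ n in atTop, c ≤ survival x 0 n * logTime n ^ (N.choose 2) := by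
  obtain ⟨T, c, hc, h⟩ := exists_le_weighted x
  obtain ⟨K, hK, h'⟩ := exists_survival_delayed_le hx T
  have hA := rangeConst_ge x
  have hA0 : 0 < rangeConst x := by linarith
  refine ⟨c / ((rangeConst x * 2) ^ (N.choose 2) * K), by positivity,
    eventually_atTop.2 ⟨T, fun n hn => ?_⟩⟩
  have hl := logTime_pos n
  rw [div_le_iff₀ (by positivity)]
  calc c ≤ _ := h n hn
    _ ≤ _ := weighted_le_survival x T n
    _ ≤ (rangeConst x * (2 * logTime n)) ^ (N.choose 2) * (K * survival x 0 n) := by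
        refine mul_le_mul (pow_le_pow_left₀ (mul_nonneg hA0.le (logTime_pos _).le) ?_ _) (h' n)
          (survival_nonneg _ _ _) (by positivity)
        exact mul_le_mul_of_nonneg_left (logTime_le_two_mul (by nlinarith)) hA0.le
    _ = _ := by simp only [mul_pow]; ring

/-- The expected weight converges, to a positive limit since the survival probability does not decay
faster than a multiple of `(log n) ^ (-N.choose 2)`. -/
lemma exists_weighted_limit [NeZero N] {x : Config N} (hx : x ∈ collisionFree N) :
    ∃ m C : ℝ, 0 < m ∧ 0 ≤ C ∧ ∀ᶠ n in atTop, |weighted x 0 n - m| ≤ C / logTime n := by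
  obtain ⟨B, hB, hinc⟩ := exists_weighted_increment_le x
  obtain ⟨s₀, hs₀⟩ := ((tendsto_one_div_logTime.const_mul B).eventually_le_const
    (show B * 0 < 1 / 2 by norm_num)).exists
  -- a crude bound on the first `s₀` values
  set U := ∑ j ∈ Finset.range (s₀ + 1), weighted x 0 j
  have hU0 : 0 ≤ U := Finset.sum_nonneg fun j _ => weighted_nonneg x 0 j
  obtain ⟨-, h2⟩ := bounded_of_increment_le (M := fun s => weighted x 0 s) (U := U) (Nat.zero_le s₀)
    antitone_one_div_logTime (fun s => (one_div_pos.2 (logTime_pos s)).le) hB hs₀ hU0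
    (fun s _ hs => Finset.single_le_sum (f := fun j => weighted x 0 j)
      (fun j _ => weighted_nonneg x 0 j) (Finset.mem_range.2 (by omega)))
    (fun s _ => by
      obtain ⟨j, -, hj, h⟩ := hinc 0 s (by omega)
      exact ⟨j, Nat.zero_le _, hj, by simpa using h⟩)
  set C := B * (2 * U + 2) with hCdef
  have hC : 0 ≤ C := by positivity
  have h3 : ∀ s t, s₀ ≤ s → s ≤ t → |weighted x 0 t - weighted x 0 s| ≤ C / logTime s := by
    intro s t hs hst
    refine (h2 s t hs hst).trans ?_
    have := one_div_pos.2 (logTime_pos t)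
    rw [div_eq_mul_one_div C, hCdef]
    nlinarith [mul_nonneg hC this.le]
  have hcauchy : CauchySeq fun n => weighted x 0 (n + s₀) := by
    refine cauchySeq_of_le_tendsto_0' (fun n => C / logTime (n + s₀)) (fun n k hnk => ?_) ?_
    · rw [dist_comm, Real.dist_eq]
      exact h3 _ _ (by omega) (by omega)
    · simpa [div_eq_mul_one_div C] using
        ((tendsto_add_atTop_iff_nat s₀).2 tendsto_one_div_logTime).const_mul C
  obtain ⟨m, hm⟩ := cauchySeq_tendsto_of_complete hcauchy
  have hm : Tendsto (fun n => weighted x 0 n) atTop (nhds m) := (tendsto_add_atTop_iff_nat s₀).1 hm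
  refine ⟨m, C, ?_, hC, eventually_atTop.2 ⟨s₀, fun s hs => ?_⟩⟩
  · obtain ⟨c, hc, hlow⟩ := eventually_le_survival hx
    obtain ⟨D, hD, hup⟩ := exists_survival_le (N := N)
    have h4 : c ≤ D * (m + 0) := by
      refine ge_of_tendsto ((hm.add tendsto_one_div_logTime).const_mul D) ?_
      filter_upwards [hlow] with n hn
      have hl := logTime_pos n
      refine hn.trans ((mul_le_mul_of_nonneg_right (hup x 0 n) (by positivity)).trans_eq ?_)
      rw [zero_add]
      field_simp
      ring
    by_contra! hneg
    nlinarith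
  · rw [abs_sub_comm]
    exact le_of_tendsto ((hm.sub_const _).abs)
      (eventually_atTop.2 ⟨s, fun t ht => h3 s t hs ht⟩)

lemma one_add_pow_le {v : ℝ} (h0 : 0 ≤ v) (h1 : v ≤ 1) (d : ℕ) : (1 + v) ^ d ≤ 1 + 2 ^ d * v := by
  suffices (1 + v) ^ d ≤ 1 + (2 ^ d - 1) * v by linarith
  induction d with
  | zero => simp
  | succ d ih =>
    have h2 : (1 : ℝ) ≤ 2 ^ d := one_le_pow₀ (by norm_num)
    rw [pow_succ, pow_succ]
    nlinarith [mul_le_mul_of_nonneg_right ih (by linarith : 0 ≤ 1 + v),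
      mul_nonneg (mul_nonneg (sub_nonneg.2 h2) h0) (sub_nonneg.2 h1)]

lemma sqrt_eq_exp_logTime (n : ℕ) : Real.sqrt (n + 2) = Real.exp (logTime n / 2) := by
  rw [Real.exp_half, logTime, Real.exp_log (by positivity)]

/-- If survival is tested at distance `√n / (log n) ^ K`, then `weighted` bounds `survival` from
above. -/
lemma eventually_survival_le [NeZero N] (x : Config N) : ∃ C : ℝ, 0 ≤ C ∧ ∀ᶠ n in atTop,
    survival x 0 n * logTime n ^ (N.choose 2) ≤
      (2 * Real.pi) ^ (N.choose 2) * weighted x 0 n *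
        (1 + C * (Real.log (logTime n) / logTime n)) + C / logTime n := by
  set d := N.choose 2
  set K := d + 1
  set C₀ : ℝ := 2 * K + 40 * Real.pi with hC₀
  have hpi := Real.pi_pos
  have hC₀0 : 0 ≤ C₀ := by positivity
  refine ⟨max (2 ^ d * (2 * C₀)) (d * (N * 200)), by positivity, ?_⟩
  have hL := tendsto_logTime
  have hlam : Tendsto (fun n => Real.log (logTime n)) atTop atTop := Real.tendsto_log_atTop.comp hL
  have heps : Tendsto (fun n => Real.log (logTime n) / logTime n) atTop (nhds 0) :=
    (Real.isLittleO_log_id_atTop.tendsto_div_nhds_zero).comp hL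
  filter_upwards [hlam.eventually_ge_atTop 1, hL.eventually_ge_atTop 1,
    (heps.const_mul C₀).eventually_le_const (show C₀ * 0 < 1 / 2 by norm_num)] with n h1 h2 h3
  set L := logTime n with hLdef
  set lam := Real.log L with hlamdef
  have hL0 : 0 < L := by linarith
  have hlamL : lam = Real.log L := rfl
  have hexp : Real.exp (K * lam) = L ^ K := by
    rw [← Real.rpow_natCast, Real.rpow_def_of_pos hL0, mul_comm]
  -- `ρ` is `√n / (log n) ^ K`; with `K = d + 1` the probability of a pair within distance `ρ` is
  -- small compared to `(log n) ^ (-d)`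
  set ρ := Real.exp (L / 2 - K * lam) with hρ
  have hKlam : 0 ≤ (K : ℝ) * lam := by positivity
  have h3' : C₀ * lam ≤ L / 2 := by
    rw [mul_div_assoc', div_le_iff₀ hL0] at h3; linarith
  have hρ1 : 1 ≤ ρ := by
    refine Real.one_le_exp ?_
    have : (2 * K + 40 * Real.pi) * lam ≤ L / 2 := h3'
    have h5 : 0 ≤ Real.pi * lam := by positivity
    nlinarith
  have hρ0 : 0 < ρ := Real.exp_pos _
  set r := ⌊ρ⌋₊ + 1
  have hrc : (r : ℝ) = ⌊ρ⌋₊ + 1 := by simp [r]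
  have hr1 : ρ ≤ r := hrc ▸ (Nat.lt_floor_add_one ρ).le
  have hr2 : (r : ℝ) ≤ 2 * ρ := by
    linarith [Nat.floor_le hρ0.le]
  set u := (2 * K * lam + 40 * Real.pi) / L with hu
  have hu0 : 0 ≤ u := by positivity
  have huC : u ≤ C₀ * (lam / L) := by
    rw [hu, mul_div_assoc', div_le_div_iff_of_pos_right hL0, hC₀]
    nlinarith
  have huh : u ≤ 1 / 2 := huC.trans h3
  set c := L / (2 * Real.pi) * (1 - u) with hc
  have hc0 : 0 < c := by
    have : 0 < 1 - u := by linarith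
    positivity
  have hcr : c ≤ (1 / Real.pi) * Real.log r - 20 := by
    have h5 : L / 2 - K * lam ≤ Real.log r := by
      rw [← Real.log_exp (L / 2 - K * lam)]
      exact Real.log_le_log hρ0 hr1
    have h6 := mul_le_mul_of_nonneg_left h5 inv_pi_pos.le
    have h7 : c = 1 / Real.pi * (L / 2 - K * lam) - 20 := by
      rw [hc, hu]; field_simp; ring
    linarith
  have key := survival_le_weighted x 0 n (r := r) (by omega) hc0 hcr
  rw [zero_add] at key
  have hn0 : (0 : ℝ) ≤ n := Nat.cast_nonneg n
  have hρsq : ρ ^ 2 = (n + 2) / L ^ (2 * K) := by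
    rw [hρ, Real.exp_sub, ← sqrt_eq_exp_logTime, hexp, div_pow, Real.sq_sqrt (by positivity),
      ← pow_mul, mul_comm]
  have herr : (N : ℝ) * (4 * r + 1) ^ 2 / ((n : ℕ) + 1) ≤ N * 200 / L ^ (2 * K) := by
    have h5 : (4 * (r : ℝ) + 1) ^ 2 ≤ 100 * ρ ^ 2 := by
      have : 4 * (r : ℝ) + 1 ≤ 10 * ρ := by linarith
      calc _ ≤ (10 * ρ) ^ 2 := pow_le_pow_left₀ (by positivity) this 2
        _ = _ := by ring
    have h6 : (4 * (r : ℝ) + 1) ^ 2 / ((n : ℝ) + 1) ≤ 200 / L ^ (2 * K) := by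
      rw [div_le_iff₀ (by positivity)]
      refine h5.trans ?_
      rw [hρsq, div_mul_eq_mul_div, mul_div_assoc', div_le_div_iff_of_pos_right (by positivity)]
      linarith
    rw [mul_div_assoc, mul_div_assoc]
    exact mul_le_mul_of_nonneg_left h6 (Nat.cast_nonneg N)
  have hLpow : L ^ d / L ^ (2 * K) ≤ 1 / L := by
    rw [div_le_div_iff₀ (by positivity) hL0, one_mul, ← pow_succ]
    exact pow_le_pow_right₀ h2 (by omega)
  have hmain : L ^ d / c ^ d ≤ (2 * Real.pi) ^ d * (1 + 2 ^ d * (2 * C₀) * (lam / L)) := by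
    have h5 : L / c ≤ 2 * Real.pi * (1 + 2 * u) := by
      rw [div_le_iff₀ hc0, hc]
      have : 2 * Real.pi * (1 + 2 * u) * (L / (2 * Real.pi) * (1 - u)) =
        L * ((1 + 2 * u) * (1 - u)) := by field_simp
      rw [this]
      have : 1 ≤ (1 + 2 * u) * (1 - u) := by nlinarith
      nlinarith
    rw [← div_pow]
    refine (pow_le_pow_left₀ (by positivity) h5 d).trans ?_
    rw [mul_pow]
    refine mul_le_mul_of_nonneg_left ((one_add_pow_le (by positivity) (by linarith) d).trans ?_)
      (by positivity)
    have := mul_le_mul_of_nonneg_left huC (by positivity : (0 : ℝ) ≤ 2 ^ d * 2)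
    linarith
  have hw := weighted_nonneg x 0 n
  have hlamL0 : 0 ≤ lam / L := by positivity
  calc survival x 0 n * L ^ d
      ≤ (weighted x 0 n / c ^ d + d * (N * 200 / L ^ (2 * K))) * L ^ d := by
        refine mul_le_mul_of_nonneg_right (key.trans ?_) (by positivity)
        exact add_le_add le_rfl (mul_le_mul_of_nonneg_left herr (Nat.cast_nonneg d))
    _ = weighted x 0 n * (L ^ d / c ^ d) + d * (N * 200) * (L ^ d / L ^ (2 * K)) := by ring
    _ ≤ weighted x 0 n * ((2 * Real.pi) ^ d * (1 + 2 ^ d * (2 * C₀) * (lam / L))) +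
        d * (N * 200) * (1 / L) := by gcongr
    _ ≤ weighted x 0 n * ((2 * Real.pi) ^ d * (1 + max (2 ^ d * (2 * C₀)) (d * (N * 200)) *
        (lam / L))) + max (2 ^ d * (2 * C₀)) (d * (N * 200)) * (1 / L) := by
        gcongr
        · exact le_max_left _ _
        · exact le_max_right _ _
    _ = _ := by ring

/-- The converse of `eventually_survival_le`: tokens at distance more than `√n * (log n) ^ K`
contribute little to `weighted`. -/
lemma eventually_weighted_le [NeZero N] (x : Config N) : ∃ C : ℝ, 0 ≤ C ∧ ∀ᶠ n in atTop,
    (2 * Real.pi) ^ (N.choose 2) * weighted x 0 n ≤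
      survival x 0 n * logTime n ^ (N.choose 2) *
        (1 + C * (Real.log (logTime n) / logTime n)) + C / logTime n := by
  set d := N.choose 2
  set K := d + 1
  set C₀ : ℝ := 2 * K + 40 * Real.pi with hC₀
  have hpi := Real.pi_pos
  have hA0 : 0 < rangeConst x := by linarith [rangeConst_ge x]
  have hC₀0 : 0 ≤ C₀ := by positivity
  set C₁ := (2 * Real.pi) ^ d * (rangeConst x ^ d * (d * (8 * ‖x‖ ^ 2 + 1)))
  have hC₁ : 0 ≤ C₁ := by positivity
  refine ⟨max (2 ^ d * C₀) C₁, by positivity, ?_⟩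
  have hL := tendsto_logTime
  have hlam : Tendsto (fun n => Real.log (logTime n)) atTop atTop := Real.tendsto_log_atTop.comp hL
  have heps : Tendsto (fun n => Real.log (logTime n) / logTime n) atTop (nhds 0) :=
    (Real.isLittleO_log_id_atTop.tendsto_div_nhds_zero).comp hL
  filter_upwards [hlam.eventually_ge_atTop 1, hL.eventually_ge_atTop 1,
    (heps.const_mul C₀).eventually_le_const (show C₀ * 0 < 1 by norm_num)] with n h1 h2 h3
  set L := logTime n with hLdef
  set lam := Real.log L with hlamdef
  have hL0 : 0 < L := by linarith
  have hexp : Real.exp (K * lam) = L ^ K := by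
    rw [← Real.rpow_natCast, Real.rpow_def_of_pos hL0, mul_comm]
  -- `R` is `√n * (log n) ^ K`; with `K = d + 1` the probability of a pair at a greater distance is
  -- small compared to the inverse of the greatest possible value of `potentialProd`
  set R := Real.exp (L / 2 + K * lam) with hR
  have hKlam : 0 ≤ (K : ℝ) * lam := by positivity
  have hR1 : 1 ≤ R := Real.one_le_exp (by positivity)
  set u := (2 * K * lam + 40 * Real.pi) / L with hu
  have hu0 : 0 ≤ u := by positivity
  have huC : u ≤ C₀ * (lam / L) := by
    rw [hu, mul_div_assoc', div_le_div_iff_of_pos_right hL0, hC₀]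
    nlinarith
  have huh : u ≤ 1 := huC.trans h3
  have key := weighted_le_survival_add x 0 n hR1
  have hn0 : (0 : ℝ) ≤ n := Nat.cast_nonneg n
  rw [zero_add, ← hLdef] at key
  have hc : 1 / Real.pi * Real.log R + 20 = L / (2 * Real.pi) * (1 + u) := by
    rw [hR, Real.log_exp, hu]; field_simp; ring
  have hRsq : R ^ 2 = (n + 2) * L ^ (2 * K) := by
    rw [hR, Real.exp_add, ← sqrt_eq_exp_logTime, hexp, mul_pow, Real.sq_sqrt (by positivity),
      ← pow_mul, mul_comm K 2]
  have herr : (8 * ‖x‖ ^ 2 + (n : ℕ)) / R ^ 2 ≤ (8 * ‖x‖ ^ 2 + 1) / L ^ (2 * K) := by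
    rw [hRsq, ← div_div]
    refine div_le_div_of_nonneg_right ?_ (by positivity)
    rw [div_le_iff₀ (by positivity)]
    nlinarith [mul_nonneg (sq_nonneg ‖x‖) hn0, sq_nonneg ‖x‖]
  have hLpow : L ^ d / L ^ (2 * K) ≤ 1 / L := by
    rw [div_le_div_iff₀ (by positivity) hL0, one_mul, ← pow_succ]
    exact pow_le_pow_right₀ h2 (by omega)
  have hq := survival_nonneg x 0 n
  have hlamL0 : 0 ≤ lam / L := by positivity
  have hpow : (1 + u) ^ d ≤ 1 + 2 ^ d * C₀ * (lam / L) := by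
    refine (one_add_pow_le hu0 huh d).trans ?_
    have := mul_le_mul_of_nonneg_left huC (by positivity : (0 : ℝ) ≤ 2 ^ d)
    linarith
  calc (2 * Real.pi) ^ d * weighted x 0 n
      ≤ (2 * Real.pi) ^ d * ((L / (2 * Real.pi) * (1 + u)) ^ d * survival x 0 n +
        (rangeConst x * L) ^ d * (d * ((8 * ‖x‖ ^ 2 + 1) / L ^ (2 * K)))) := by
        rw [← hc]
        refine mul_le_mul_of_nonneg_left (key.trans ?_) (by positivity)
        gcongr
    _ = survival x 0 n * L ^ d * (1 + u) ^ d + C₁ * (L ^ d / L ^ (2 * K)) := by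
        rw [mul_pow (L / _), div_pow, mul_pow (rangeConst x)]
        field_simp
        ring
    _ ≤ survival x 0 n * L ^ d * (1 + 2 ^ d * C₀ * (lam / L)) + C₁ * (1 / L) := by gcongr
    _ ≤ survival x 0 n * L ^ d * (1 + max (2 ^ d * C₀) C₁ * (lam / L)) +
        max (2 ^ d * C₀) C₁ * (1 / L) := by
        gcongr
        · exact le_max_left _ _
        · exact le_max_right _ _
    _ = _ := by ring

/-- The survival probability of the jump chain is `c₀ (log n) ^ (-N.choose 2)`, up to a relative
error of order `log log n / log n`. -/
theorem exists_survival_asymptotics [NeZero N] {x : Config N} (hx : x ∈ collisionFree N) :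
    ∃ c₀ C : ℝ, 0 < c₀ ∧ 0 ≤ C ∧ ∀ᶠ n in atTop,
      |survival x 0 n * logTime n ^ (N.choose 2) - c₀| ≤
        C * (Real.log (logTime n) / logTime n) := by
  obtain ⟨m, C₁, hm, hC₁, h1⟩ := exists_weighted_limit hx
  obtain ⟨C₂, hC₂, h2⟩ := eventually_survival_le x
  obtain ⟨C₃, hC₃, h3⟩ := eventually_weighted_le x
  set d := N.choose 2
  set P := (2 * Real.pi) ^ d
  have hpi := Real.pi_pos
  have hP : 0 < P := by positivity
  set S := P * (m + C₁) * (1 + C₂) + C₂ with hS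
  have hS0 : 0 ≤ S := by positivity
  set C := P * C₁ + P * (m + C₁) * C₂ + C₂ + S * C₃ + C₃
  refine ⟨P * m, C, by positivity, by positivity, ?_⟩
  have hL := tendsto_logTime
  have hlam : Tendsto (fun n => Real.log (logTime n)) atTop atTop := Real.tendsto_log_atTop.comp hL
  have heps : Tendsto (fun n => Real.log (logTime n) / logTime n) atTop (nhds 0) :=
    (Real.isLittleO_log_id_atTop.tendsto_div_nhds_zero).comp hL
  filter_upwards [h1, h2, h3, hlam.eventually_ge_atTop 1, heps.eventually_le_const zero_lt_one]
    with n h1 h2 h3 h4 h5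
  set L := logTime n
  have hL0 : 0 < L := logTime_pos n
  set ε := Real.log L / L
  set Q := survival x 0 n * L ^ d
  have hinv : ∀ C : ℝ, 0 ≤ C → C / L ≤ C * ε := fun C hC => by
    rw [div_eq_mul_one_div]
    exact mul_le_mul_of_nonneg_left ((div_le_div_iff_of_pos_right hL0).2 h4) hC
  have hε0 : 0 ≤ ε := by positivity
  have e1 := abs_le.1 (h1.trans (hinv C₁ hC₁))
  have e2 := hinv C₂ hC₂
  have e3 := hinv C₃ hC₃
  set M := weighted x 0 n
  have hM : M ≤ m + C₁ := by nlinarith [e1.2]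
  have hM0 : 0 ≤ M := weighted_nonneg x 0 n
  have hQ : Q ≤ S := by
    refine h2.trans ?_
    have : C₂ * ε ≤ C₂ := by nlinarith
    rw [hS]
    have h6 : C₂ / L ≤ C₂ := by linarith
    gcongr
  have hCε : C * ε = P * (C₁ * ε) + P * (m + C₁) * (C₂ * ε) + C₂ * ε + S * (C₃ * ε) + C₃ * ε := by
    ring
  have f1 : 0 ≤ C₁ * ε := by positivity
  have f2 : 0 ≤ C₂ * ε := by positivity
  have f3 : 0 ≤ C₃ * ε := by positivity
  have g1 : P * (M - m) ≤ P * (C₁ * ε) := mul_le_mul_of_nonneg_left e1.2 hP.le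
  have g2 : P * (m - M) ≤ P * (C₁ * ε) := mul_le_mul_of_nonneg_left (by linarith [e1.1]) hP.le
  have g3 : P * M * (C₂ * ε) ≤ P * (m + C₁) * (C₂ * ε) := by gcongr
  have g4 : Q * (C₃ * ε) ≤ S * (C₃ * ε) := by gcongr
  have g5 : 0 ≤ P * (m + C₁) * (C₂ * ε) := by positivity
  have g6 : 0 ≤ S * (C₃ * ε) := by positivity
  rw [hCε, abs_le]
  constructor <;> nlinarith

/-! ### From the jump chain to continuous time -/

/-- The probabilities of the Poisson distribution. -/
noncomputable def poissonWeight (r : ℝ≥0) (n : ℕ) : ℝ := Real.exp (-r) * r ^ n / n.factorial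

lemma poissonWeight_nonneg (r : ℝ≥0) (n : ℕ) : 0 ≤ poissonWeight r n := by
  unfold poissonWeight; positivity

lemma hasSum_poissonWeight (r : ℝ≥0) : HasSum (poissonWeight r) 1 := hasSum_one_poissonMeasure r

lemma hasSum_poissonWeight_mul_natCast {r : ℝ≥0} {g : ℕ → ℝ} {S : ℝ}
    (h : HasSum (fun n => poissonWeight r n * g (n + 1)) S) :
    HasSum (fun n => poissonWeight r n * (n * g n)) (r * S) := by
  rw [← hasSum_nat_add_iff' 1]
  simp only [Finset.range_one, Finset.sum_singleton, Nat.cast_zero, zero_mul, mul_zero, sub_zero]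
  have hsucc : ∀ n : ℕ, poissonWeight r (n + 1) * ((n + 1 : ℕ) * g (n + 1)) =
      r * (poissonWeight r n * g (n + 1)) := by
    intro n
    simp only [poissonWeight, Nat.factorial_succ, Nat.cast_mul, pow_succ]
    have : (n.factorial : ℝ) ≠ 0 := by exact_mod_cast n.factorial_ne_zero
    have : ((n + 1 : ℕ) : ℝ) ≠ 0 := by positivity
    field_simp
  simpa only [hsucc] using h.mul_left (r : ℝ)

lemma hasSum_poissonWeight_mul_sub_sq (r : ℝ≥0) :
    HasSum (fun n => poissonWeight r n * ((n : ℝ) - r) ^ 2) r := by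
  have h0 := hasSum_poissonWeight r
  have h1 : HasSum (fun n => poissonWeight r n * (n * (1 : ℝ))) (r * 1) :=
    hasSum_poissonWeight_mul_natCast (g := fun _ => 1) (by simpa using h0)
  have h2 : HasSum (fun n => poissonWeight r n * (n * (n : ℝ))) (r * (r * 1 + 1)) := by
    refine hasSum_poissonWeight_mul_natCast (g := fun n => (n : ℝ)) ?_
    convert h1.add h0 using 1
    funext n
    push_cast
    ring
  convert (h2.add (h1.mul_left (-2 * (r : ℝ)))).add (h0.mul_left ((r : ℝ) ^ 2)) using 1
  · funext n; ring
  · ring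

lemma summable_poissonWeight_mul {q : ℕ → ℝ} (h0 : ∀ n, 0 ≤ q n) (h1 : ∀ n, q n ≤ 1) (r : ℝ≥0) :
    Summable fun n => poissonWeight r n * q n :=
  (hasSum_poissonWeight r).summable.of_nonneg_of_le
    (fun n => mul_nonneg (poissonWeight_nonneg r n) (h0 n))
    (fun n => mul_le_of_le_one_right (poissonWeight_nonneg r n) (h1 n))

lemma hasSum_integral_poissonMeasure_of_le_one {q : ℕ → ℝ} (h0 : ∀ n, 0 ≤ q n) (h1 : ∀ n, q n ≤ 1)
    (r : ℝ≥0) : HasSum (fun n => poissonWeight r n * q n) (∫ n, q n ∂(poissonMeasure r)) := by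
  rw [integral_poissonMeasure]
  exact (summable_poissonWeight_mul h0 h1 r).hasSum

/-- Chebyshev's inequality: a Poisson variable of mean `r` is rarely below `r / 2`. -/
lemma integral_poissonMeasure_le {q : ℕ → ℝ} (hq : Antitone q) (h0 : ∀ n, 0 ≤ q n)
    (h1 : ∀ n, q n ≤ 1) {r : ℝ≥0} (hr : 0 < r) {m : ℕ} (hm : (m : ℝ) ≤ r / 2) :
    ∫ n, q n ∂(poissonMeasure r) ≤ q m + 4 / r := by
  have hr' : (0 : ℝ) < r := hr
  have h := ((hasSum_poissonWeight r).mul_right (q m)).add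
    ((hasSum_poissonWeight_mul_sub_sq r).mul_right (4 / (r : ℝ) ^ 2))
  have e : 1 * q m + (r : ℝ) * (4 / (r : ℝ) ^ 2) = q m + 4 / r := by field_simp
  rw [e] at h
  refine hasSum_le (fun n => ?_) (hasSum_integral_poissonMeasure_of_le_one h0 h1 r) h
  rw [mul_assoc, ← mul_add]
  refine mul_le_mul_of_nonneg_left ?_ (poissonWeight_nonneg r n)
  by_cases hn : m ≤ n
  · have : 0 ≤ ((n : ℝ) - r) ^ 2 * (4 / (r : ℝ) ^ 2) := by positivity
    linarith [hq hn]
  · have hnm : (n : ℝ) ≤ m := by exact_mod_cast (not_le.1 hn).le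
    have : 1 ≤ ((n : ℝ) - r) ^ 2 * (4 / (r : ℝ) ^ 2) := by
      rw [mul_div_assoc', le_div_iff₀ (by positivity)]
      nlinarith
    linarith [h1 n, h0 m]

/-- Chebyshev's inequality: a Poisson variable of mean `r` is rarely above `2 * r`. -/
lemma le_integral_poissonMeasure {q : ℕ → ℝ} (hq : Antitone q) (h0 : ∀ n, 0 ≤ q n)
    (h1 : ∀ n, q n ≤ 1) {r : ℝ≥0} (hr : 0 < r) {m : ℕ} (hm : 2 * r ≤ (m : ℝ)) :
    q m - 1 / r ≤ ∫ n, q n ∂(poissonMeasure r) := by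
  have hr' : (0 : ℝ) < r := hr
  have h := ((hasSum_poissonWeight r).mul_right (q m)).sub
    ((hasSum_poissonWeight_mul_sub_sq r).mul_right (1 / (r : ℝ) ^ 2))
  have e : 1 * q m - (r : ℝ) * (1 / (r : ℝ) ^ 2) = q m - 1 / r := by field_simp
  rw [e] at h
  refine hasSum_le (fun n => ?_) h (hasSum_integral_poissonMeasure_of_le_one h0 h1 r)
  rw [mul_assoc, ← mul_sub]
  refine mul_le_mul_of_nonneg_left ?_ (poissonWeight_nonneg r n)
  by_cases hn : n ≤ m
  · have : 0 ≤ ((n : ℝ) - r) ^ 2 * (1 / (r : ℝ) ^ 2) := by positivity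
    linarith [hq hn]
  · have hnm : (m : ℝ) ≤ n := by exact_mod_cast (not_le.1 hn).le
    have : 1 ≤ ((n : ℝ) - r) ^ 2 * (1 / (r : ℝ) ^ 2) := by
      rw [mul_div_assoc', le_div_iff₀ (by positivity)]
      nlinarith
    linarith [h1 m, h0 n]

lemma logTime_le_add_one (n : ℕ) : logTime n ≤ n + 1 := by
  have := Real.log_le_sub_one_of_pos (x := (n : ℝ) + 2) (by positivity)
  unfold logTime
  linarith

lemma tendsto_log_log_atTop : Tendsto (fun t : ℝ => Real.log (Real.log t)) atTop atTop :=
  Real.tendsto_log_atTop.comp Real.tendsto_log_atTop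

/-- The asymptotics do not change if the number of steps is only known up to a bounded factor. -/
lemma eventually_abs_mul_log_pow_sub_le {q : ℕ → ℝ} (hq : ∀ n, 0 ≤ q n) {d : ℕ} {c₀ C A : ℝ}
    (hc₀ : 0 < c₀) (hC : 0 ≤ C) (hA : 0 ≤ A)
    (h : ∀ᶠ n in atTop, |q n * logTime n ^ d - c₀| ≤ C * (Real.log (logTime n) / logTime n))
    {m : ℝ → ℕ} (hm : ∀ᶠ t in atTop, |logTime (m t) - Real.log t| ≤ A) :
    ∃ C' : ℝ, 0 ≤ C' ∧ ∀ᶠ t in atTop,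
      |q (m t) * Real.log t ^ d - c₀| ≤ C' * (Real.log (Real.log t) / Real.log t) := by
  have hmt : Tendsto m atTop atTop := by
    rw [← tendsto_natCast_atTop_iff (R := ℝ)]
    refine tendsto_atTop_mono' _ ?_
      (tendsto_atTop_add_const_right _ (-A - 1) Real.tendsto_log_atTop)
    filter_upwards [hm] with t ht
    linarith [(abs_le.1 ht).1, logTime_le_add_one (m t)]
  refine ⟨4 * C + (c₀ + 4 * C) * ((2 ^ d + d) * (2 * A)), by positivity, ?_⟩
  have heps : Tendsto (fun t => Real.log (Real.log t) / Real.log t) atTop (nhds 0) :=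
    (Real.isLittleO_log_id_atTop.tendsto_div_nhds_zero).comp Real.tendsto_log_atTop
  filter_upwards [hmt.eventually h, hm, Real.tendsto_log_atTop.eventually_ge_atTop (2 + 2 * A),
    tendsto_log_log_atTop.eventually_ge_atTop 1, heps.eventually_le_const zero_lt_one]
    with t h1 h2 h3 h4 h5
  set L := logTime (m t)
  set l := Real.log t
  set ε := Real.log l / l
  have h2' := abs_le.1 h2
  have hl0 : 0 < l := by linarith
  have hL1 : l / 2 ≤ L := by linarith [h2'.1]
  have hL2 : L ≤ 2 * l := by linarith [h2'.2]
  have hL0 : 0 < L := by linarith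
  have hε0 : 0 ≤ ε := by positivity
  have hle : 1 / l ≤ ε := (div_le_div_iff_of_pos_right hl0).2 h4
  have hεL : Real.log L / L ≤ 4 * ε := by
    have e1 : Real.log L ≤ 2 * Real.log l := by
      rw [← Real.log_pow l 2 |>.trans (by norm_num : _ = 2 * Real.log l)]
      exact Real.log_le_log hL0 (by nlinarith)
    calc Real.log L / L ≤ 2 * Real.log l / L := by gcongr
      _ ≤ 2 * Real.log l / (l / 2) := by gcongr
      _ = 4 * ε := by simp only [ε]; field_simp; norm_num
  have hAL : A / L ≤ 2 * A * ε := by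
    calc A / L ≤ A / (l / 2) := by gcongr
      _ = 2 * A * (1 / l) := by field_simp
      _ ≤ _ := by gcongr
  have hAL1 : A / L ≤ 1 := by rw [div_le_one hL0]; linarith
  have hAL0 : 0 ≤ A / L := by positivity
  have hup : l ^ d ≤ L ^ d * (1 + 2 ^ d * (A / L)) := by
    have e1 : l ≤ L * (1 + A / L) := by
      rw [mul_add, mul_one, mul_div_cancel₀ _ hL0.ne']; linarith [h2'.1]
    refine (pow_le_pow_left₀ hl0.le e1 d).trans ?_
    rw [mul_pow]
    exact mul_le_mul_of_nonneg_left (one_add_pow_le hAL0 hAL1 d) (by positivity)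
  have hlow : L ^ d * (1 - d * (A / L)) ≤ l ^ d := by
    have e1 : L * (1 + -(A / L)) ≤ l := by
      rw [mul_add, mul_neg, mul_one, mul_div_cancel₀ _ hL0.ne']; linarith [h2'.2]
    refine le_trans ?_ (pow_le_pow_left₀ (mul_nonneg hL0.le (by linarith)) e1 d)
    rw [mul_pow]
    refine mul_le_mul_of_nonneg_left ?_ (by positivity)
    have := one_add_mul_le_pow (a := -(A / L)) (by linarith) d
    linarith
  set Q := q (m t) * L ^ d
  have hQ0 : 0 ≤ Q := mul_nonneg (hq _) (by positivity)
  have hQ : |Q - c₀| ≤ 4 * C * ε := by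
    refine h1.trans ((mul_le_mul_of_nonneg_left hεL hC).trans_eq ?_)
    ring
  have hQ' : Q ≤ c₀ + 4 * C := by
    have := (abs_le.1 hQ).2
    nlinarith
  have hdiff : |q (m t) * l ^ d - Q| ≤ (c₀ + 4 * C) * ((2 ^ d + d) * (2 * A)) * ε := by
    have e1 : |q (m t) * l ^ d - Q| ≤ Q * ((2 ^ d + d) * (A / L)) := by
      have f1 := mul_le_mul_of_nonneg_left hup (hq (m t))
      have f2 := mul_le_mul_of_nonneg_left hlow (hq (m t))
      have f3 : 0 ≤ Q * (2 ^ d * (A / L)) := by positivity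
      have f4 : 0 ≤ Q * (d * (A / L)) := by positivity
      rw [← mul_assoc] at f1 f2
      change _ ≤ Q * _ at f1
      change Q * _ ≤ _ at f2
      rw [abs_le]
      constructor <;> nlinarith
    refine e1.trans ?_
    calc Q * ((2 ^ d + d) * (A / L)) ≤ (c₀ + 4 * C) * ((2 ^ d + d) * (2 * A * ε)) := by gcongr
      _ = _ := by ring
  calc |q (m t) * l ^ d - c₀| ≤ |q (m t) * l ^ d - Q| + |Q - c₀| := abs_sub_le _ _ _
    _ ≤ _ := add_le_add hdiff hQ
    _ = _ := by ring

/-- The survival probability in continuous time has the asymptotics of the jump chain, as the number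
of jumps until time `t` is concentrated around `N * t`. -/
theorem exists_poissonized_asymptotics [NeZero N] {x : Config N} (hx : x ∈ collisionFree N) :
    ∃ c₀ C : ℝ, 0 < c₀ ∧ ∀ᶠ t : ℝ in atTop,
      |(∫ n, survival x 0 n ∂(poissonMeasure (N * t.toNNReal))) * Real.log t ^ (N.choose 2) - c₀| ≤
        C * (Real.log (Real.log t) / Real.log t) := by
  obtain ⟨c₀, C, hc₀, hC, h⟩ := exists_survival_asymptotics hx
  have hN1 : 1 ≤ (N : ℝ) := by exact_mod_cast Nat.one_le_iff_ne_zero.2 (NeZero.ne N)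
  have hq0 := fun n => survival_nonneg x 0 n
  have hq1 := fun n => survival_le_one x 0 n
  set A : ℝ := Real.log (5 * N) with hA
  have hA0 : 0 ≤ A := Real.log_nonneg (by linarith)
  have hlogm : ∀ m : ℝ → ℕ, (∀ᶠ t : ℝ in atTop, (N : ℝ) * t / 2 ≤ m t + 2 ∧ m t + 2 ≤ 5 * N * t) →
      ∀ᶠ t : ℝ in atTop, |logTime (m t) - Real.log t| ≤ A := by
    intro m hm
    filter_upwards [hm, eventually_gt_atTop 0] with t ht ht0
    have e1 : logTime (m t) ≤ A + Real.log t := by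
      rw [hA, ← Real.log_mul (by positivity) ht0.ne']
      exact Real.log_le_log (by positivity) ht.2
    have e2 : Real.log t - A ≤ logTime (m t) := by
      rw [hA, ← Real.log_div ht0.ne' (by positivity)]
      refine Real.log_le_log (by positivity) (le_trans ?_ ht.1)
      rw [div_le_iff₀ (by positivity)]
      nlinarith [mul_nonneg ht0.le (sub_nonneg.2 hN1)]
    rw [abs_le]
    constructor <;> linarith
  obtain ⟨C₁, hC₁, h1⟩ := eventually_abs_mul_log_pow_sub_le hq0 hc₀ hC hA0 h
    (m := fun t => ⌊(N : ℝ) * t / 2⌋₊) <| hlogm _ <| by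
      filter_upwards [eventually_ge_atTop 1] with t ht
      have hNt : 1 ≤ (N : ℝ) * t := by nlinarith
      have := Nat.floor_le (a := (N : ℝ) * t / 2) (by positivity)
      have := Nat.lt_floor_add_one ((N : ℝ) * t / 2)
      constructor <;> linarith
  obtain ⟨C₂, hC₂, h2⟩ := eventually_abs_mul_log_pow_sub_le hq0 hc₀ hC hA0 h
    (m := fun t => ⌈2 * (N * t)⌉₊) <| hlogm _ <| by
      filter_upwards [eventually_ge_atTop 1] with t ht
      have hNt : 1 ≤ (N : ℝ) * t := by nlinarith
      have := Nat.le_ceil (2 * ((N : ℝ) * t))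
      have := Nat.ceil_lt_add_one (a := 2 * ((N : ℝ) * t)) (by positivity)
      constructor <;> linarith
  have h3 : ∀ᶠ t : ℝ in atTop, Real.log t ^ (N.choose 2 + 1) ≤ t := by
    filter_upwards [(Real.isLittleO_pow_log_id_atTop (n := N.choose 2 + 1)).bound zero_lt_one,
      eventually_ge_atTop 1] with t ht ht1
    have hl := Real.log_nonneg ht1
    rw [one_mul, Real.norm_of_nonneg (by positivity), id, Real.norm_of_nonneg (by linarith)] at ht
    exact ht
  refine ⟨c₀, C₁ + C₂ + 4, hc₀, ?_⟩
  filter_upwards [h1, h2, h3, eventually_ge_atTop 1,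
    tendsto_log_log_atTop.eventually_ge_atTop 1,
    Real.tendsto_log_atTop.eventually_ge_atTop 1] with t h1 h2 h3 ht h4 h5
  set d := N.choose 2
  set l := Real.log t
  set ε := Real.log l / l
  have ht0 : 0 < t := by linarith
  have hr : ((N * t.toNNReal : ℝ≥0) : ℝ) = N * t := by
    rw [NNReal.coe_mul, NNReal.coe_natCast, Real.coe_toNNReal _ ht0.le]
  have hr0 : 0 < (N * t.toNNReal : ℝ≥0) := by
    rw [← NNReal.coe_pos, hr]; positivity
  have hl0 : 0 < l := by linarith
  have hε0 : 0 ≤ ε := by positivity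
  have hle : 1 / l ≤ ε := (div_le_div_iff_of_pos_right hl0).2 h4
  have hsmall : 1 / (N * t) * l ^ d ≤ ε := by
    refine le_trans ?_ hle
    rw [one_div_mul_eq_div, div_le_div_iff₀ (by positivity) hl0, one_mul, ← pow_succ]
    exact h3.trans (le_mul_of_one_le_left ht0.le hN1)
  have hld : 0 ≤ l ^ d := by positivity
  have u1 := mul_le_mul_of_nonneg_right
    (integral_poissonMeasure_le (survival_antitone x) hq0 hq1 hr0
    (m := ⌊(N : ℝ) * t / 2⌋₊) (by rw [hr]; exact Nat.floor_le (by positivity))) hld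
  have u2 := mul_le_mul_of_nonneg_right
    (le_integral_poissonMeasure (survival_antitone x) hq0 hq1 hr0
    (m := ⌈2 * ((N : ℝ) * t)⌉₊) (by rw [hr]; exact Nat.le_ceil _)) hld
  rw [hr] at u1 u2
  have v1 := (abs_le.1 h1).2
  have v2 := (abs_le.1 h2).1
  have w1 : 0 ≤ C₁ * ε := by positivity
  have w2 : 0 ≤ C₂ * ε := by positivity
  have e4 : 4 / (N * t) * l ^ d = 4 * (1 / (N * t) * l ^ d) := by ring
  rw [add_mul, e4] at u1
  rw [sub_mul] at u2
  rw [abs_le]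
  constructor <;> nlinarith

/-! ### The continuous-time walks on a time grid -/

instance isProbabilityMeasure_srwLaw (t : ℝ≥0) : IsProbabilityMeasure (srwLaw t) :=
  isProbabilityMeasure_bind Measurable.of_discrete.aemeasurable
    (Eventually.of_forall fun _ => PMF.toMeasure.isProbabilityMeasure _)

lemma poissonWeight_mul_le_srwLaw (t : ℝ≥0) (n : ℕ) (z : ℤ × ℤ) :
    poissonWeight t n * (stepsPMF n z).toReal ≤ (srwLaw t).real {z} := by
  have h : (srwLaw t) {z} = ∑' n, (stepsPMF n) z * (poissonMeasure t) {n} := by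
    rw [srwLaw, Measure.bind_apply (MeasurableSet.singleton z) Measurable.of_discrete.aemeasurable,
      lintegral_countable']
    simp only [PMF.toMeasure_apply_singleton _ _ (MeasurableSet.singleton z)]
  rw [Measure.real_def, ← ENNReal.toReal_ofReal (poissonWeight_nonneg t n), ← ENNReal.toReal_mul,
    h, mul_comm]
  refine ENNReal.toReal_mono (h ▸ measure_ne_top _ _) ?_
  rw [poissonWeight, ← poissonMeasure_singleton]
  exact ENNReal.le_tsum (f := fun n => (stepsPMF n) z * (poissonMeasure t) {n}) n

lemma exp_neg_le_srwLaw_zero (t : ℝ≥0) : Real.exp (-t) ≤ (srwLaw t).real {0} := by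
  simpa [poissonWeight, stepsPMF] using poissonWeight_mul_le_srwLaw t 0 0

lemma exp_neg_mul_le_srwLaw (t : ℝ≥0) {e : ℤ × ℤ} (he : e ∈ latticeSteps) :
    Real.exp (-t) * (t / 4) ≤ (srwLaw t).real {e} := by
  have h1 : stepsPMF 1 = stepPMF := by
    simp only [stepsPMF, PMF.pure_bind, zero_add]
    exact PMF.map_id _
  have h2 : (stepPMF e).toReal = 1 / 4 := by
    rw [stepPMF, PMF.uniformOfFinset_apply_of_mem _ (by simpa [latticeSteps] using he)]
    norm_num
  have h := poissonWeight_mul_le_srwLaw t 1 e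
  rw [h1, h2] at h
  refine le_trans (le_of_eq ?_) h
  simp only [poissonWeight, pow_one, Nat.factorial_one, Nat.cast_one]
  ring

/-- The law of the increments of `N` independent walks over a time interval of length `δ`. -/
noncomputable def incrementLaw (N : ℕ) (δ : ℝ≥0) : Measure (Config N) :=
  Measure.pi fun _ => srwLaw δ

instance isProbabilityMeasure_incrementLaw (δ : ℝ≥0) : IsProbabilityMeasure (incrementLaw N δ) := by
  unfold incrementLaw; infer_instance

lemma incrementLaw_real_singleton (δ : ℝ≥0) (w : Config N) :
    (incrementLaw N δ).real {w} = ∏ i, (srwLaw δ).real {w i} := by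
  simp only [Measure.real_def, incrementLaw, Measure.pi_singleton, ENNReal.toReal_prod]

lemma exp_neg_le_incrementLaw_zero (δ : ℝ≥0) :
    Real.exp (-(N * δ : ℝ≥0)) ≤ (incrementLaw N δ).real {0} := by
  rw [incrementLaw_real_singleton]
  calc Real.exp (-(N * δ : ℝ≥0)) = ∏ _i : Fin N, Real.exp (-δ) := by
        rw [Finset.prod_const, Finset.card_univ, Fintype.card_fin, ← Real.exp_nat_mul]
        push_cast; ring_nf
    _ ≤ _ := Finset.prod_le_prod (fun _ _ => (Real.exp_pos _).le)
        fun i _ => exp_neg_le_srwLaw_zero δ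

lemma exp_neg_mul_le_incrementLaw_single (δ : ℝ≥0) (i : Fin N) {e : ℤ × ℤ} (he : e ∈ latticeSteps) :
    Real.exp (-(N * δ : ℝ≥0)) * (δ / 4) ≤ (incrementLaw N δ).real {Pi.single i e} := by
  rw [incrementLaw_real_singleton]
  calc Real.exp (-(N * δ : ℝ≥0)) * (δ / 4)
      = ∏ k : Fin N, Real.exp (-δ) * (if k = i then (δ : ℝ) / 4 else 1) := by
        rw [Finset.prod_mul_distrib, Finset.prod_ite_eq' Finset.univ i, Finset.prod_const,
          Finset.card_univ, Fintype.card_fin, ← Real.exp_nat_mul, if_pos (Finset.mem_univ i)]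
        push_cast; ring_nf
    _ ≤ _ := by
        refine Finset.prod_le_prod (fun k _ => ?_) fun k _ => ?_
        · split_ifs <;> positivity
        · rcases eq_or_ne k i with rfl | hk
          · simpa using exp_neg_mul_le_srwLaw δ he
          · simpa [hk] using exp_neg_le_srwLaw_zero δ

lemma integrable_of_mem_Icc {α : Type*} [MeasurableSpace α] [DiscreteMeasurableSpace α]
    [Countable α] {ν : Measure α} [IsFiniteMeasure ν] {f : α → ℝ}
    (hf : ∀ y, f y ∈ Set.Icc (0 : ℝ) 1) : Integrable f ν :=
  Integrable.of_bound (Measurable.of_discrete.aestronglyMeasurable) 1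
    (Eventually.of_forall fun y => by rw [Real.norm_of_nonneg (hf y).1]; exact (hf y).2)

lemma one_sub_mem_Icc {α : Type*} {f : α → ℝ} (hf : ∀ y, f y ∈ Set.Icc (0 : ℝ) 1) (y : α) :
    1 - f y ∈ Set.Icc (0 : ℝ) 1 :=
  ⟨by linarith [(hf y).2], by linarith [(hf y).1]⟩

lemma one_sub_exp_neg_mul_le {a : ℝ} (ha : 0 ≤ a) : 1 - Real.exp (-a) * (1 + a) ≤ a ^ 2 := by
  nlinarith [Real.add_one_le_exp (-a)]

/-- The left-hand side counts only the paths with at most one jump. -/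
lemma le_integral_incrementLaw [NeZero N] (δ : ℝ≥0) {f : Config N → ℝ}
    (hf : ∀ y, f y ∈ Set.Icc (0 : ℝ) 1) (y : Config N) :
    Real.exp (-(N * δ : ℝ≥0)) * (f y + (N * δ : ℝ≥0) * stepAvg N f y) ≤
      ∫ w, f (y + w) ∂(incrementLaw N δ) := by
  have hN : (N : ℝ) ≠ 0 := Nat.cast_ne_zero.2 (NeZero.ne N)
  have hint : Integrable (fun w => f (y + w)) (incrementLaw N δ) :=
    integrable_of_mem_Icc fun w => hf _
  set S : Finset (Config N) := (Finset.univ ×ˢ latticeSteps).image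
    fun p : Fin N × (ℤ × ℤ) => Pi.single p.1 p.2 with hS
  have hne : ∀ e ∈ latticeSteps, e ≠ 0 := by decide
  have h0 : (0 : Config N) ∉ S := by
    rw [hS, Finset.mem_image]
    rintro ⟨⟨i, e⟩, hp, h⟩
    exact hne e (Finset.mem_product.1 hp).2 (by simpa using h)
  have hinj : Set.InjOn (fun p : Fin N × (ℤ × ℤ) => (Pi.single p.1 p.2 : Config N))
      (Finset.univ ×ˢ latticeSteps : Finset (Fin N × (ℤ × ℤ))) := by
    rintro ⟨i, e⟩ hp ⟨j, e'⟩ - h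
    have he := hne e (Finset.mem_product.1 (Finset.mem_coe.1 hp)).2
    have h1 := congrFun h i
    simp only [Pi.single_eq_same] at h1
    rcases eq_or_ne i j with rfl | hij
    · simpa using h1
    · rw [Pi.single_eq_of_ne hij] at h1
      exact absurd h1 he
  refine le_trans ?_ (setIntegral_le_integral (s := ((insert 0 S : Finset (Config N)) : Set _)) hint
    (Eventually.of_forall fun w => (hf _).1))
  rw [setIntegral_finset _ hint.integrableOn, Finset.sum_insert h0, Finset.sum_image hinj,
    Finset.sum_product, add_zero, mul_add]
  refine add_le_add
    (mul_le_mul_of_nonneg_right (exp_neg_le_incrementLaw_zero δ) (hf y).1) ?_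
  have h1 : Real.exp (-(N * δ : ℝ≥0)) * ((N * δ : ℝ≥0) * stepAvg N f y) =
      ∑ i, ∑ e ∈ latticeSteps, Real.exp (-(N * δ : ℝ≥0)) * (δ / 4) * f (y + Pi.single i e) := by
    simp only [stepAvg_apply, tokenAvg_apply, ← Finset.mul_sum]
    push_cast
    field_simp
  rw [h1]
  exact Finset.sum_le_sum fun i _ => Finset.sum_le_sum fun e he =>
    mul_le_mul_of_nonneg_right (exp_neg_mul_le_incrementLaw_single δ i he) (hf _).1

/-- In a short time, at most one token jumps, up to an error of second order. -/
lemma abs_integral_incrementLaw_sub_le [NeZero N] (δ : ℝ≥0) {f : Config N → ℝ}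
    (hf : ∀ y, f y ∈ Set.Icc (0 : ℝ) 1) (y : Config N) :
    |∫ w, f (y + w) ∂(incrementLaw N δ) -
      Real.exp (-(N * δ : ℝ≥0)) * (f y + (N * δ : ℝ≥0) * stepAvg N f y)| ≤
      ((N * δ : ℝ≥0) : ℝ) ^ 2 := by
  have h1 := le_integral_incrementLaw δ hf y
  have h2 := le_integral_incrementLaw δ (one_sub_mem_Icc hf) y
  have h3 := one_sub_exp_neg_mul_le (N * δ : ℝ≥0).coe_nonneg
  have hint : Integrable (fun w => f (y + w)) (incrementLaw N δ) :=
    integrable_of_mem_Icc fun w => hf _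
  have h4 : stepAvg N (fun z => 1 - f z) y = 1 - stepAvg N f y := by
    have : (fun z => 1 - f z) = (fun _ => 1) - f := rfl
    rw [this, map_sub, stepAvg_one, Pi.sub_apply]
  rw [integral_sub (integrable_const _) hint, h4] at h2
  simp only [integral_const, probReal_univ, smul_eq_mul, mul_one] at h2
  rw [abs_le]
  constructor <;> nlinarith

lemma le_integral_poisson {g : ℕ → ℝ} (hg : ∀ n, g n ∈ Set.Icc (0 : ℝ) 1) (a : ℝ≥0) :
    Real.exp (-a) * (g 0 + a * g 1) ≤ ∫ n, g n ∂(poissonMeasure a) := by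
  have h := sum_le_hasSum {0, 1} (fun i _ => mul_nonneg (poissonWeight_nonneg a i) (hg i).1)
    (hasSum_integral_poissonMeasure_of_le_one (fun n => (hg n).1) (fun n => (hg n).2) a)
  rw [Finset.sum_pair zero_ne_one] at h
  simp only [poissonWeight, pow_zero, pow_one, Nat.factorial_zero, Nat.factorial_one, Nat.cast_one,
    div_one, mul_one] at h
  linarith

/-- At most one jump in a short time, as in `abs_integral_incrementLaw_sub_le`. -/
lemma abs_integral_poisson_sub_le {g : ℕ → ℝ} (hg : ∀ n, g n ∈ Set.Icc (0 : ℝ) 1) (a : ℝ≥0) :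
    |∫ n, g n ∂(poissonMeasure a) - Real.exp (-a) * (g 0 + a * g 1)| ≤ (a : ℝ) ^ 2 := by
  have h1 := le_integral_poisson hg a
  have h2 := le_integral_poisson (one_sub_mem_Icc hg) a
  have h3 := one_sub_exp_neg_mul_le a.coe_nonneg
  rw [integral_sub (integrable_const _) (integrable_of_mem_Icc hg)] at h2
  simp only [integral_const, probReal_univ, smul_eq_mul, mul_one] at h2
  rw [abs_le]
  constructor <;> nlinarith

/-- The probability that the jump chain run at rate `N` survives for a time `s`. -/
noncomputable def contSurvival (s : ℝ≥0) (y : Config N) : ℝ :=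
  ∫ n, survival y 0 n ∂(poissonMeasure (N * s))

lemma survival_mem_Icc [NeZero N] (y : Config N) (n : ℕ) : survival y 0 n ∈ Set.Icc (0 : ℝ) 1 :=
  ⟨survival_nonneg y 0 n, survival_le_one y 0 n⟩

lemma integral_mem_Icc {α : Type*} [MeasurableSpace α] [DiscreteMeasurableSpace α]
    [Countable α] {ν : Measure α} [IsProbabilityMeasure ν] {f : α → ℝ}
    (hf : ∀ y, f y ∈ Set.Icc (0 : ℝ) 1) : ∫ y, f y ∂ν ∈ Set.Icc (0 : ℝ) 1 := by
  refine ⟨integral_nonneg fun y => (hf y).1, ?_⟩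
  refine (integral_mono (integrable_of_mem_Icc hf) (integrable_const (1 : ℝ))
    fun y => (hf y).2).trans_eq ?_
  simp

lemma contSurvival_mem_Icc [NeZero N] (s : ℝ≥0) (y : Config N) :
    contSurvival s y ∈ Set.Icc (0 : ℝ) 1 :=
  integral_mem_Icc (survival_mem_Icc y)

lemma contSurvival_zero (y : Config N) : contSurvival 0 y = alive N y := by
  rw [contSurvival, integral_poissonMeasure, tsum_eq_single 0 (fun n hn => by simp [hn])]
  simp [survival_zero_zero]

lemma contSurvival_of_notMem {y : Config N} (hy : y ∉ collisionFree N) (s : ℝ≥0) :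
    contSurvival s y = 0 := by
  simp [contSurvival, survival_of_notMem hy]

/-- The law of the jump chain is averaged over its first step; by linearity this commutes with the
average over the number of further jumps. -/
lemma integral_survival_succ [NeZero N] (s : ℝ≥0) (y : Config N) :
    ∫ n, survival y 0 (1 + n) ∂(poissonMeasure (N * s)) = killedStep N (contSurvival s) y := by
  by_cases hy : y ∈ collisionFree N
  · have hint : ∀ z : Config N, Integrable (fun n => survival z 0 n) (poissonMeasure (N * s)) :=
      fun z => integrable_of_mem_Icc (survival_mem_Icc z)
    simp only [add_comm 1, survival_zero_succ, killedStep_apply, Set.indicator_of_mem hy,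
      stepAvg_apply, tokenAvg_apply]
    rw [integral_const_mul, integral_finsetSum _ fun i _ =>
      (integrable_finsetSum _ fun e _ => hint _).const_mul _]
    congr 1
    refine Finset.sum_congr rfl fun i _ => ?_
    rw [integral_const_mul, integral_finsetSum _ fun e _ => hint _]
    rfl
  · simp [survival_of_notMem hy, killedStep_apply, hy]

/-- A short time `δ` is split off at the start, in which at most one jump happens up to an error of
second order. -/
lemma abs_contSurvival_add_sub_le [NeZero N] (s δ : ℝ≥0) (y : Config N) :
    |contSurvival (s + δ) y - Real.exp (-(N * δ : ℝ≥0)) *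
      (contSurvival s y + (N * δ : ℝ≥0) * killedStep N (contSurvival s) y)| ≤
      ((N * δ : ℝ≥0) : ℝ) ^ 2 := by
  set g : ℕ → ℝ := fun k => ∫ n, survival y 0 (k + n) ∂(poissonMeasure (N * s))
  have hg : ∀ k, g k ∈ Set.Icc (0 : ℝ) 1 := fun k => integral_mem_Icc fun n => survival_mem_Icc y _
  have h0 : g 0 = contSurvival s y := by simp only [g, zero_add, contSurvival]
  have h1 : g 1 = killedStep N (contSurvival s) y := integral_survival_succ s y
  have h2 : contSurvival (s + δ) y = ∫ k, g k ∂(poissonMeasure (N * δ)) := by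
    rw [contSurvival, mul_add, add_comm, ← poissonMeasure_conv_poissonMeasure,
      integral_conv (integrable_of_mem_Icc (survival_mem_Icc y))]
  rw [h2, ← h0, ← h1]
  exact abs_integral_poisson_sub_le hg _

/-- The transition operator of the walks over a time `δ`, killed if there is a collision at the
start of the time interval. -/
noncomputable def gridStep (N : ℕ) (δ : ℝ≥0) (f : Config N → ℝ) (y : Config N) : ℝ :=
  alive N y * ∫ w, f (y + w) ∂(incrementLaw N δ)

lemma gridStep_mem_Icc {δ : ℝ≥0} {f : Config N → ℝ} (hf : ∀ y, f y ∈ Set.Icc (0 : ℝ) 1)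
    (y : Config N) : gridStep N δ f y ∈ Set.Icc (0 : ℝ) 1 := by
  have h := integral_mem_Icc (ν := incrementLaw N δ) fun w => hf (y + w)
  exact ⟨mul_nonneg (alive_nonneg y) h.1, mul_le_one₀ (alive_le_one y) h.1 h.2⟩

lemma abs_gridStep_sub_gridStep_le {δ : ℝ≥0} {f g : Config N → ℝ} {C : ℝ}
    (hf : ∀ y, f y ∈ Set.Icc (0 : ℝ) 1) (hg : ∀ y, g y ∈ Set.Icc (0 : ℝ) 1)
    (h : ∀ y, |f y - g y| ≤ C) (y : Config N) : |gridStep N δ f y - gridStep N δ g y| ≤ C := by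
  rw [gridStep, gridStep, ← mul_sub, ← integral_sub (integrable_of_mem_Icc fun w => hf _)
    (integrable_of_mem_Icc fun w => hg _), abs_mul, abs_of_nonneg (alive_nonneg y)]
  refine (mul_le_of_le_one_left (abs_nonneg _) (alive_le_one y)).trans ?_
  have := norm_integral_le_of_norm_le_const (μ := incrementLaw N δ) (C := C)
    (f := fun w => f (y + w) - g (y + w)) (Eventually.of_forall fun w => h _)
  simpa using this

/-- The counterpart of `abs_contSurvival_add_sub_le` for the walks on the time grid. -/
lemma abs_gridStep_sub_le [NeZero N] (δ : ℝ≥0) {f : Config N → ℝ}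
    (hf : ∀ y, f y ∈ Set.Icc (0 : ℝ) 1) (hf0 : ∀ y ∉ collisionFree N, f y = 0) (y : Config N) :
    |gridStep N δ f y - Real.exp (-(N * δ : ℝ≥0)) * (f y + (N * δ : ℝ≥0) * killedStep N f y)| ≤
      ((N * δ : ℝ≥0) : ℝ) ^ 2 := by
  by_cases hy : y ∈ collisionFree N
  · rw [gridStep, alive_of_mem hy, one_mul, killedStep_apply, Set.indicator_of_mem hy]
    exact abs_integral_incrementLaw_sub_le δ hf y
  · rw [gridStep, alive_of_notMem hy, hf0 y hy, killedStep_apply, Set.indicator_of_notMem hy]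
    simp only [zero_mul, mul_zero, add_zero, sub_zero, abs_zero]
    positivity

lemma alive_mem_Icc (y : Config N) : alive N y ∈ Set.Icc (0 : ℝ) 1 :=
  ⟨alive_nonneg y, alive_le_one y⟩

lemma gridStep_iterate_mem_Icc (δ : ℝ≥0) (m : ℕ) (y : Config N) :
    (gridStep N δ)^[m] (alive N) y ∈ Set.Icc (0 : ℝ) 1 := by
  induction m generalizing y with
  | zero => exact alive_mem_Icc y
  | succ m ih => rw [Function.iterate_succ_apply']; exact gridStep_mem_Icc ih y

/-- The walks observed on a fine time grid survive like the jump chain run at rate `N`. -/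
lemma abs_contSurvival_sub_gridStep_le [NeZero N] (δ : ℝ≥0) (m : ℕ) (y : Config N) :
    |contSurvival (m * δ) y - (gridStep N δ)^[m] (alive N) y| ≤
      m * (2 * ((N * δ : ℝ≥0) : ℝ) ^ 2) := by
  induction m generalizing y with
  | zero => simp [contSurvival_zero]
  | succ m ih =>
    rw [Function.iterate_succ_apply']
    have e : ((m + 1 : ℕ) : ℝ≥0) * δ = m * δ + δ := by push_cast; ring
    rw [e]
    have h1 := abs_contSurvival_add_sub_le (m * δ) δ y
    have h2 := abs_gridStep_sub_le δ (contSurvival_mem_Icc (m * δ))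
      (fun y hy => contSurvival_of_notMem hy _) y
    have h3 := abs_gridStep_sub_gridStep_le (δ := δ) (contSurvival_mem_Icc (m * δ))
      (gridStep_iterate_mem_Icc δ m) ih y
    rw [abs_le] at h1 h2 h3 ⊢
    rw [Nat.cast_succ]
    constructor <;> linarith [h1.1, h1.2, h2.1, h2.2, h3.1, h3.2]

/-! ### The collision probability of the continuous-time walks -/

section Walks

variable {Ω : Type*}

/-- The positions of the walks after `j` of the increments `D`. -/
def gridPos (y : Config N) (D : Fin N × ℕ → Ω → ℤ × ℤ) (j : ℕ) (ω : Ω) : Config N :=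
  fun i => y i + ∑ l ∈ Finset.range j, D (i, l) ω

lemma gridPos_succ (y : Config N) (D : Fin N × ℕ → Ω → ℤ × ℤ) (j : ℕ) (ω : Ω) :
    gridPos y D (j + 1) ω = gridPos y D j ω + fun i => D (i, j) ω := by
  funext i
  simp only [gridPos, Finset.sum_range_succ, Pi.add_apply, add_assoc]

/-- The event that there is no collision at the times `0, δ, …, m * δ`. -/
def gridEvent (X : Fin N → ℝ≥0 → Ω → ℤ × ℤ) (δ : ℝ≥0) (m : ℕ) : Set Ω :=
  {ω | ∀ j ≤ m, (fun i => X i (j * δ) ω) ∈ collisionFree N}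

lemma antitone_gridEvent (X : Fin N → ℝ≥0 → Ω → ℤ × ℤ) (t : ℝ≥0) :
    Antitone fun n : ℕ => gridEvent X (t / 2 ^ n) (2 ^ n) := by
  refine antitone_nat_of_succ_le fun n ω h j hj => ?_
  have h1 := h (2 * j) (by rw [pow_succ]; omega)
  have e : ((2 * j : ℕ) : ℝ≥0) * (t / 2 ^ (n + 1)) = j * (t / 2 ^ n) := by
    push_cast
    rw [pow_succ]
    field_simp
  rwa [e] at h1

variable [MeasurableSpace Ω] {μ : Measure Ω} {x : Fin N → ℤ × ℤ} {X : Fin N → ℝ≥0 → Ω → ℤ × ℤ}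

lemma measurableSet_gridEvent (hX : IsIndepWalkSystem x X μ) (δ : ℝ≥0) (m : ℕ) :
    MeasurableSet (gridEvent X δ m) := by
  have : gridEvent X δ m = ⋂ j : ℕ, ⋂ _ : j ≤ m,
      (fun ω i => X i (j * δ) ω) ⁻¹' collisionFree N := by
    ext ω; simp [gridEvent]
  rw [this]
  exact MeasurableSet.iInter fun j => MeasurableSet.iInter fun _ =>
    (measurable_pi_lambda _ fun i => (hX.isWalk i).measurable _) (MeasurableSet.of_discrete)

lemma exists_forall_eq_of_rightContinuous {g : ℝ≥0 → ℤ × ℤ} {s : ℝ≥0}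
    (h : ContinuousWithinAt g (Set.Ici s) s) : ∃ ε > 0, ∀ r, s ≤ r → r < s + ε → g r = g s := by
  have h1 : ∀ᶠ r in nhdsWithin s (Set.Ici s), g r = g s :=
    h.eventually (show ∀ᶠ z in nhds (g s), z = g s by simp)
  obtain ⟨ε, hε, h2⟩ := Metric.mem_nhdsWithin_iff.1 h1
  refine ⟨⟨ε, hε.le⟩, hε, fun r hr hr' => h2 ⟨?_, hr⟩⟩
  have hr1 : (s : ℝ) ≤ r := by exact_mod_cast hr
  have hr2 : (r : ℝ) < s + ε := by exact_mod_cast hr'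
  rw [Metric.mem_ball, NNReal.dist_eq, abs_of_nonneg (by linarith)]
  linarith

/-- By right-continuity, a collision is seen at a time of every fine enough dyadic grid. -/
lemma ae_eq_iInter_gridEvent (hX : IsIndepWalkSystem x X μ) (t : ℝ≥0) :
    {ω | ∀ i j, i ≠ j → ∀ s ≤ t, X i s ω ≠ X j s ω} =ᵐ[μ]
      ⋂ n : ℕ, gridEvent X (t / 2 ^ n) (2 ^ n) := by
  filter_upwards [ae_all_iff.2 fun i => (hX.isWalk i).rightContinuous] with ω hω
  refine propext ⟨fun h => ?_, fun h i j hij s hs heq => ?_⟩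
  · refine Set.mem_iInter.2 fun n k hk i j hij => ?_
    by_contra hne
    refine h i j hne _ ?_ hij
    have hk' : (k : ℝ≥0) ≤ 2 ^ n := by exact_mod_cast hk
    calc (k : ℝ≥0) * (t / 2 ^ n) ≤ 2 ^ n * (t / 2 ^ n) := by gcongr
      _ = t := mul_div_cancel₀ _ (by positivity)
  · obtain ⟨ε₁, hε₁, h1⟩ := exists_forall_eq_of_rightContinuous (hω i s)
    obtain ⟨ε₂, hε₂, h2⟩ := exists_forall_eq_of_rightContinuous (hω j s)
    rcases eq_zero_or_pos t with rfl | ht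
    · obtain rfl : s = 0 := le_antisymm hs zero_le
      have h3 := Set.mem_iInter.1 h 0 0 (Nat.zero_le _)
      refine hij (h3 ?_)
      simpa using heq
    obtain ⟨n, hn⟩ := pow_unbounded_of_one_lt (t / min ε₁ ε₂) (one_lt_two (α := ℝ≥0))
    have hε : 0 < min ε₁ ε₂ := lt_min hε₁ hε₂
    set δ := t / 2 ^ n
    have hδ0 : 0 < δ := by positivity
    have hδ : δ < min ε₁ ε₂ := by
      rw [div_lt_iff₀ hε] at hn
      rw [div_lt_iff₀ (by positivity), mul_comm]
      exact hn
    -- `k * δ` is the first time of the grid that is not before the collision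
    set k := ⌈s / δ⌉₊
    have hk1 : s ≤ k * δ := (div_le_iff₀ hδ0).1 (Nat.le_ceil _)
    have hk2 : k * δ < s + δ := by
      have := Nat.ceil_lt_add_one (zero_le (a := s / δ))
      calc k * δ < (s / δ + 1) * δ := by gcongr
        _ = s + δ := by rw [add_mul, div_mul_cancel₀ _ hδ0.ne', one_mul]
    have hk : k ≤ 2 ^ n := by
      refine Nat.ceil_le.2 ?_
      rw [div_le_iff₀ hδ0]
      push_cast
      rw [mul_div_cancel₀ _ (by positivity)]
      exact hs
    have hlt : k * δ < s + min ε₁ ε₂ := hk2.trans (by gcongr)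
    refine hij (Set.mem_iInter.1 h n k hk ?_)
    change X i (k * δ) ω = X j (k * δ) ω
    have e1 := h1 _ hk1 (hlt.trans_le (by gcongr; exact min_le_left _ _))
    have e2 := h2 _ hk1 (hlt.trans_le (by gcongr; exact min_le_right _ _))
    rw [e1, e2, heq]

variable [IsProbabilityMeasure μ]

/-- An independent variable may be replaced by its law; by countability there is no measurability
condition on `Φ`. -/
lemma integral_of_indepFun {α β : Type*} [MeasurableSpace α] [DiscreteMeasurableSpace α]
    [Countable α] [MeasurableSpace β] [DiscreteMeasurableSpace β] [Countable β] {U : Ω → α}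
    {V : Ω → β} {ν : Measure β} [IsProbabilityMeasure ν] (hU : Measurable U) (hV : HasLaw V ν μ)
    (hUV : IndepFun U V μ) {Φ : α → β → ℝ} (hΦ : ∀ a b, Φ a b ∈ Set.Icc (0 : ℝ) 1) :
    ∫ ω, Φ (U ω) (V ω) ∂μ = ∫ ω, ∫ b, Φ (U ω) b ∂ν ∂μ := by
  have h1 := (indepFun_iff_map_prod_eq_prod_map_map hU.aemeasurable hV.aemeasurable).1 hUV
  rw [hV.map_eq] at h1
  have : IsProbabilityMeasure (μ.map U) := Measure.isProbabilityMeasure_map hU.aemeasurable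
  have h2 : ∫ ω, Φ (U ω) (V ω) ∂μ = ∫ p, Φ p.1 p.2 ∂(μ.map fun ω => (U ω, V ω)) :=
    (integral_map (f := fun p : α × β => Φ p.1 p.2) (hU.aemeasurable.prodMk hV.aemeasurable)
      Measurable.of_discrete.aestronglyMeasurable).symm
  rw [h2, h1, integral_prod _ (integrable_of_mem_Icc fun p => hΦ _ _),
    integral_map hU.aemeasurable Measurable.of_discrete.aestronglyMeasurable]

/-- The Markov property on a time grid: the last increment is integrated out first. -/
lemma integral_gridPos {D : Fin N × ℕ → Ω → ℤ × ℤ} {δ : ℝ≥0} (hD : ∀ p, Measurable (D p))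
    (hind : iIndepFun D μ) (hlaw : ∀ p, HasLaw (D p) (srwLaw δ) μ) (y : Config N) (m : ℕ)
    {f : Config N → ℝ} (hf : ∀ z, f z ∈ Set.Icc (0 : ℝ) 1) :
    ∫ ω, (∏ j ∈ Finset.range m, alive N (gridPos y D j ω)) * f (gridPos y D m ω) ∂μ =
      (gridStep N δ)^[m] f y := by
  induction m generalizing f with
  | zero =>
    have h0 : ∀ ω, gridPos y D 0 ω = y := fun ω => by funext i; simp [gridPos]
    simp [h0]
  | succ m ih =>
    rw [Function.iterate_succ_apply, ← ih (gridStep_mem_Icc hf)]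
    set S : Finset (Fin N × ℕ) := Finset.univ ×ˢ Finset.range m
    set T : Finset (Fin N × ℕ) := Finset.univ ×ˢ {m}
    have hST : Disjoint S T := Finset.disjoint_product.2 (Or.inr (by simp))
    have hT : ∀ i, (i, m) ∈ T := fun i => by simp [T]
    -- the positions up to time `m` as functions of the increments before time `m`
    let pos : ℕ → (S → ℤ × ℤ) → Config N := fun j u i =>
      y i + ∑ l ∈ Finset.range j, if h : (i, l) ∈ S then u ⟨(i, l), h⟩ else 0
    have hpos : ∀ j ≤ m, ∀ ω, pos j (fun p => D p ω) = gridPos y D j ω := by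
      intro j hj ω
      funext i
      simp only [pos, gridPos]
      congr 1
      refine Finset.sum_congr rfl fun l hl => dif_pos ?_
      have := Finset.mem_range.1 hl
      simp only [S, Finset.mem_product, Finset.mem_univ, Finset.mem_range, true_and]
      omega
    have hindm : IndepFun (fun ω (p : S) => D p ω) (fun ω i => D (i, m) ω) μ :=
      (hind.indepFun_finset S T hST hD).comp (φ := id)
        (ψ := fun (v : T → ℤ × ℤ) (i : Fin N) => v ⟨(i, m), hT i⟩)
        measurable_id (measurable_pi_lambda _ fun i => measurable_pi_apply _)
    have hlawm : HasLaw (fun ω i => D (i, m) ω) (incrementLaw N δ) μ :=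
      iIndepFun.hasLaw_pi (fun i => hlaw (i, m))
        (hind.precomp (g := fun i : Fin N => (i, m)) fun i j h => by simpa using h)
    set Φ : (S → ℤ × ℤ) → Config N → ℝ := fun u w =>
      (∏ j ∈ Finset.range (m + 1), alive N (pos j u)) * f (pos m u + w)
    have hprod : ∀ k u, ∏ j ∈ Finset.range k, alive N (pos j u) ∈ Set.Icc (0 : ℝ) 1 := fun k u =>
      ⟨Finset.prod_nonneg fun j _ => alive_nonneg _,
        Finset.prod_le_one (fun j _ => alive_nonneg _) fun j _ => alive_le_one _⟩
    have hΦ : ∀ u w, Φ u w ∈ Set.Icc (0 : ℝ) 1 := fun u w =>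
      ⟨mul_nonneg (hprod _ u).1 (hf _).1, mul_le_one₀ (hprod _ u).2 (hf _).1 (hf _).2⟩
    -- the increment over the last cell is independent of the earlier ones and is replaced by its
    -- law
    have key := integral_of_indepFun (measurable_pi_lambda _ fun p : S => hD p) hlawm hindm hΦ
    have hl : ∀ ω, Φ (fun p => D p ω) (fun i => D (i, m) ω) =
        (∏ j ∈ Finset.range (m + 1), alive N (gridPos y D j ω)) * f (gridPos y D (m + 1) ω) := by
      intro ω
      simp only [Φ]
      rw [hpos m le_rfl, ← gridPos_succ]
      congr 1
      exact Finset.prod_congr rfl fun j hj => by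
        rw [hpos j (by have := Finset.mem_range.1 hj; omega)]
    have hr : ∀ ω, ∫ w, Φ (fun p => D p ω) w ∂(incrementLaw N δ) =
        (∏ j ∈ Finset.range m, alive N (gridPos y D j ω)) * gridStep N δ f (gridPos y D m ω) := by
      intro ω
      simp only [Φ]
      rw [integral_const_mul, hpos m le_rfl, Finset.prod_range_succ, mul_assoc, hpos m le_rfl]
      congr 1
      exact Finset.prod_congr rfl fun j hj => by rw [hpos j (Finset.mem_range.1 hj).le]
    simpa only [hl, hr] using key

/-- The increments over the cells of the grid are independent with law `srwLaw δ`, so the walks on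
the grid are a Markov chain with killed transition operator `gridStep`. -/
lemma measureReal_gridEvent (hX : IsIndepWalkSystem x X μ) (δ : ℝ≥0) (m : ℕ) :
    μ.real (gridEvent X δ m) = (gridStep N δ)^[m] (alive N) x := by
  set D : Fin N × ℕ → Ω → ℤ × ℤ := fun p ω => X p.1 ((p.2 + 1 : ℕ) * δ) ω - X p.1 (p.2 * δ) ω
  have hmono : Monotone fun j : ℕ => (j : ℝ≥0) * δ := fun a b h => by
    exact mul_le_mul_of_nonneg_right (by exact_mod_cast h) zero_le
  have hD : ∀ p, Measurable (D p) := fun p =>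
    ((hX.isWalk p.1).measurable _).sub ((hX.isWalk p.1).measurable _)
  have hlaw : ∀ p, HasLaw (D p) (srwLaw δ) μ := by
    intro p
    have h := (hX.isWalk p.1).increment_law (p.2 * δ) ((p.2 + 1 : ℕ) * δ) (hmono (Nat.le_succ _))
    rwa [Nat.cast_succ, add_mul, one_mul, add_tsub_cancel_left, ← add_one_mul,
      ← Nat.cast_succ] at h
  have hind : iIndepFun D μ := by
    refine iIndepFun_uncurry' (X := fun i j => D (i, j)) (fun i j => hD (i, j)) ?_
      fun i => (hX.isWalk i).indepIncrements.nat hmono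
    exact hX.indep.comp (fun _ (path : ℝ≥0 → ℤ × ℤ) (j : ℕ) =>
      path ((j + 1 : ℕ) * δ) - path (j * δ)) fun _ => measurable_pi_lambda _ fun j =>
        (measurable_pi_apply _).sub (measurable_pi_apply _)
  rw [← integral_gridPos hD hind hlaw x m alive_mem_Icc,
    ← integral_indicator_one (measurableSet_gridEvent hX δ m)]
  refine integral_congr_ae ?_
  filter_upwards [ae_all_iff.2 fun i => (hX.isWalk i).start] with ω hω
  have hpos : ∀ j, gridPos x D j ω = fun i => X i (j * δ) ω := by
    intro j
    funext i
    have := Finset.sum_range_sub (fun l : ℕ => X i (l * δ) ω) j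
    simp only [gridPos, D]
    rw [this, Nat.cast_zero, zero_mul, hω i]
    abel
  rw [← Finset.prod_range_succ (fun j => alive N (gridPos x D j ω))]
  by_cases h : ω ∈ gridEvent X δ m
  · rw [Set.indicator_of_mem h, Pi.one_apply]
    refine (Finset.prod_eq_one fun j hj => ?_).symm
    rw [hpos, alive_of_mem (h j (by have := Finset.mem_range.1 hj; omega))]
  · rw [Set.indicator_of_notMem h]
    simp only [gridEvent, Set.mem_ofPred_eq, not_forall] at h
    obtain ⟨j, hj, hc⟩ := h
    refine (Finset.prod_eq_zero (Finset.mem_range.2 (by omega : j < m + 1)) ?_).symm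
    rw [hpos, alive_of_notMem hc]

/-- The walks survive until time `t` like the jump chain with a Poisson number of steps, of mean
`N * t`: both are limits of the iterates of `gridStep` along the dyadic grids of `[0, t]`. -/
theorem nonCollisionProb_eq_contSurvival [NeZero N] (hX : IsIndepWalkSystem x X μ) (t : ℝ≥0) :
    nonCollisionProb X μ t = contSurvival t x := by
  have h1 : Tendsto (fun n : ℕ => μ.real (gridEvent X (t / 2 ^ n) (2 ^ n))) atTop
      (nhds (nonCollisionProb X μ t)) := by
    have h := tendsto_measure_iInter_atTop (μ := μ)
      (fun n => (measurableSet_gridEvent hX (t / 2 ^ n) (2 ^ n)).nullMeasurableSet)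
      (antitone_gridEvent X t) ⟨0, measure_ne_top _ _⟩
    rw [← measure_congr (ae_eq_iInter_gridEvent hX t)] at h
    exact (ENNReal.tendsto_toReal (measure_ne_top _ _)).comp h
  refine tendsto_nhds_unique h1 ?_
  rw [tendsto_iff_dist_tendsto_zero]
  have h2 : Tendsto (fun n : ℕ => 2 * ((N * t : ℝ≥0) : ℝ) ^ 2 * (1 / 2 : ℝ) ^ n) atTop
      (nhds 0) := by
    simpa using (tendsto_pow_atTop_nhds_zero_of_lt_one (by norm_num : (0 : ℝ) ≤ 1 / 2)
      (by norm_num)).const_mul (2 * ((N * t : ℝ≥0) : ℝ) ^ 2)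
  -- `2 ^ n` steps, each with an error of order `4 ^ (-n)`
  refine squeeze_zero (fun _ => dist_nonneg) (fun n => ?_) h2
  have h3 := abs_contSurvival_sub_gridStep_le (t / 2 ^ n) (2 ^ n) x
  have e : ((2 ^ n : ℕ) : ℝ≥0) * (t / 2 ^ n) = t := by
    push_cast
    exact mul_div_cancel₀ _ (by positivity)
  rw [e] at h3
  rw [dist_comm, Real.dist_eq, measureReal_gridEvent hX]
  refine h3.trans_eq ?_
  push_cast
  rw [one_div, inv_pow]
  field_simp

end Walks

end KilledChain

/-! ### Rate of decay of the non-collision probability -/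

theorem mainTheorem3 (N : ℕ) (x : Fin N → ℤ × ℤ) (hx : Function.Injective x) :
    ∃ c₀ : ℝ, 0 < c₀ ∧ ∃ E : ℝ → ℝ,
      E =O[atTop] (fun t => Real.log (Real.log t) / Real.log t) ∧
      ∀ (Ω : Type*) [MeasurableSpace Ω] (μ : Measure Ω) [IsProbabilityMeasure μ]
        (X : Fin N → ℝ≥0 → Ω → ℤ × ℤ), IsIndepWalkSystem x X μ →
        ∀ t : ℝ≥0, 1 < t →
          nonCollisionProb X μ t =
            c₀ * Real.log t ^ (-(N.choose 2 : ℤ)) * (1 + E t) := by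
  rcases Nat.eq_zero_or_pos N with rfl | hN
  · -- there is no pair of walkers
    refine ⟨1, one_pos, fun _ => 0, Asymptotics.isBigO_zero _ _, fun Ω _ μ _ X _ t _ => ?_⟩
    have h : {ω | ∀ i j : Fin 0, i ≠ j → ∀ s ≤ t, X i s ω ≠ X j s ω} = Set.univ :=
      Set.eq_univ_of_forall fun ω i => i.elim0
    rw [nonCollisionProb, h]
    simp
  have : NeZero N := ⟨hN.ne'⟩
  obtain ⟨c₀, C, hc₀, h⟩ := exists_poissonized_asymptotics (x := x) hx
  -- the relative error is defined by the asserted equation, so that only its size is in question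
  refine ⟨c₀, hc₀, fun t => contSurvival t.toNNReal x * Real.log t ^ (N.choose 2) / c₀ - 1, ?_,
    fun Ω _ μ _ X hX t ht => ?_⟩
  · refine Asymptotics.IsBigO.of_bound (C / c₀) ?_
    filter_upwards [h, tendsto_log_log_atTop.eventually_ge_atTop 0,
      Real.tendsto_log_atTop.eventually_ge_atTop 0] with t ht h0 h1
    rw [Real.norm_eq_abs, Real.norm_of_nonneg (div_nonneg h0 h1), div_mul_eq_mul_div,
      le_div_iff₀ hc₀, ← abs_of_pos hc₀, ← abs_mul, abs_of_pos hc₀]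
    refine (le_of_eq (congrArg _ ?_)).trans ht
    rw [sub_mul, div_mul_cancel₀ _ hc₀.ne', one_mul]
    rfl
  · have hlog : Real.log t ≠ 0 := (Real.log_pos (by exact_mod_cast ht)).ne'
    beta_reduce
    rw [nonCollisionProb_eq_contSurvival hX, Real.toNNReal_coe, zpow_neg, zpow_natCast]
    field_simp
    ring
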